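/- Let $d\ge 1$, let $v_1,v_2\in\mathbb R^d$ and $\Gamma_1,\Gamma_2,W_1,W_2\in\mathbb R^{d\times d}$, and put $h_i(\theta,w)=v_i-\Gamma_i\theta-W_iw$ for $i=1,2$. Assume that $W_2$ and $X_1=\Gamma_1-W_1W_2^{-1}\Gamma_2$ are positive definite (not necessarily symmetric: $x^\top Ax>0$ for all $x\ne0$). Let $1>\alpha>\beta>0$, $\alpha_n=(n+1)^{-\alpha}$, $\beta_n=(n+1)^{-\beta}$, $\theta^*=X_1^{-1}(v_1-W_1W_2^{-1}v_2)$ and $w^*=W_2^{-1}(v_2-\Gamma_2\theta^*)$. Consider the linear two-timescale stochastic approximation $$\theta_{n+1}=\theta_n+\alpha_n\big[h_1(\theta_n,w_n)+M^{(1)}_{n+1}\big],\qquad w_{n+1}=w_n+\beta_n\big[h_2(\theta_n,w_n)+M^{(2)}_{n+1}\big],\qquad n\ge0,$$ where the noise consists of $(\theta_n,w_n)$-dominated martingale differences with parameters $m_1,m_2$: with $\mathcal F_n=\sigma(\theta_0,w_0,M^{(1)}_1,M^{(2)}_1,\dots,M^{(1)}_n,M^{(2)}_n)$, for $i=1,2$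 and all $n\ge0$, $M^{(i)}_{n+1}$ is integrable, $\mathbb E[M^{(i)}_{n+1}\mid\mathcal F_n]=0$ and $\|M^{(i)}_{n+1}\|\le m_i(1+\|\theta_n\|+\|w_n\|)$ almost surely. For real random variables $X_n$ and $\gamma_n>0$, write $X_n=\Omega_p(\gamma_n)$ if for every $\epsilon>0$ there are constants $c>0$ and $K$ such that $\Pr\{|X_n|/\gamma_n<c\}\le\epsilon$ for all $n\ge K$. Say that the *lower bounds hold* if $$\|\theta_n-\theta^*\|=\Omega_p(n^{-\alpha/2}),\qquad \|w_n-w^*\|=\Omega_p(n^{-\beta/2}),$$ and, moreover, for every $C\in(0,\infty)$ and every positive sequence $g_n\to0$, $$\lim_{n\to\infty}\Pr\{\|\theta_n-\theta^*\|\le Cn^{-\alpha/2}g_n\}=0,\qquad \lim_{n\to\infty}\Pr\{\|w_n-w^*\|\le Cn^{-\beta/2}g_n\}=0.$$ Say that the noise satisfies $\mathcal A_3$ if it is square integrable and there is a (deterministic) positive definite matrix $\Gamma\in\mathbb R^{2d\times 2d}$ such that, almost surely, $$\lim_{n\to\infty}\mathbb E\left[\begin{pmatrix}M^{(1)}_{n+1}\\M^{(2)}_{n+1}\end{pmatrix}\begin{pmatrix}M^{(1)}_{n+1}\\M^{(2)}_{n+1}\end{pmatrix}^{\!\top}\,\middle|\,\mathcal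 F_n\right]=\Gamma.$$ Then: 1. For all $m_1,m_2>0$ and all deterministic initial values $\theta_0,w_0\in\mathbb R^d$ there is an algorithm of the above form, started at $(\theta_0,w_0)$, whose noise consists of $(\theta_n,w_n)$-dominated martingale differences with parameters $m_1,m_2$ and satisfies $\mathcal A_3$, and for which the lower bounds hold. 2. For every algorithm of the above form (with possibly random $\theta_0,w_0$) whose noise consists of $(\theta_n,w_n)$-dominated martingale differences with some parameters $m_1,m_2$ and satisfies $\mathcal A_3$, the lower bounds hold. -/

import Mathlib

open MeasureTheory Filter Topology

universe u

noncomputable section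

/-- `ℝᵈ` with its Euclidean norm. -/
abbrev Vec (d : ℕ) := EuclideanSpace ℝ (Fin d)

/-- The matrix-vector product on `ℝᵈ` with its Euclidean norm. -/
def mulV {d : ℕ} (A : Matrix (Fin d) (Fin d) ℝ) (x : Vec d) : Vec d :=
  WithLp.toLp 2 (A.mulVec x.ofLp)

/-- A real square matrix that is positive definite but not necessarily symmetric:
`xᵀ A x > 0` for every `x ≠ 0`. -/
def IsPosDefNonsymm {d : ℕ} (A : Matrix (Fin d) (Fin d) ℝ) : Prop :=
  ∀ x : Fin d → ℝ, x ≠ 0 → 0 < dotProduct x (A.mulVec x)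

/-- The data of a linear two-timescale problem in dimension `d`. -/
structure LinearProblem (d : ℕ) where
  v₁ : Vec d
  v₂ : Vec d
  Γ₁ : Matrix (Fin d) (Fin d) ℝ
  Γ₂ : Matrix (Fin d) (Fin d) ℝ
  W₁ : Matrix (Fin d) (Fin d) ℝ
  W₂ : Matrix (Fin d) (Fin d) ℝ

namespace LinearProblem

variable {d : ℕ} (S : LinearProblem d)

/-- `h₁(θ, w) = v₁ - Γ₁ θ - W₁ w`. -/
def h₁ (θ w : Vec d) : Vec d := S.v₁ - mulV S.Γ₁ θ - mulV S.W₁ w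

/-- `h₂(θ, w) = v₂ - Γ₂ θ - W₂ w`. -/
def h₂ (θ w : Vec d) : Vec d := S.v₂ - mulV S.Γ₂ θ - mulV S.W₂ w

/-- `X₁ = Γ₁ - W₁ W₂⁻¹ Γ₂`. -/
def X₁ : Matrix (Fin d) (Fin d) ℝ := S.Γ₁ - S.W₁ * S.W₂⁻¹ * S.Γ₂

/-- `b₁ = v₁ - W₁ W₂⁻¹ v₂`. -/
def b₁ : Vec d := S.v₁ - mulV (S.W₁ * S.W₂⁻¹) S.v₂

/-- `θ* = X₁⁻¹ b₁`. -/
def θstar : Vec d := mulV S.X₁⁻¹ S.b₁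

/-- `w* = W₂⁻¹ (v₂ - Γ₂ θ*)`. -/
def wstar : Vec d := mulV S.W₂⁻¹ (S.v₂ - mulV S.Γ₂ S.θstar)

/-- The matrix assumption: `W₂` and `X₁` are positive definite (not necessarily symmetric). -/
def MatrixAssumption : Prop := IsPosDefNonsymm S.W₂ ∧ IsPosDefNonsymm S.X₁

/-- The processes `θ`, `w` are the iterates of the two-timescale recursion for the problem `S`
with stepsizes `αₙ = (n+1)^(-α)`, `βₙ = (n+1)^(-β)` and noise `M₁`, `M₂`
(the values `M₁ 0`, `M₂ 0` are not used). -/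
def IsIterates {Ω : Type*} (α β : ℝ) (θ w M₁ M₂ : ℕ → Ω → Vec d) : Prop :=
  ∀ (n : ℕ) (ω : Ω),
    θ (n + 1) ω = θ n ω + ((n : ℝ) + 1) ^ (-α) • (S.h₁ (θ n ω) (w n ω) + M₁ (n + 1) ω) ∧
    w (n + 1) ω = w n ω + ((n : ℝ) + 1) ^ (-β) • (S.h₂ (θ n ω) (w n ω) + M₂ (n + 1) ω)

end LinearProblem

/-- `ℱₙ = σ(θ₀, w₀, M₁ 1, M₂ 1, …, M₁ n, M₂ n)`. -/
@[reducible] def noiseSigma {Ω : Type*} {d : ℕ} (θ₀ w₀ : Ω → Vec d) (M₁ M₂ : ℕ → Ω → Vec d) (n : ℕ) :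
    MeasurableSpace Ω :=
  MeasurableSpace.comap θ₀ inferInstance ⊔ MeasurableSpace.comap w₀ inferInstance ⊔
    ⨆ k ∈ Finset.Icc 1 n,
      (MeasurableSpace.comap (M₁ k) inferInstance ⊔ MeasurableSpace.comap (M₂ k) inferInstance)

/-- `(Mᵢ n)`, `n ≥ 1`, are `(θₙ, wₙ)`-dominated martingale differences with parameters
`m₁`, `m₂`, with respect to `ℱₙ = σ(θ₀, w₀, M₁ 1, M₂ 1, …, M₁ n, M₂ n)`. -/
structure IsDominatedMartingaleDiff {Ω : Type*} [MeasurableSpace Ω] (P : Measure Ω) {d : ℕ}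
    (θ w M₁ M₂ : ℕ → Ω → Vec d) (m₁ m₂ : ℝ) : Prop where
  measurable_θ₀ : Measurable (θ 0)
  measurable_w₀ : Measurable (w 0)
  measurable₁ : ∀ n, Measurable (M₁ (n + 1))
  measurable₂ : ∀ n, Measurable (M₂ (n + 1))
  integrable₁ : ∀ n, Integrable (M₁ (n + 1)) P
  integrable₂ : ∀ n, Integrable (M₂ (n + 1)) P
  condExp₁ : ∀ n, P[M₁ (n + 1) | noiseSigma (θ 0) (w 0) M₁ M₂ n] =ᵐ[P] 0
  condExp₂ : ∀ n, P[M₂ (n + 1) | noiseSigma (θ 0) (w 0) M₁ M₂ n] =ᵐ[P] 0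
  bound₁ : ∀ n, ∀ᵐ ω ∂P, ‖M₁ (n + 1) ω‖ ≤ m₁ * (1 + ‖θ n ω‖ + ‖w n ω‖)
  bound₂ : ∀ n, ∀ᵐ ω ∂P, ‖M₂ (n + 1) ω‖ ≤ m₂ * (1 + ‖θ n ω‖ + ‖w n ω‖)

/-- The coordinates of the stacked noise vector `(M₁ n, M₂ n) ∈ ℝ²ᵈ`. -/
def stackedNoise {Ω : Type*} {d : ℕ} (M₁ M₂ : ℕ → Ω → Vec d) (n : ℕ) (ω : Ω) :
    Fin d ⊕ Fin d → ℝ :=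
  Sum.elim (M₁ n ω).ofLp (M₂ n ω).ofLp

/-- The noise is square integrable and its conditional covariance matrix
`E[(M₁ (n+1), M₂ (n+1)) (M₁ (n+1), M₂ (n+1))ᵀ | ℱₙ]` converges almost surely, as `n → ∞`, to a
deterministic positive definite matrix. -/
def HasLimitCondCov {Ω : Type*} [MeasurableSpace Ω] (P : Measure Ω) {d : ℕ}
    (θ w M₁ M₂ : ℕ → Ω → Vec d) : Prop :=
  (∀ n, MemLp (M₁ (n + 1)) 2 P ∧ MemLp (M₂ (n + 1)) 2 P) ∧
  ∃ Γ : Matrix (Fin d ⊕ Fin d) (Fin d ⊕ Fin d) ℝ, Γ.PosDef ∧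
    ∀ i j, ∀ᵐ ω ∂P, Tendsto
      (fun n : ℕ => (P[fun ω' => stackedNoise M₁ M₂ (n + 1) ω' i * stackedNoise M₁ M₂ (n + 1) ω' j |
        noiseSigma (θ 0) (w 0) M₁ M₂ n]) ω)
      atTop (𝓝 (Γ i j))

/-- `Xₙ = Ω_p(γₙ)`: for every `ε > 0` there are `c > 0` and `K` with
`Pr{|Xₙ| / γₙ < c} ≤ ε` for all `n ≥ K`. -/
def IsOmegaP {Ω : Type*} [MeasurableSpace Ω] (P : Measure Ω) (X : ℕ → Ω → ℝ) (γ : ℕ → ℝ) : Prop :=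
  ∀ ε : ℝ, 0 < ε → ∃ c : ℝ, 0 < c ∧ ∃ K : ℕ, ∀ n ≥ K, P.real {ω | |X n ω| / γ n < c} ≤ ε

/-- No rate of smaller order than `γₙ` holds for `Xₙ` with non-vanishing probability: for every
constant `C > 0` and every positive sequence `gₙ → 0`, `Pr{Xₙ ≤ C γₙ gₙ} → 0`. -/
def NoFasterRate {Ω : Type*} [MeasurableSpace Ω] (P : Measure Ω) (X : ℕ → Ω → ℝ) (γ : ℕ → ℝ) :
    Prop :=
  ∀ C : ℝ, 0 < C → ∀ g : ℕ → ℝ, (∀ n, 0 < g n) → Tendsto g atTop (𝓝 0) →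
    Tendsto (fun n => P.real {ω | X n ω ≤ C * γ n * g n}) atTop (𝓝 0)

/-- The lower bounds for the iterates: `‖θₙ - θ*‖ = Ω_p(n^(-α/2))`, `‖wₙ - w*‖ = Ω_p(n^(-β/2))`,
and no faster rate holds for either of the two errors. -/
def LowerBounds {Ω : Type*} [MeasurableSpace Ω] (P : Measure Ω) {d : ℕ} (S : LinearProblem d)
    (α β : ℝ) (θ w : ℕ → Ω → Vec d) : Prop :=
  IsOmegaP P (fun n ω => ‖θ n ω - S.θstar‖) (fun n => (n : ℝ) ^ (-(α / 2))) ∧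
  IsOmegaP P (fun n ω => ‖w n ω - S.wstar‖) (fun n => (n : ℝ) ^ (-(β / 2))) ∧
  NoFasterRate P (fun n ω => ‖θ n ω - S.θstar‖) (fun n => (n : ℝ) ^ (-(α / 2))) ∧
  NoFasterRate P (fun n ω => ‖w n ω - S.wstar‖) (fun n => (n : ℝ) ^ (-(β / 2)))

end

/-! The lower bound comes from the noise injected in the last few steps. Take a scalar recursion `Q
(n+1) = Q n + γₙ (D n + ξ n)` with `γₙ` of order `n^(-γ)` and `E|D n| = O(n^(-γ/2))`, and look back
over a window of about `δ n^γ` steps. Wherever `Q` stands at the start of the window, the noise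
collected inside it is nearly Gaussian with standard deviation of order at least `√δ n^(-γ/2)`,
whereas the drift moves `Q` by only `O(δ n^(-γ/2))`. For small `δ` the noise wins, and `Q n` puts
little mass within `c n^(-γ/2)` of `0` (`IsAsymptoticNoise.anticoncentration`). No central limit
theorem is needed: an upper bound on the modulus of the characteristic function suffices. It is
obtained by replacing one noise term at a time by a Gaussian factor (`norm_integral_exp_sum_le`),
and `measureReal_abs_le_le_integral_charFun` turns it into a bound on the mass near `0`.

The drift must therefore be of the order of the error itself. Write `x = θ - θ*`, `y = w - w*`. The
drift of `x` contains the fast error, of order `βₙ^(1/2)`, much larger than `αₙ^(1/2)`. The remedy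
is the change of variables `z = y + W₂⁻¹ Γ₂ x`, `p = x - (αₙ/βₙ) W₁ W₂⁻¹ z`, after which every
coupling term carries a factor `αₙ/βₙ` (`fast_succ`, `slow_succ`, `norm_coupling_le`). A Lyapunov
argument then gives `E‖p‖² = O(αₙ)` and `E‖z‖² = O(βₙ)` (`mean_square_rates`), hence the required
drift bound. Since `x - p` and `y - z` are of smaller order than `αₙ^(1/2)` and `βₙ^(1/2)`,
anti-concentration passes back to `x` and `y`.

The noise of `p` and of `z` in a fixed direction is a linear combination of the stacked noise whose
coefficients have a nonzero limit `a'`. Its limiting conditional variance `a'ᵀ Γ a'` is positive by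
`𝒜₃`; domination and the mean-square rates upgrade the almost sure convergence to `L¹`. Initial
values without moments are handled by restricting the measure to an `ℱ₀`-event on which they are
bounded, which is why the lemmas speak of measures of mass at most `1`. For the existence claim,
independent random signs serve as noise. -/

noncomputable section

/-! ### Polynomial step sizes and deterministic rate recursions. -/

/-- The polynomial step size `(n+1)^(-γ)`. -/
def pstep (γ : ℝ) (n : ℕ) : ℝ := ((n : ℝ) + 1) ^ (-γ)

lemma pstep_pos (γ : ℝ) (n : ℕ) : 0 < pstep γ n := Real.rpow_pos_of_pos (by positivity) _

lemma pstep_le_one {γ : ℝ} (hγ : 0 ≤ γ) (n : ℕ) : pstep γ n ≤ 1 :=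
  Real.rpow_le_one_of_one_le_of_nonpos (by linarith [(Nat.cast_nonneg n : (0 : ℝ) ≤ n)]) (by linarith)

lemma pstep_anti {γ : ℝ} (hγ : 0 ≤ γ) {m n : ℕ} (h : m ≤ n) : pstep γ n ≤ pstep γ m := by
  have : (m : ℝ) ≤ n := by exact_mod_cast h
  exact Real.rpow_le_rpow_of_nonpos (by positivity) (by linarith) (by linarith)

lemma pstep_add (a b : ℝ) (n : ℕ) : pstep (a + b) n = pstep a n * pstep b n := by
  unfold pstep
  rw [← Real.rpow_add (by positivity)]
  ring_nf

lemma pstep_one (n : ℕ) : pstep 1 n = 1 / ((n : ℝ) + 1) := by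
  unfold pstep
  rw [Real.rpow_neg_one, one_div]

lemma tendsto_pstep {γ : ℝ} (hγ : 0 < γ) : Tendsto (pstep γ) atTop (𝓝 0) :=
  (tendsto_rpow_neg_atTop hγ).comp
    (tendsto_atTop_add_const_right _ 1 tendsto_natCast_atTop_atTop)

lemma eventually_pstep_le {a b : ℝ} (hab : a < b) {c : ℝ} (hc : 0 < c) :
    ∀ᶠ n in atTop, pstep b n ≤ c * pstep a n := by
  filter_upwards [(tendsto_pstep (sub_pos.2 hab)).eventually_le_const hc] with n hn
  have : pstep b n = pstep (b - a) n * pstep a n := by rw [← pstep_add]; ring_nf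
  rw [this]
  exact mul_le_mul_of_nonneg_right hn (pstep_pos _ _).le

/-- The ratio of consecutive steps is `(1 + x)^(-γ) = exp (-γ log (1 + x))` with `x = 1/(n+1)`; then
`exp t ≥ 1 + t` and `log (1 + x) ≤ x`. A relative loss of `O(1/n)` per step is negligible against a
contraction `c γₙ`, as `γ < 1`. -/
lemma pstep_succ_ge {γ : ℝ} (hγ : 0 ≤ γ) (n : ℕ) :
    pstep γ n * (1 - γ * pstep 1 n) ≤ pstep γ (n + 1) := by
  have hn : (0 : ℝ) < (n : ℝ) + 1 := by positivity
  have h1 : pstep γ (n + 1) = pstep γ n * (1 + 1 / ((n : ℝ) + 1)) ^ (-γ) := by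
    unfold pstep
    rw [← Real.mul_rpow hn.le (by positivity)]
    congr 1
    push_cast
    field_simp
  rw [h1, pstep_one]
  refine mul_le_mul_of_nonneg_left ?_ (pstep_pos _ _).le
  have h2 : (0 : ℝ) < 1 + 1 / ((n : ℝ) + 1) := by positivity
  rw [Real.rpow_def_of_pos h2]
  have h3 := Real.add_one_le_exp (Real.log (1 + 1 / ((n : ℝ) + 1)) * -γ)
  have h4 := Real.log_le_sub_one_of_pos h2
  nlinarith

/-- A perturbed contraction with step size `γₙ` and forcing `γₙ κₙ` is `O(κₙ)`. -/
lemma rate_of_contraction {γ κ c C : ℝ} (hγ0 : 0 < γ) (hγ : γ < 1) (hκ : 0 < κ) (hc : 0 < c)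
    {a : ℕ → ℝ}
    (h : ∀ᶠ n in atTop, a (n + 1) ≤ (1 - c * pstep γ n) * a n + C * (pstep γ n * pstep κ n)) :
    ∃ K, 0 < K ∧ ∀ n, a n ≤ K * pstep κ n := by
  have e1 : ∀ᶠ n in atTop, pstep γ n ≤ 1 / c := (tendsto_pstep hγ0).eventually_le_const (by positivity)
  have e2 := eventually_pstep_le hγ (c := c / 2 / κ) (by positivity)
  obtain ⟨N, hN⟩ := eventually_atTop.1 (h.and (e1.and e2))
  -- `K` has to cover the finitely many indices before the recursion is in force, and to exceed
  -- `2C/c` so that the forcing uses up only half of the contraction.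
  have hbig : ∃ K, 0 < K ∧ 2 * C / c ≤ K ∧ ∀ n ∈ Finset.range (N + 1), a n ≤ K * pstep κ n := by
    refine ⟨|2 * C / c| + 1 + ∑ n ∈ Finset.range (N + 1), |a n / pstep κ n|, by positivity, ?_, ?_⟩
    · have := le_abs_self (2 * C / c)
      have : 0 ≤ ∑ n ∈ Finset.range (N + 1), |a n / pstep κ n| := by positivity
      linarith
    · intro n hn
      rw [← div_le_iff₀ (pstep_pos _ _)]
      have h1 := Finset.single_le_sum (f := fun n => |a n / pstep κ n|)
        (fun _ _ => abs_nonneg _) hn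
      have h2 := le_abs_self (a n / pstep κ n)
      have h3 := abs_nonneg (2 * C / c)
      beta_reduce at h1
      linarith
  obtain ⟨K, hK, hCK, hKN⟩ := hbig
  refine ⟨K, hK, fun n => ?_⟩
  rcases le_or_gt n N with hn | hn
  · exact hKN n (Finset.mem_range.2 (by omega))
  · induction n, hn.le using Nat.le_induction with
    | base => omega
    | succ n hn' ih =>
      have ih : a n ≤ K * pstep κ n := by
        rcases hn'.eq_or_lt with rfl | h'
        · exact hKN _ (Finset.mem_range.2 (by omega))
        · exact ih h'
      obtain ⟨g1, g2, g3⟩ := hN n hn'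
      have g4 := pstep_succ_ge hκ.le n
      have p1 := pstep_pos γ n
      have p2 := pstep_pos κ n
      have g5 : 0 ≤ 1 - c * pstep γ n := by
        rw [le_div_iff₀ hc] at g2; linarith
      have g6 : κ * pstep 1 n ≤ c / 2 * pstep γ n := by
        have := mul_le_mul_of_nonneg_left g3 hκ.le
        calc _ ≤ _ := this
          _ = _ := by field_simp
      have g7 : C ≤ K * c / 2 := by
        rw [div_le_iff₀ hc] at hCK; linarith
      -- Half of the contraction absorbs the forcing; the other half beats the decrease of `pstep κ`
      -- from `n` to `n + 1`.
      calc a (n + 1) ≤ _ := g1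
        _ ≤ (1 - c * pstep γ n) * (K * pstep κ n) + (K * c / 2) * (pstep γ n * pstep κ n) := by
          gcongr
        _ = K * (pstep κ n * (1 - c / 2 * pstep γ n)) := by ring
        _ ≤ K * (pstep κ n * (1 - κ * pstep 1 n)) := by gcongr
        _ ≤ K * pstep κ (n + 1) := by gcongr

/-- Mean-square rates for a pair of recursions running on the time scales `αₙ` and `βₙ`,
coupled through a factor `rₙ = αₙ / βₙ`. -/
lemma two_timescale_rates {α β c C : ℝ} (hα : α < 1) (hαβ : β < α) (hβ : 0 < β) (hc : 0 < c)
    (hC : 0 ≤ C) {a s : ℕ → ℝ} (ha0 : ∀ n, 0 ≤ a n) (hs0 : ∀ n, 0 ≤ s n)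
    (ha : ∀ n, a (n + 1) ≤ (1 - c * pstep α n) * a n +
      C * (pstep α n * pstep (α - β) n ^ 2 * (a n + s n) + pstep α n ^ 2 * (1 + a n + s n)))
    (hs : ∀ n, s (n + 1) ≤ (1 - c * pstep β n) * s n +
      C * (pstep β n * pstep (α - β) n ^ 2 * (a n + s n) + pstep β n ^ 2 * (1 + a n + s n))) :
    ∃ K, 0 < K ∧ ∀ n, a n ≤ K * pstep α n ∧ s n ≤ K * pstep β n := by
  have hα0 : 0 < α := hβ.trans hαβ
  have hr0 : 0 < α - β := sub_pos.2 hαβ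
  have hrb : ∀ n, pstep (α - β) n * pstep β n = pstep α n := fun n => by
    rw [← pstep_add]; ring_nf
  have small : ∀ γ : ℝ, 0 < γ → ∀ d : ℝ, 0 < d → ∀ᶠ n in atTop, C * pstep γ n ≤ d := by
    intro γ hγ d hd
    have := (tendsto_pstep hγ).const_mul C
    rw [mul_zero] at this
    exact this.eventually_le_const hd
  -- Lyapunov function `a + r s` with `r = αₙ/βₙ`: as `r βₙ = αₙ`, the weight turns the contraction
  -- `c βₙ` of `s` into a gain `c αₙ s`, enough to absorb the `s`-terms in the recursion of `a`.
  -- This crude rate for `a` is then fed into the recursion of `s`, and the resulting rate of `s`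
  -- into that of `a`.
  have hV_rate : ∃ K, 0 < K ∧ ∀ n, a n + pstep (α - β) n * s n ≤ K * pstep β n := by
    refine rate_of_contraction (γ := α) (c := c / 2) (C := 2 * C) hα0 hα hβ (by positivity) ?_
    filter_upwards [small _ hα0 (c / 8) (by positivity), small _ hβ (c / 8) (by positivity),
      small _ hr0 (c / 8) (by positivity)] with n h1 h2 h3
    have A := ha n
    have S := hs n
    have pr := pstep_pos (α - β) n
    have pr1 := pstep_le_one hr0.le n
    have pa := pstep_pos α n
    have pb := pstep_pos β n
    have pab : pstep α n ≤ pstep β n := by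
      rw [← hrb]; exact mul_le_of_le_one_left pb.le pr1
    have anti := pstep_anti hr0.le (Nat.le_succ n)
    have hS' : pstep (α - β) (n + 1) * s (n + 1) ≤ pstep (α - β) n * s (n + 1) :=
      mul_le_mul_of_nonneg_right anti (hs0 _)
    have hS := mul_le_mul_of_nonneg_left S pr.le
    have hb := hrb n
    have a0 := ha0 n
    have s0 := hs0 n
    set r := pstep (α - β) n
    set A' := pstep α n
    set B' := pstep β n
    have e1 : r * ((1 - c * B') * s n + C * (B' * r ^ 2 * (a n + s n) + B' ^ 2 * (1 + a n + s n)))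
        = r * s n - c * A' * s n + C * (A' * r ^ 2 * (a n + s n) + A' * B' * (1 + a n + s n)) := by
      rw [← hb]; ring
    have t1 : C * (A' * r ^ 2 * (a n + s n)) ≤ c / 8 * (A' * (a n + s n)) := by
      have u : C * r ^ 2 ≤ c / 8 :=
        (mul_le_mul_of_nonneg_left (pow_le_of_le_one pr.le pr1 two_ne_zero) hC).trans h3
      linarith [mul_le_mul_of_nonneg_right u (mul_nonneg pa.le (add_nonneg a0 s0))]
    have t2 : C * (A' * B' * (1 + a n + s n)) ≤ C * (A' * B') + c / 8 * (A' * (a n + s n)) := by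
      linarith [mul_le_mul_of_nonneg_right h2 (mul_nonneg pa.le (add_nonneg a0 s0))]
    have t3 : C * (A' ^ 2 * (1 + a n + s n)) ≤ C * (A' * B') + c / 8 * (A' * (a n + s n)) := by
      have u : C * (A' * A') ≤ C * (A' * B') := by gcongr
      linarith [mul_le_mul_of_nonneg_right h1 (mul_nonneg pa.le (add_nonneg a0 s0))]
    have t4 : r * s n * (c / 2 * A') ≤ c / 2 * (A' * s n) := by
      have := mul_nonneg (mul_nonneg hc.le pa.le) s0
      linarith [mul_le_mul_of_nonneg_right pr1 this]
    rw [e1] at hS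
    linarith
  obtain ⟨K1, hK1, h1⟩ := hV_rate
  have ha1 : ∀ n, a n ≤ K1 * pstep β n := fun n => by
    have := mul_nonneg (pstep_pos (α - β) n).le (hs0 n)
    linarith [h1 n]
  have hs_rate : ∃ K, 0 < K ∧ ∀ n, s n ≤ K * pstep β n := by
    refine rate_of_contraction (γ := β) (c := c / 2) (C := C * (2 * K1 + 1)) hβ (hαβ.trans hα) hβ
      (by positivity) ?_
    filter_upwards [small _ hβ (c / 4) (by positivity), small _ hr0 (c / 4) (by positivity)]
      with n h2 h3
    have S := hs n
    have pr := pstep_pos (α - β) n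
    have pr1 := pstep_le_one hr0.le n
    have pb := pstep_pos β n
    have pb1 := pstep_le_one hβ.le n
    have a0 := ha0 n
    have s0 := hs0 n
    have a1 := ha1 n
    set r := pstep (α - β) n
    set B' := pstep β n
    have r2 : r ^ 2 ≤ 1 := pow_le_one₀ pr.le pr1
    have t1 : C * (B' * r ^ 2 * (a n + s n)) ≤ C * (K1 * (B' * B')) + c / 4 * (B' * s n) := by
      have u1 : C * r ^ 2 ≤ c / 4 :=
        (mul_le_mul_of_nonneg_left (pow_le_of_le_one pr.le pr1 two_ne_zero) hC).trans h3
      have u2 : C * (B' * r ^ 2 * a n) ≤ C * (B' * 1 * (K1 * B')) := by gcongr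
      linarith [mul_le_mul_of_nonneg_right u1 (mul_nonneg pb.le s0)]
    have t2 : C * (B' ^ 2 * (1 + a n + s n)) ≤ C * ((1 + K1) * (B' * B')) + c / 4 * (B' * s n) := by
      have u2 : C * (B' ^ 2 * a n) ≤ C * (B' ^ 2 * (K1 * 1)) := by
        gcongr; exact a1.trans (by gcongr)
      linarith [mul_le_mul_of_nonneg_right h2 (mul_nonneg pb.le s0)]
    linarith
  obtain ⟨K2, hK2, h2⟩ := hs_rate
  have ha_rate : ∃ K, 0 < K ∧ ∀ n, a n ≤ K * pstep α n := by
    refine rate_of_contraction (γ := α) (c := c / 2) (C := C * (2 * K2 + 1)) hα0 hα hα0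
      (by positivity) ?_
    filter_upwards [small _ hα0 (c / 4) (by positivity), small _ hr0 (c / 4) (by positivity)]
      with n h3 h4
    have A := ha n
    have pr := pstep_pos (α - β) n
    have pr1 := pstep_le_one hr0.le n
    have pa := pstep_pos α n
    have pb1 := pstep_le_one hβ.le n
    have hb := hrb n
    have a0 := ha0 n
    have s0 := hs0 n
    have s1 := h2 n
    set r := pstep (α - β) n
    set A' := pstep α n
    set B' := pstep β n
    have t1 : C * (A' * r ^ 2 * (a n + s n)) ≤ C * (K2 * (A' * A')) + c / 4 * (A' * a n) := by
      have u1 : C * r ^ 2 ≤ c / 4 :=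
        (mul_le_mul_of_nonneg_left (pow_le_of_le_one pr.le pr1 two_ne_zero) hC).trans h4
      have u2 : C * (A' * r ^ 2 * s n) ≤ C * (A' * (r * 1) * (K2 * B')) := by
        gcongr; rw [pow_two]; gcongr
      -- One of the two factors `r` turns the bound `s = O(βₙ)` into `O(αₙ)`, which sharpens the
      -- rate of `a` from `βₙ` to `αₙ`.
      have u3 : C * (A' * (r * 1) * (K2 * B')) = C * (K2 * (A' * A')) := by
        rw [← hb]; ring
      linarith [mul_le_mul_of_nonneg_right u1 (mul_nonneg pa.le a0)]
    have t2 : C * (A' ^ 2 * (1 + a n + s n)) ≤ C * ((1 + K2) * (A' * A')) + c / 4 * (A' * a n) := by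
      have u2 : C * (A' ^ 2 * s n) ≤ C * (A' ^ 2 * (K2 * 1)) := by
        gcongr; exact s1.trans (by gcongr)
      linarith [mul_le_mul_of_nonneg_right h3 (mul_nonneg pa.le a0)]
    linarith
  obtain ⟨K3, hK3, h3⟩ := ha_rate
  refine ⟨max K2 K3, lt_max_of_lt_left hK2, fun n => ⟨(h3 n).trans ?_, (h2 n).trans ?_⟩⟩
  · exact mul_le_mul_of_nonneg_right (le_max_right _ _) (pstep_pos _ _).le
  · exact mul_le_mul_of_nonneg_right (le_max_left _ _) (pstep_pos _ _).le

/-! ### Anti-concentration from characteristic functions -/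

lemma exp_neg_sq_div_two_eq_integral (x : ℝ) :
    (Real.exp (-x ^ 2 / 2) : ℂ) =
      ∫ z : ℝ, Complex.exp (x * z * Complex.I) ∂(ProbabilityTheory.gaussianReal 0 1) := by
  have := ProbabilityTheory.charFun_gaussianReal (μ := 0) (v := 1) x
  rw [charFun_apply_real] at this
  rw [this]
  push_cast
  congr 1
  simp
  ring

/-- The mass that a finite measure puts near `0` is controlled by a Gaussian average of its
characteristic function. -/
lemma measureReal_abs_le_le_integral_charFun (ρ : Measure ℝ) [IsFiniteMeasure ρ] {c : ℝ}
    (hc : 0 < c) :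
    ρ.real {x | |x| ≤ c} ≤
      2 * ∫ z, ‖charFun ρ (z / c)‖ ∂(ProbabilityTheory.gaussianReal 0 1) := by
  set N := ProbabilityTheory.gaussianReal 0 1
  have hmeas : MeasurableSet {x : ℝ | |x| ≤ c} := measurableSet_le (by fun_prop) (by fun_prop)
  have hint : Integrable (fun x : ℝ => Real.exp (-(x / c) ^ 2 / 2)) ρ := by
    refine Integrable.of_bound (C := 1) (by fun_prop) (ae_of_all _ fun x => ?_)
    rw [Real.norm_eq_abs, abs_of_pos (Real.exp_pos _), Real.exp_le_one_iff]
    have := sq_nonneg (x / c)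
    linarith
  -- On `|x| ≤ c` the Gaussian bump is at least `exp (-1/2) ≥ 1/2`. The bump is the characteristic
  -- function of a Gaussian, so Fubini turns its integral into an average of `charFun ρ`.
  have h1 : ρ.real {x | |x| ≤ c} ≤ 2 * ∫ x, Real.exp (-(x / c) ^ 2 / 2) ∂ρ := by
    rw [← integral_indicator_one hmeas, ← integral_const_mul]
    refine integral_mono ((integrable_const (1 : ℝ)).indicator hmeas) (hint.const_mul 2) fun x => ?_
    by_cases hx : |x| ≤ c
    · rw [Set.indicator_of_mem (by exact hx)]
      have h2 : (x / c) ^ 2 ≤ 1 := by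
        rw [sq_le_one_iff_abs_le_one, abs_div, abs_of_pos hc, div_le_one hc]
        exact hx
      have h3 := Real.add_one_le_exp (-(x / c) ^ 2 / 2)
      simp only [Pi.one_apply]
      linarith
    · rw [Set.indicator_of_notMem (by exact hx)]
      positivity
  have h2 : ((∫ x, Real.exp (-(x / c) ^ 2 / 2) ∂ρ : ℝ) : ℂ) = ∫ z, charFun ρ (z / c) ∂N := by
    rw [← integral_complex_ofReal]
    simp_rw [exp_neg_sq_div_two_eq_integral, charFun_apply_real]
    rw [integral_integral_swap]
    · refine integral_congr_ae (ae_of_all _ fun z => integral_congr_ae (ae_of_all _ fun x => ?_))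
      simp only
      congr 1
      push_cast
      ring
    · refine Integrable.of_bound (C := 1) ?_ (ae_of_all _ fun p => ?_)
      · apply Continuous.aestronglyMeasurable
        simp only [Function.uncurry_def]
        fun_prop
      · have : ((p.1 / c : ℝ) : ℂ) * p.2 * Complex.I = ((p.1 / c * p.2 : ℝ) : ℂ) * Complex.I := by
          push_cast; ring
        simp only [Function.uncurry_def]
        rw [this, Complex.norm_exp_ofReal_mul_I]
  have h3 : ∫ x, Real.exp (-(x / c) ^ 2 / 2) ∂ρ ≤ ∫ z, ‖charFun ρ (z / c)‖ ∂N := by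
    refine le_trans ?_ (norm_integral_le_integral_norm _)
    rw [← h2, Complex.norm_real]
    exact le_abs_self _
  linarith

/-! ### Characteristic functions of martingale noise. -/

/-- Both bounds are needed: the cubic one is of smaller order where the noise is bounded, the
quadratic one is integrable where only second moments are available. -/
lemma norm_exp_mul_I_sub_taylor_le (y : ℝ) :
    ‖Complex.exp (y * Complex.I) - (1 + y * Complex.I - y ^ 2 / 2)‖ ≤ 4 * y ^ 2 ∧
    ‖Complex.exp (y * Complex.I) - (1 + y * Complex.I - y ^ 2 / 2)‖ ≤ 4 * |y| ^ 3 := by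
  have hn : ‖(y : ℂ) * Complex.I‖ = |y| := by simp
  rcases le_or_gt |y| 1 with hy | hy
  · have h := Complex.exp_bound (x := y * Complex.I) (by rw [hn]; exact hy) (n := 3) (by norm_num)
    rw [hn] at h
    have e : ∑ m ∈ Finset.range 3, ((y : ℂ) * Complex.I) ^ m / (m.factorial : ℂ) =
        1 + y * Complex.I - y ^ 2 / 2 := by
      simp [Finset.sum_range_succ, mul_pow]
      ring
    rw [e] at h
    have h3 : |y| ^ 3 ≤ y ^ 2 := by
      rw [← sq_abs y]
      exact pow_le_pow_of_le_one (abs_nonneg _) hy (by norm_num)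
    have h4 : |y| ^ 3 * ((3 : ℕ).succ * ((Nat.factorial 3 : ℝ) * (3 : ℕ))⁻¹) ≤ 1 * |y| ^ 3 := by
      rw [mul_comm]
      gcongr
      norm_num [Nat.factorial]
    have := pow_nonneg (abs_nonneg y) 3
    have := sq_nonneg y
    constructor <;> linarith
  · have h : ‖Complex.exp (y * Complex.I) - (1 + y * Complex.I - y ^ 2 / 2)‖ ≤
        1 + (1 + |y| + y ^ 2 / 2) := by
      refine (norm_sub_le _ _).trans ?_
      rw [Complex.norm_exp_ofReal_mul_I]
      gcongr
      refine (norm_sub_le _ _).trans ?_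
      refine add_le_add ((norm_add_le _ _).trans ?_) ?_
      · rw [hn]; simp
      · simp
    have h2 : |y| ≤ |y| ^ 2 := by nlinarith
    have h3 : |y| ^ 2 ≤ |y| ^ 3 := by nlinarith [sq_nonneg |y|]
    rw [← sq_abs y] at *
    constructor <;> linarith

lemma abs_exp_neg_sub_le {x : ℝ} (hx : 0 ≤ x) : |Real.exp (-x) - (1 - x)| ≤ x ^ 2 := by
  rcases le_or_gt x 1 with h | h
  · have := Real.abs_exp_sub_one_sub_id_le (x := -x) (by rwa [abs_neg, abs_of_nonneg hx])
    rw [neg_sq] at this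
    convert this using 2
    ring
  · rw [abs_le]
    have := Real.exp_pos (-x)
    have : Real.exp (-x) ≤ 1 := Real.exp_le_one_iff.2 (by linarith)
    constructor <;> nlinarith

/-- A scalar martingale difference sequence `ξ n` (revealed at time `n + 1`) whose conditional
variance tends to `σ2` in `L¹` and whose squares are dominated by `C (1 + Yₙ)` with `Yₙ → 0`
in `L¹`. -/
structure IsAsymptoticNoise {Ω : Type*} {m0 : MeasurableSpace Ω} (μ : Measure Ω)
    (ℱ : ℕ → MeasurableSpace Ω) (ξ : ℕ → Ω → ℝ) (σ2 C : ℝ) (ε : ℕ → ℝ) (Y : ℕ → Ω → ℝ) :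
    Prop where
  le : ∀ n, ℱ n ≤ m0
  mono : Monotone ℱ
  adapted : ∀ n, Measurable[ℱ (n + 1)] (ξ n)
  memLp : ∀ n, MemLp (ξ n) 2 μ
  -- Conditional moments are recorded by testing against bounded complex functions of the past,
  -- because they are used against `G = exp (i t ·)` of the partial sums.
  mean_zero : ∀ n, ∀ G : Ω → ℂ, StronglyMeasurable[ℱ n] G → (∀ ω, ‖G ω‖ ≤ 1) →
    ∫ ω, (ξ n ω : ℂ) * G ω ∂μ = 0
  var_close : ∀ n, ∀ G : Ω → ℂ, StronglyMeasurable[ℱ n] G → (∀ ω, ‖G ω‖ ≤ 1) →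
    ‖∫ ω, ((ξ n ω ^ 2 - σ2 : ℝ) : ℂ) * G ω ∂μ‖ ≤ ε n
  var_pos : 0 < σ2
  tendsto_ε : Tendsto ε atTop (𝓝 0)
  C_nonneg : 0 ≤ C
  Y_nonneg : ∀ n ω, 0 ≤ Y n ω
  Y_integrable : ∀ n, Integrable (Y n) μ
  sq_le : ∀ n, ∀ᵐ ω ∂μ, ξ n ω ^ 2 ≤ C * (1 + Y n ω)
  tendsto_Y : Tendsto (fun n => ∫ ω, Y n ω ∂μ) atTop (𝓝 0)

namespace IsAsymptoticNoise

variable {Ω : Type*} {m0 : MeasurableSpace Ω} {μ : Measure Ω} {ℱ : ℕ → MeasurableSpace Ω}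
  {ξ : ℕ → Ω → ℝ} {σ2 C : ℝ} {ε : ℕ → ℝ} {Y : ℕ → Ω → ℝ}

/-- Error of replacing one noise term by a Gaussian in the characteristic function. -/
def stepError (C σ2 : ℝ) (e y s : ℝ) : ℝ :=
  s ^ 2 * e + (4 * (1 + 2 * C) ^ 2 + σ2 ^ 2) * (|s| ^ 3 + s ^ 4 + s ^ 2 * y)

/-- Expand both exponentials to second order in `s`. The linear term integrates to `0`, the
quadratic terms differ by the error `ε n` of the conditional variance, and the remainders `R`, `R'`
are of higher order or controlled by `Y`. -/
lemma norm_integral_exp_sub_le [IsFiniteMeasure μ] (hμ : μ.real Set.univ ≤ 1)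
    (h : IsAsymptoticNoise μ ℱ ξ σ2 C ε Y) (n : ℕ) (s : ℝ)
    {G : Ω → ℂ} (hG : StronglyMeasurable[ℱ n] G) (hG1 : ∀ ω, ‖G ω‖ ≤ 1) :
    ‖∫ ω, (Complex.exp ((s * ξ n ω : ℝ) * Complex.I) - (Real.exp (-(s ^ 2 * σ2 / 2)) : ℝ)) * G ω ∂μ‖
      ≤ stepError C σ2 (ε n) (∫ ω, Y n ω ∂μ) s := by
  have hGm : AEStronglyMeasurable G μ := (hG.mono (h.le n)).aestronglyMeasurable
  have hξm : Measurable (ξ n) := (h.adapted n).mono (h.le _) le_rfl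
  set x := s ^ 2 * σ2 / 2 with hx
  have hx0 : 0 ≤ x := by have := h.var_pos; positivity
  set R : Ω → ℂ := fun ω => Complex.exp ((s * ξ n ω : ℝ) * Complex.I) -
    (1 + ((s * ξ n ω : ℝ) : ℂ) * Complex.I - ((s * ξ n ω : ℝ) : ℂ) ^ 2 / 2) with hR
  set R' : ℝ := Real.exp (-x) - (1 - x) with hR'
  have hξ1 : Integrable (fun ω => (ξ n ω : ℂ) * G ω) μ :=
    (((h.memLp n).integrable one_le_two).ofReal).mul_bdd (c := 1) hGm (ae_of_all _ hG1)
  have hξ2 : Integrable (fun ω => ((ξ n ω ^ 2 - σ2 : ℝ) : ℂ) * G ω) μ :=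
    (((h.memLp n).integrable_sq.sub (integrable_const σ2)).ofReal).mul_bdd (c := 1) hGm
      (ae_of_all _ hG1)
  have hRb : ∀ᵐ ω ∂μ, ‖R ω * G ω‖ ≤ 4 * (1 + 2 * C) ^ 2 * (|s| ^ 3 + s ^ 2 * Y n ω) := by
    filter_upwards [h.sq_le n] with ω hω
    rw [norm_mul]
    refine (mul_le_of_le_one_right (norm_nonneg _) (hG1 ω)).trans ?_
    obtain ⟨t1, t2⟩ := norm_exp_mul_I_sub_taylor_le (s * ξ n ω)
    have hC := h.C_nonneg
    have hY := h.Y_nonneg n ω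
    -- Where `Y ≤ 1` the noise is bounded by `1 + 2C` and the cubic remainder applies; where `Y > 1`
    -- the quadratic remainder is dominated by a multiple of `s² Y`, small in mean.
    rcases le_or_gt (Y n ω) 1 with hY1 | hY1
    · refine t2.trans ?_
      have hv : ξ n ω ^ 2 ≤ 1 + 2 * C := by nlinarith
      have hv1 : |ξ n ω| ≤ 1 + 2 * C := by
        by_contra hcon
        push Not at hcon
        rw [← sq_abs] at hv
        nlinarith
      have : |s * ξ n ω| ^ 3 ≤ |s| ^ 3 * (1 + 2 * C) ^ 2 := by
        rw [abs_mul, mul_pow, pow_succ |ξ n ω|, sq_abs, pow_two (1 + 2 * C)]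
        gcongr
      have : 0 ≤ s ^ 2 * Y n ω := by positivity
      nlinarith [sq_nonneg (1 + 2 * C)]
    · refine t1.trans ?_
      have hv : ξ n ω ^ 2 ≤ (1 + 2 * C) ^ 2 * Y n ω := by nlinarith
      have : (s * ξ n ω) ^ 2 ≤ s ^ 2 * ((1 + 2 * C) ^ 2 * Y n ω) := by
        rw [mul_pow]; gcongr
      have : 0 ≤ (1 + 2 * C) ^ 2 * |s| ^ 3 := by positivity
      nlinarith
  have hbi : Integrable (fun ω => 4 * (1 + 2 * C) ^ 2 * (|s| ^ 3 + s ^ 2 * Y n ω)) μ :=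
    ((integrable_const _).add ((h.Y_integrable n).const_mul _)).const_mul _
  have hRi : Integrable (fun ω => R ω * G ω) μ := by
    refine hbi.mono' (AEStronglyMeasurable.mul ?_ hGm) hRb
    apply Measurable.aestronglyMeasurable
    rw [hR]
    fun_prop
  have hR'i : Integrable (fun ω => (R' : ℂ) * G ω) μ := by
    refine Integrable.of_bound (C := |R'|) (hGm.const_mul _) (ae_of_all _ fun ω => ?_)
    rw [norm_mul, Complex.norm_real]
    exact mul_le_of_le_one_right (norm_nonneg _) (hG1 ω)
  have hdec : ∀ ω, (Complex.exp ((s * ξ n ω : ℝ) * Complex.I) - (Real.exp (-x) : ℝ)) * G ω =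
      (s * Complex.I) * ((ξ n ω : ℂ) * G ω) +
      (-(s ^ 2 / 2) : ℂ) * (((ξ n ω ^ 2 - σ2 : ℝ) : ℂ) * G ω) + R ω * G ω - (R' : ℂ) * G ω := by
    intro ω
    simp only [hR, hR', hx]
    push_cast
    ring
  have i1 : Integrable (fun ω => (s * Complex.I) * ((ξ n ω : ℂ) * G ω)) μ := hξ1.const_mul _
  have i2 : Integrable (fun ω => (-(s ^ 2 / 2) : ℂ) * (((ξ n ω ^ 2 - σ2 : ℝ) : ℂ) * G ω)) μ :=
    hξ2.const_mul _
  have i3 := i1.fun_add i2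
  have i4 := i3.fun_add hRi
  simp_rw [hdec]
  rw [integral_sub i4 hR'i, integral_add i3 hRi, integral_add i1 i2, integral_const_mul,
    integral_const_mul, h.mean_zero n G hG hG1, mul_zero, zero_add]
  have b1 : ‖(-(s ^ 2 / 2) : ℂ) * ∫ ω, ((ξ n ω ^ 2 - σ2 : ℝ) : ℂ) * G ω ∂μ‖ ≤ s ^ 2 * ε n := by
    have hv := h.var_close n G hG hG1
    rw [norm_mul]
    have : ‖(-(s ^ 2 / 2) : ℂ)‖ = s ^ 2 / 2 := by
      rw [norm_neg, norm_div, norm_pow, Complex.norm_real, Real.norm_eq_abs, sq_abs]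
      simp
    rw [this]
    have hε : 0 ≤ ε n := (norm_nonneg _).trans hv
    calc _ ≤ s ^ 2 / 2 * ε n := by gcongr
      _ ≤ s ^ 2 * ε n := by nlinarith [mul_nonneg (sq_nonneg s) hε]
  have b2 : ‖∫ ω, R ω * G ω ∂μ‖ ≤
      4 * (1 + 2 * C) ^ 2 * (|s| ^ 3 + s ^ 2 * ∫ ω, Y n ω ∂μ) := by
    refine (norm_integral_le_of_norm_le hbi hRb).trans ?_
    rw [integral_const_mul, integral_add (integrable_const _) ((h.Y_integrable n).const_mul _),
      integral_const_mul, integral_const, smul_eq_mul]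
    gcongr
    exact mul_le_of_le_one_left (by positivity) hμ
  have b3 : ‖∫ ω, (R' : ℂ) * G ω ∂μ‖ ≤ σ2 ^ 2 * s ^ 4 := by
    have hle := abs_exp_neg_sub_le hx0
    refine (norm_integral_le_of_norm_le_const (C := x ^ 2) (ae_of_all _ fun ω => ?_)).trans ?_
    · rw [norm_mul, Complex.norm_real]
      exact (mul_le_of_le_one_right (norm_nonneg _) (hG1 ω)).trans hle
    · refine (mul_le_of_le_one_right (by positivity) hμ).trans ?_
      rw [hx]
      nlinarith [sq_nonneg (s ^ 2 * σ2)]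
  have hY0 : 0 ≤ ∫ ω, Y n ω ∂μ := integral_nonneg (h.Y_nonneg n)
  refine (norm_sub_le _ _).trans ((add_le_add ((norm_add_le _ _).trans (add_le_add b1 b2)) b3).trans ?_)
  unfold stepError
  have q1 : 0 ≤ 4 * (1 + 2 * C) ^ 2 * s ^ 4 := by positivity
  have q2 : 0 ≤ σ2 ^ 2 * (|s| ^ 3 + s ^ 2 * ∫ ω, Y n ω ∂μ) := by positivity
  nlinarith

/-- Characteristic function of a sum of noise terms started at an `ℱ k`-measurable point. -/
lemma norm_integral_exp_sum_le [IsFiniteMeasure μ] (hμ : μ.real Set.univ ≤ 1)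
    (h : IsAsymptoticNoise μ ℱ ξ σ2 C ε Y) (a : ℕ → ℝ) (t : ℝ) {k n : ℕ} (hkn : k ≤ n)
    {A : Ω → ℝ} (hA : Measurable[ℱ k] A) :
    ‖∫ ω, Complex.exp ((t * (A ω + ∑ j ∈ Finset.Ico k n, a j * ξ j ω) : ℝ) * Complex.I) ∂μ‖ ≤
      Real.exp (-(∑ j ∈ Finset.Ico k n, (t * a j) ^ 2 * σ2 / 2)) +
      ∑ j ∈ Finset.Ico k n, stepError C σ2 (ε j) (∫ ω, Y j ω ∂μ) (t * a j) := by
  have hmeas : ∀ n, k ≤ n →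
      Measurable[ℱ n] fun ω => A ω + ∑ j ∈ Finset.Ico k n, a j * ξ j ω := by
    intro n hn
    refine (hA.mono (h.mono hn) le_rfl).add (Finset.measurable_fun_sum _ fun j hj => ?_)
    have : j + 1 ≤ n := (Finset.mem_Ico.1 hj).2
    exact ((h.adapted j).mono (h.mono this) le_rfl).const_mul _
  induction n, hkn using Nat.le_induction with
  | base =>
    simp only [Finset.Ico_self, Finset.sum_empty, add_zero, neg_zero, Real.exp_zero]
    -- Nothing is known about the law of the starting point `A`: its characteristic function is
    -- merely bounded by `1`.
    refine (norm_integral_le_of_norm_le_const (C := 1) (ae_of_all _ fun ω => ?_)).trans ?_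
    · rw [Complex.norm_exp_ofReal_mul_I]
    · linarith
  | succ n hn ih =>
    simp only [Finset.sum_Ico_succ_top hn]
    set G : Ω → ℂ := fun ω =>
      Complex.exp ((t * (A ω + ∑ j ∈ Finset.Ico k n, a j * ξ j ω) : ℝ) * Complex.I) with hG
    have hGm : Measurable[ℱ n] G := by
      have := hmeas n hn
      exact Complex.measurable_exp.comp
        ((Complex.measurable_ofReal.comp (this.const_mul t)).mul_const _)
    have hG1 : ∀ ω, ‖G ω‖ ≤ 1 := fun ω => (Complex.norm_exp_ofReal_mul_I _).le
    have hGi : Integrable G μ := by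
      refine Integrable.of_bound (C := 1) ?_ (ae_of_all _ hG1)
      exact (hGm.mono (h.le n) le_rfl).aestronglyMeasurable
    have hone := norm_integral_exp_sub_le hμ h n (t * a n) hGm.stronglyMeasurable hG1
    set x := (t * a n) ^ 2 * σ2 / 2 with hx
    have hx0 : 0 ≤ x := by have := h.var_pos; positivity
    -- The last noise factor is replaced by the constant `exp (-x)`. Since this constant is at most
    -- `1`, the errors made at earlier steps are not amplified.
    have hsplit : ∀ ω, Complex.exp ((t * (A ω + (∑ j ∈ Finset.Ico k n, a j * ξ j ω + a n * ξ n ω)) : ℝ)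
        * Complex.I) =
        (Complex.exp ((t * a n * ξ n ω : ℝ) * Complex.I) - (Real.exp (-x) : ℝ)) * G ω +
          (Real.exp (-x) : ℝ) * G ω := by
      intro ω
      rw [sub_mul, sub_add_cancel, hG, ← Complex.exp_add]
      congr 1
      push_cast
      ring
    have hint : Integrable (fun ω =>
        (Complex.exp ((t * a n * ξ n ω : ℝ) * Complex.I) - (Real.exp (-x) : ℝ)) * G ω) μ := by
      have hξm : Measurable (ξ n) := (h.adapted n).mono (h.le _) le_rfl
      refine hGi.bdd_mul (c := 1 + Real.exp (-x)) (Measurable.aestronglyMeasurable (by fun_prop))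
        (ae_of_all _ fun ω => ?_)
      refine (norm_sub_le _ _).trans ?_
      rw [Complex.norm_exp_ofReal_mul_I, Complex.norm_real, Real.norm_eq_abs,
        abs_of_pos (Real.exp_pos _)]
    simp_rw [hsplit]
    rw [integral_add hint (hGi.const_mul _), integral_const_mul]
    refine (norm_add_le _ _).trans ?_
    rw [norm_mul, Complex.norm_real, Real.norm_eq_abs, abs_of_pos (Real.exp_pos _)]
    have hexp : Real.exp (-x) ≤ 1 := Real.exp_le_one_iff.2 (by linarith)
    have herr : 0 ≤ ∑ j ∈ Finset.Ico k n, stepError C σ2 (ε j) (∫ ω, Y j ω ∂μ) (t * a j) := by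
      refine Finset.sum_nonneg fun j _ => ?_
      have h1 : 0 ≤ ∫ ω, Y j ω ∂μ := integral_nonneg (h.Y_nonneg j)
      have h2 : 0 ≤ ε j :=
        (norm_nonneg _).trans (h.var_close j (fun _ => 0) stronglyMeasurable_const (by simp))
      unfold stepError
      positivity
    have := mul_le_mul_of_nonneg_left ih (Real.exp_pos (-x)).le
    rw [mul_add, ← Real.exp_add] at this
    have h2 := mul_le_of_le_one_left herr hexp
    have e : -x + -(∑ j ∈ Finset.Ico k n, (t * a j) ^ 2 * σ2 / 2) =
      -(∑ j ∈ Finset.Ico k n, (t * a j) ^ 2 * σ2 / 2 + x) := by ring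
    rw [e] at this
    linarith

end IsAsymptoticNoise

/-! ### Windows of length `δ n^γ` and anti-concentration of scalar recursions. -/

/-- Left end of the window of length `⌊δ n^γ⌋` ending at `n`. -/
def windowStart (γ δ : ℝ) (n : ℕ) : ℕ := n - ⌊δ * (n : ℝ) ^ γ⌋₊

lemma windowStart_le (γ δ : ℝ) (n : ℕ) : windowStart γ δ n ≤ n := Nat.sub_le _ _

lemma rpow_neg_le_pstep {g : ℝ} (hg : 0 ≤ g) {j n : ℕ} (h : j < n) :
    (n : ℝ) ^ (-g) ≤ pstep g j := by
  have : (j : ℝ) + 1 ≤ n := by exact_mod_cast h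
  exact Real.rpow_le_rpow_of_nonpos (by positivity) this (by linarith)

lemma pstep_le_two_mul_rpow_neg {g : ℝ} (hg : 0 ≤ g) (hg1 : g ≤ 1) {j n : ℕ} (hn : 0 < n)
    (h : n ≤ 2 * j) : pstep g j ≤ 2 * (n : ℝ) ^ (-g) := by
  have h0 : (0 : ℝ) < n := by exact_mod_cast hn
  have h1 : (n : ℝ) ≤ 2 * j := by exact_mod_cast h
  have h2 : pstep g j ≤ ((n : ℝ) / 2) ^ (-g) :=
    Real.rpow_le_rpow_of_nonpos (by positivity) (by linarith) (by linarith)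
  refine h2.trans ?_
  rw [Real.div_rpow h0.le (by norm_num), Real.rpow_neg (by norm_num : (0 : ℝ) ≤ 2), div_inv_eq_mul,
    mul_comm]
  have : (2 : ℝ) ^ g ≤ 2 := by
    calc (2 : ℝ) ^ g ≤ 2 ^ (1 : ℝ) := Real.rpow_le_rpow_of_exponent_le (by norm_num) hg1
      _ = 2 := Real.rpow_one 2
  gcongr

/-- As `γ < 1` the window has length `o(n)` and lies in `[n/2, n]`, where all steps `pstep γ j` are
comparable to `n^(-γ)`; as `γ > 0` its length tends to infinity, so rounding down costs at most a
factor `2`. -/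
lemma eventually_windowStart {γ δ : ℝ} (hγ0 : 0 < γ) (hγ : γ < 1) (hδ : 0 < δ) (hδ1 : δ ≤ 1) :
    ∀ᶠ n : ℕ in atTop, 0 < n ∧ n ≤ 2 * windowStart γ δ n ∧
      δ / 2 * (n : ℝ) ^ γ ≤ ((n - windowStart γ δ n : ℕ) : ℝ) ∧
      ((n - windowStart γ δ n : ℕ) : ℝ) ≤ δ * (n : ℝ) ^ γ := by
  have h1 : Tendsto (fun n : ℕ => (n : ℝ) ^ γ) atTop atTop :=
    (tendsto_rpow_atTop hγ0).comp tendsto_natCast_atTop_atTop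
  have h2 : Tendsto (fun n : ℕ => (n : ℝ) ^ (-(1 - γ))) atTop (𝓝 0) :=
    (tendsto_rpow_neg_atTop (by linarith)).comp tendsto_natCast_atTop_atTop
  filter_upwards [eventually_gt_atTop 0, h1.eventually_ge_atTop (2 / δ),
    h2.eventually_le_const (u := 1 / 2) (by norm_num)] with n hn h3 h4
  have h0 : (0 : ℝ) < n := by exact_mod_cast hn
  have hp : 0 < (n : ℝ) ^ γ := Real.rpow_pos_of_pos h0 _
  have h5 : (n : ℝ) ^ γ ≤ n / 2 := by
    have : (n : ℝ) ^ γ = (n : ℝ) ^ (-(1 - γ)) * n := by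
      rw [← Real.rpow_add_one h0.ne']; ring_nf
    rw [this]
    nlinarith
  have hfl : (⌊δ * (n : ℝ) ^ γ⌋₊ : ℝ) ≤ δ * (n : ℝ) ^ γ := Nat.floor_le (by positivity)
  have hfl2 : δ * (n : ℝ) ^ γ < (⌊δ * (n : ℝ) ^ γ⌋₊ : ℝ) + 1 := Nat.lt_floor_add_one _
  have h6 : 2 * ⌊δ * (n : ℝ) ^ γ⌋₊ ≤ n := by
    have : (2 : ℝ) * (⌊δ * (n : ℝ) ^ γ⌋₊ : ℝ) ≤ n := by nlinarith
    exact_mod_cast this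
  have h7 : n - windowStart γ δ n = ⌊δ * (n : ℝ) ^ γ⌋₊ := by unfold windowStart; omega
  refine ⟨hn, by unfold windowStart; omega, ?_, ?_⟩
  · rw [h7]
    rw [div_le_iff₀ hδ] at h3
    linarith
  · rw [h7]; exact hfl

namespace IsAsymptoticNoise

variable {Ω : Type*} {m0 : MeasurableSpace Ω} {μ : Measure Ω} {ℱ : ℕ → MeasurableSpace Ω}
  {ξ : ℕ → Ω → ℝ} {σ2 C : ℝ} {ε : ℕ → ℝ} {Y : ℕ → Ω → ℝ}

/-- The rescaled position at time `n` when the drift is switched off inside the window. -/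
def driftless (γ δ : ℝ) (Q ξ : ℕ → Ω → ℝ) (n : ℕ) (ω : Ω) : ℝ :=
  (n : ℝ) ^ (γ / 2) * Q (windowStart γ δ n) ω +
    ∑ j ∈ Finset.Ico (windowStart γ δ n) n, (n : ℝ) ^ (γ / 2) * pstep γ j * ξ j ω

lemma measurable_driftless (h : IsAsymptoticNoise μ ℱ ξ σ2 C ε Y) {Q : ℕ → Ω → ℝ}
    (hQ : ∀ n, Measurable[ℱ n] (Q n)) (γ δ : ℝ) (n : ℕ) : Measurable (driftless γ δ Q ξ n) := by
  refine (((hQ _).mono (h.le _) le_rfl).const_mul _).add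
    (Finset.measurable_fun_sum _ fun j _ => ?_)
  exact ((h.adapted j).mono (h.le _) le_rfl).const_mul _

/-- With `w = n^(-γ/2)`, the rescaled coefficients lie in `[w, 2w]` and the number of steps in
`[(δ/2) w⁻², δ w⁻²]`. The Gaussian exponent is thus at least `(δ/2) w⁻² · t² w² σ2 / 2`, while each
single error is `o(w²)`, so their sum vanishes. -/
lemma eventually_norm_charFun_le [IsFiniteMeasure μ] (hμ : μ.real Set.univ ≤ 1)
    (h : IsAsymptoticNoise μ ℱ ξ σ2 C ε Y) {γ δ : ℝ} (hγ0 : 0 < γ) (hγ : γ < 1) (hδ : 0 < δ)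
    (hδ1 : δ ≤ 1) {Q : ℕ → Ω → ℝ} (hQ : ∀ n, Measurable[ℱ n] (Q n)) (t : ℝ) {η : ℝ}
    (hη : 0 < η) :
    ∀ᶠ n in atTop, ‖charFun (μ.map (driftless γ δ Q ξ n)) t‖ ≤
      Real.exp (-(t ^ 2 * σ2 * δ / 4)) + η := by
  -- Each error will be at most `4 t² w² η1`, with at most `w⁻²` of them; the `+ 1` covers `t = 0`.
  set η1 := η / (4 * t ^ 2 + 1) with hη1
  have hη1pos : 0 < η1 := by positivity
  set Kc := 4 * (1 + 2 * C) ^ 2 + σ2 ^ 2 with hKc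
  have hKc0 : 0 ≤ Kc := by positivity
  have hlim1 : Tendsto (fun j => ε j + Kc * ∫ ω, Y j ω ∂μ) atTop (𝓝 0) := by
    simpa using h.tendsto_ε.add (h.tendsto_Y.const_mul Kc)
  obtain ⟨J, hJ⟩ := eventually_atTop.1 (hlim1.eventually_le_const (half_pos hη1pos))
  have hu : Tendsto (fun n : ℕ => (n : ℝ) ^ (-(γ / 2))) atTop (𝓝 0) :=
    (tendsto_rpow_neg_atTop (by linarith)).comp tendsto_natCast_atTop_atTop
  have hlim2 : Tendsto (fun n : ℕ => Kc * (|t| * (2 * (n : ℝ) ^ (-(γ / 2))) +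
      (|t| * (2 * (n : ℝ) ^ (-(γ / 2)))) ^ 2)) atTop (𝓝 0) := by
    have := (hu.const_mul 2).const_mul |t|
    simpa using (this.add (this.pow 2)).const_mul Kc
  -- Since the window starts at or after `n/2`, the condition `n ≥ 2J` places all of it beyond `J`.
  filter_upwards [eventually_windowStart hγ0 hγ hδ hδ1, eventually_ge_atTop (2 * J),
    hlim2.eventually_le_const (half_pos hη1pos)] with n ⟨hn, hk2, hL1, hL2⟩ hnJ hsmall
  have hn0 : (0 : ℝ) < n := by exact_mod_cast hn
  rw [charFun_apply_real, integral_map (h.measurable_driftless hQ γ δ n).aemeasurable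
    (by fun_prop)]
  set k := windowStart γ δ n with hk
  set w := (n : ℝ) ^ (-(γ / 2)) with hw
  have hw0 : 0 < w := Real.rpow_pos_of_pos hn0 _
  have hwinv : (n : ℝ) ^ (γ / 2) = w⁻¹ := by rw [hw, Real.rpow_neg hn0.le, inv_inv]
  have hwsq : (n : ℝ) ^ γ = (w ^ 2)⁻¹ := by
    rw [← inv_pow, ← hwinv, ← Real.rpow_natCast, ← Real.rpow_mul hn0.le]; norm_num
  have hwsq' : (n : ℝ) ^ (-γ) = w ^ 2 := by rw [Real.rpow_neg hn0.le, hwsq, inv_inv]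
  have ha : ∀ j ∈ Finset.Ico k n, w ≤ w⁻¹ * pstep γ j ∧ w⁻¹ * pstep γ j ≤ 2 * w := by
    intro j hj
    rw [Finset.mem_Ico] at hj
    have h1 := rpow_neg_le_pstep hγ0.le hj.2
    have h2 := pstep_le_two_mul_rpow_neg hγ0.le hγ.le hn (j := j) (by omega)
    rw [hwsq'] at h1 h2
    constructor
    · calc w = w⁻¹ * w ^ 2 := by field_simp
        _ ≤ _ := by gcongr
    · calc w⁻¹ * pstep γ j ≤ w⁻¹ * (2 * w ^ 2) := by gcongr
        _ = 2 * w := by field_simp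
  have hcard : ((Finset.Ico k n).card : ℝ) = ((n - k : ℕ) : ℝ) := by rw [Nat.card_Ico]
  have hmain := h.norm_integral_exp_sum_le hμ (fun j => w⁻¹ * pstep γ j) t
    (windowStart_le γ δ n) (A := fun ω => w⁻¹ * Q k ω) ((hQ k).const_mul _)
  have e1 : ∀ ω, ((t : ℂ) * (driftless γ δ Q ξ n ω : ℝ) * Complex.I) =
      ((t * (w⁻¹ * Q k ω + ∑ j ∈ Finset.Ico k n, w⁻¹ * pstep γ j * ξ j ω) : ℝ) : ℂ) * Complex.I := by
    intro ω
    rw [driftless, hwinv]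
    push_cast
    rfl
  simp_rw [e1]
  refine hmain.trans (add_le_add ?_ ?_)
  · rw [Real.exp_le_exp, neg_le_neg_iff]
    calc t ^ 2 * σ2 * δ / 4 = (δ / 2 * (w ^ 2)⁻¹) * (t ^ 2 * w ^ 2 * σ2 / 2) := by
          field_simp; norm_num
      _ ≤ ((n - k : ℕ) : ℝ) * (t ^ 2 * w ^ 2 * σ2 / 2) := by
          have := h.var_pos
          rw [hwsq] at hL1
          gcongr
      _ = ∑ j ∈ Finset.Ico k n, (t ^ 2 * w ^ 2 * σ2 / 2) := by
          rw [Finset.sum_const, nsmul_eq_mul, hcard]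
      _ ≤ _ := by
          refine Finset.sum_le_sum fun j hj => ?_
          have := h.var_pos
          have := (ha j hj).1
          rw [mul_pow]
          gcongr
  · have hterm : ∀ j ∈ Finset.Ico k n,
        stepError C σ2 (ε j) (∫ ω, Y j ω ∂μ) (t * (w⁻¹ * pstep γ j)) ≤ 4 * t ^ 2 * w ^ 2 * η1 := by
      intro j hj
      have hab := (ha j hj).2
      have ha0 : 0 ≤ w⁻¹ * pstep γ j := hw0.le.trans (ha j hj).1
      rw [Finset.mem_Ico] at hj
      have hjJ := hJ j (by omega)
      set s := t * (w⁻¹ * pstep γ j) with hs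
      have hs1 : |s| ≤ |t| * (2 * w) := by
        rw [hs, abs_mul, abs_of_nonneg ha0]; gcongr
      have hs2 : s ^ 2 ≤ 4 * t ^ 2 * w ^ 2 := by
        rw [← sq_abs s, ← sq_abs t]
        calc |s| ^ 2 ≤ (|t| * (2 * w)) ^ 2 := by gcongr
          _ = _ := by ring
      have e2 : stepError C σ2 (ε j) (∫ ω, Y j ω ∂μ) s =
          s ^ 2 * (ε j + Kc * (∫ ω, Y j ω ∂μ) + Kc * (|s| + |s| ^ 2)) := by
        have : |s| ^ 3 = s ^ 2 * |s| := by rw [← sq_abs]; ring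
        rw [stepError, this, sq_abs]
        ring
      rw [e2]
      have h3 : Kc * (|s| + |s| ^ 2) ≤ η1 / 2 := by
        refine le_trans ?_ hsmall
        gcongr
      have h4 : ε j + Kc * (∫ ω, Y j ω ∂μ) + Kc * (|s| + |s| ^ 2) ≤ η1 := by linarith
      calc _ ≤ s ^ 2 * η1 := by gcongr
        _ ≤ _ := by gcongr
    refine (Finset.sum_le_sum hterm).trans ?_
    rw [Finset.sum_const, nsmul_eq_mul, hcard]
    have hL3 : ((n - k : ℕ) : ℝ) ≤ (w ^ 2)⁻¹ := by
      refine hL2.trans ?_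
      rw [hwsq]
      exact mul_le_of_le_one_left (by positivity) hδ1
    calc _ ≤ (w ^ 2)⁻¹ * (4 * t ^ 2 * w ^ 2 * η1) := by gcongr
      _ = 4 * t ^ 2 * η1 := by field_simp
      _ ≤ (4 * t ^ 2 + 1) * η1 := by gcongr; linarith
      _ = η := by rw [hη1]; field_simp

/-- Eventual bound on the mass near `0` of the driftless process. -/
lemma eventually_driftless_small [IsFiniteMeasure μ] (hμ : μ.real Set.univ ≤ 1)
    (h : IsAsymptoticNoise μ ℱ ξ σ2 C ε Y) {γ δ : ℝ} (hγ0 : 0 < γ) (hγ : γ < 1) (hδ : 0 < δ)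
    (hδ1 : δ ≤ 1) {Q : ℕ → Ω → ℝ} (hQ : ∀ n, Measurable[ℱ n] (Q n)) {c : ℝ} (hc : 0 < c) {η : ℝ}
    (hη : 0 < η) :
    ∀ᶠ n in atTop, μ.real {ω | |driftless γ δ Q ξ n ω| ≤ c} ≤
      2 * ((∫ z, Real.exp (-((z / c) ^ 2 * σ2 * δ / 4)) ∂(ProbabilityTheory.gaussianReal 0 1)) + η)
      := by
  set N := ProbabilityTheory.gaussianReal 0 1
  set b : ℝ → ℝ := fun z => Real.exp (-((z / c) ^ 2 * σ2 * δ / 4)) with hb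
  have hσ := h.var_pos
  have hb1 : ∀ z, b z ≤ 1 := fun z => Real.exp_le_one_iff.2 (by
    have : 0 ≤ (z / c) ^ 2 * σ2 * δ / 4 := by positivity
    linarith)
  have hb0 : ∀ z, 0 < b z := fun z => Real.exp_pos _
  -- Only an asymptotic upper bound on the characteristic functions is known. Their maximum with `b`
  -- does converge, to `b`, so dominated convergence applies.
  set f : ℕ → ℝ → ℝ := fun n z => max ‖charFun (μ.map (driftless γ δ Q ξ n)) (z / c)‖ (b z) with hf
  have hmass : ∀ n, (μ.map (driftless γ δ Q ξ n)).real Set.univ ≤ 1 := by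
    intro n
    rw [map_measureReal_apply (h.measurable_driftless hQ γ δ n) MeasurableSet.univ]
    exact hμ
  have hcf : ∀ n, Measurable fun z : ℝ => ‖charFun (μ.map (driftless γ δ Q ξ n)) (z / c)‖ :=
    fun n => (measurable_charFun.comp (measurable_id.div_const c)).norm
  have hcf1 : ∀ n z, ‖charFun (μ.map (driftless γ δ Q ξ n)) (z / c)‖ ≤ 1 :=
    fun n z => (norm_charFun_le _).trans (hmass n)
  have hfm : ∀ n, Measurable (f n) := fun n => (hcf n).max (by fun_prop)
  have hf1 : ∀ n z, ‖f n z‖ ≤ 1 := by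
    intro n z
    rw [Real.norm_eq_abs, abs_of_nonneg (le_max_of_le_right (hb0 z).le)]
    exact max_le (hcf1 n z) (hb1 z)
  have hlim : Tendsto (fun n => ∫ z, f n z ∂N) atTop (𝓝 (∫ z, b z ∂N)) := by
    refine tendsto_integral_of_dominated_convergence (fun _ => 1)
      (fun n => (hfm n).aestronglyMeasurable) (integrable_const _)
      (fun n => ae_of_all _ (hf1 n)) (ae_of_all _ fun z => ?_)
    rw [tendsto_order]
    constructor
    · intro x hx
      exact Eventually.of_forall fun n => hx.trans_le (le_max_right _ _)
    · intro x hx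
      filter_upwards [h.eventually_norm_charFun_le hμ hγ0 hγ hδ hδ1 hQ (z / c)
        (half_pos (sub_pos.2 hx))] with n hn
      refine max_lt (hn.trans_lt ?_) hx
      simp only [hb] at hx ⊢
      linarith
  filter_upwards [hlim.eventually_le_const (lt_add_of_pos_right _ hη)] with n hn
  have hset : μ.real {ω | |driftless γ δ Q ξ n ω| ≤ c} =
      (μ.map (driftless γ δ Q ξ n)).real {x | |x| ≤ c} := by
    rw [map_measureReal_apply (h.measurable_driftless hQ γ δ n)
      (measurableSet_le (by fun_prop) (by fun_prop))]
    rfl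
  rw [hset]
  refine (measureReal_abs_le_le_integral_charFun _ hc).trans ?_
  gcongr
  refine le_trans (integral_mono ?_ ?_ fun z => le_max_left _ (b z)) hn
  · exact Integrable.of_bound (C := 1) (hcf n).aestronglyMeasurable (ae_of_all _ fun z => by
      rw [norm_norm]; exact hcf1 n z)
  · exact Integrable.of_bound (C := 1) (hfm n).aestronglyMeasurable (ae_of_all _ (hf1 n))

/-- A recursion `Qₙ₊₁ = Qₙ + γₙ (Dₙ + ξₙ)` with `E|Dₙ| = O(γₙ^(1/2))` puts little mass within
`c n^(-γ/2)` of the origin. -/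
theorem anticoncentration [IsFiniteMeasure μ] (hμ : μ.real Set.univ ≤ 1)
    (h : IsAsymptoticNoise μ ℱ ξ σ2 C ε Y) {γ K : ℝ} (hγ0 : 0 < γ) (hγ : γ < 1)
    {Q D : ℕ → Ω → ℝ} (hQ : ∀ n, Measurable[ℱ n] (Q n)) (hD : ∀ n, Integrable (D n) μ)
    (hDK : ∀ n, ∫ ω, |D n ω| ∂μ ≤ K * pstep (γ / 2) n)
    (hrec : ∀ n ω, Q (n + 1) ω = Q n ω + pstep γ n * (D n ω + ξ n ω)) {τ : ℝ} (hτ : 0 < τ) :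
    ∃ c, 0 < c ∧ ∀ᶠ n : ℕ in atTop,
      μ.real {ω | |Q n ω| < c * (n : ℝ) ^ (-(γ / 2))} ≤ τ := by
  set N := ProbabilityTheory.gaussianReal 0 1
  have hK : 0 ≤ K := by
    have h1 := hDK 0
    have h2 : 0 ≤ ∫ ω, |D 0 ω| ∂μ := integral_nonneg fun _ => abs_nonneg _
    exact nonneg_of_mul_nonneg_left (h2.trans h1) (pstep_pos _ _)
  have hσ := h.var_pos
  have hlim : Tendsto (fun x : ℝ => ∫ z, Real.exp (-(z ^ 2 * σ2 / 16 * x)) ∂N) atTop (𝓝 0) := by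
    rw [← integral_zero ℝ ℝ (μ := N)]
    refine tendsto_integral_filter_of_dominated_convergence (fun _ => 1)
      (Eventually.of_forall fun x => by fun_prop) ?_ (integrable_const _) ?_
    · filter_upwards [eventually_ge_atTop 0] with x hx
      refine ae_of_all _ fun z => ?_
      rw [Real.norm_eq_abs, abs_of_pos (Real.exp_pos _), Real.exp_le_one_iff]
      have : 0 ≤ z ^ 2 * σ2 / 16 * x := by positivity
      linarith
    -- At `z = 0` the integrand is constantly `1`; the Gaussian has no atom there.
    · have : NullSingletonClass N :=
        ProbabilityTheory.nullSingletonClass_gaussianReal one_ne_zero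
      have hne : ∀ᵐ z ∂N, z ≠ 0 := by
        rw [ae_iff]; simp
      filter_upwards [hne] with z hz
      have hz2 : 0 < z ^ 2 * σ2 / 16 := by positivity
      exact Real.tendsto_exp_neg_atTop_nhds_zero.comp (tendsto_id.const_mul_atTop hz2)
  have hlim' : Tendsto (fun h : ℝ => ∫ z, Real.exp (-(z ^ 2 * σ2 / 16 * (h ^ 2)⁻¹)) ∂N)
      (𝓝[>] 0) (𝓝 0) := by
    refine hlim.comp (tendsto_inv_nhdsGT_zero.comp ?_)
    rw [tendsto_nhdsWithin_iff]
    constructor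
    · have : Tendsto (fun h : ℝ => h ^ 2) (𝓝 0) (𝓝 (0 ^ 2)) := (continuous_pow 2).tendsto 0
      rw [zero_pow two_ne_zero] at this
      exact this.mono_left nhdsWithin_le_nhds
    · filter_upwards [self_mem_nhdsWithin] with x hx
      exact pow_pos (Set.mem_Ioi.1 hx) 2
  have hch : ∀ᶠ r : ℝ in 𝓝[>] 0, (0 < r ∧ r ≤ 1) ∧ 4 * K * r ≤ τ / 2 ∧
      ∫ z, Real.exp (-(z ^ 2 * σ2 / 16 * (r ^ 2)⁻¹)) ∂N ≤ τ / 8 := by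
    refine (Eventually.and ?_ (Eventually.and ?_ (hlim'.eventually_le_const (by positivity))))
    · filter_upwards [Ioc_mem_nhdsGT (zero_lt_one' ℝ)] with r hr using hr
    · have : Tendsto (fun r : ℝ => 4 * K * r) (𝓝[>] 0) (𝓝 (4 * K * 0)) :=
        ((continuous_const_mul (4 * K)).tendsto 0).mono_left nhdsWithin_le_nhds
      rw [mul_zero] at this
      exact this.eventually_le_const (by positivity)
  obtain ⟨r, ⟨hr0, hr1⟩, hr2, hr3⟩ := hch.exists
  have hδ1 : r ^ 4 ≤ 1 := pow_le_one₀ hr0.le hr1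
  -- With `δ = r⁴`, the rescaled noise has size at least of order `√δ = r²` and the rescaled drift
  -- has mean at most `4Kδ = 4K r⁴`. The threshold `r³` lies between the two: Markov's inequality
  -- for the drift gives `4Kr`, and the Gaussian exponent becomes `z² σ2 / (16 r²)`, which tends to
  -- infinity as `r → 0`.
  refine ⟨r ^ 3, by positivity, ?_⟩
  filter_upwards [eventually_windowStart hγ0 hγ (pow_pos hr0 4) hδ1,
    h.eventually_driftless_small hμ hγ0 hγ (pow_pos hr0 4) hδ1 hQ
      (c := 2 * r ^ 3) (by positivity) (η := τ / 8) (by positivity)]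
    with n ⟨hn, hk2, hL1, hL2⟩ hsmall
  have hn0 : (0 : ℝ) < n := by exact_mod_cast hn
  set δ := r ^ 4 with hδ
  set k := windowStart γ δ n with hk
  set w := (n : ℝ) ^ (-(γ / 2)) with hw
  have hw0 : 0 < w := Real.rpow_pos_of_pos hn0 _
  have hwinv : (n : ℝ) ^ (γ / 2) = w⁻¹ := by rw [hw, Real.rpow_neg hn0.le, inv_inv]
  have hwsq : (n : ℝ) ^ γ = (w ^ 2)⁻¹ := by
    rw [← inv_pow, ← hwinv, ← Real.rpow_natCast, ← Real.rpow_mul hn0.le]; norm_num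
  have hwsq' : (n : ℝ) ^ (-γ) = w ^ 2 := by rw [Real.rpow_neg hn0.le, hwsq, inv_inv]
  have hQn : ∀ m, k ≤ m → ∀ ω, Q m ω = Q k ω + ∑ j ∈ Finset.Ico k m, pstep γ j * (D j ω + ξ j ω) := by
    intro m hm ω
    induction m, hm using Nat.le_induction with
    | base => simp
    | succ m hm ih => rw [hrec, ih, Finset.sum_Ico_succ_top hm]; ring
  set d : Ω → ℝ := fun ω => ∑ j ∈ Finset.Ico k n, w⁻¹ * pstep γ j * D j ω with hd
  have hdecomp : ∀ ω, w⁻¹ * Q n ω = driftless γ δ Q ξ n ω + d ω := by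
    intro ω
    rw [hQn n (windowStart_le _ _ _), driftless, hwinv, hd]
    simp only
    rw [add_assoc, ← Finset.sum_add_distrib, mul_add, Finset.mul_sum]
    congr 1
    refine Finset.sum_congr rfl fun j _ => ?_
    ring
  have hdi : Integrable d μ := integrable_finsetSum _ fun j _ => (hD j).const_mul _
  have hdb : ∫ ω, |d ω| ∂μ ≤ 4 * K * δ := by
    have h1 : ∀ ω, |d ω| ≤ ∑ j ∈ Finset.Ico k n, 2 * w * |D j ω| := by
      intro ω
      refine (Finset.abs_sum_le_sum_abs _ _).trans (Finset.sum_le_sum fun j hj => ?_)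
      rw [Finset.mem_Ico] at hj
      have h2 := pstep_le_two_mul_rpow_neg hγ0.le hγ.le hn (j := j) (by omega)
      rw [hwsq'] at h2
      have h0 := (pstep_pos γ j).le
      rw [abs_mul, abs_of_nonneg (by positivity)]
      refine mul_le_mul_of_nonneg_right ?_ (abs_nonneg _)
      calc w⁻¹ * pstep γ j ≤ w⁻¹ * (2 * w ^ 2) := by gcongr
        _ = 2 * w := by field_simp
    refine (integral_mono hdi.abs (integrable_finsetSum _ fun j _ =>
      (hD j).abs.const_mul (2 * w)) h1).trans ?_
    rw [integral_finsetSum _ fun j _ => (hD j).abs.const_mul (2 * w)]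
    have h2 : ∀ j ∈ Finset.Ico k n, ∫ ω, 2 * w * |D j ω| ∂μ ≤ 4 * K * w ^ 2 := by
      intro j hj
      rw [Finset.mem_Ico] at hj
      rw [integral_const_mul]
      have h3 := pstep_le_two_mul_rpow_neg (g := γ / 2) (by linarith) (by linarith) hn (j := j)
        (by omega)
      calc 2 * w * ∫ ω, |D j ω| ∂μ ≤ 2 * w * (K * pstep (γ / 2) j) := by gcongr; exact hDK j
        _ ≤ 2 * w * (K * (2 * w)) := by gcongr
        _ = 4 * K * w ^ 2 := by ring
    refine (Finset.sum_le_sum h2).trans ?_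
    rw [Finset.sum_const, nsmul_eq_mul, Nat.card_Ico]
    rw [hwsq] at hL2
    calc _ ≤ (δ * (w ^ 2)⁻¹) * (4 * K * w ^ 2) := by gcongr
      _ = 4 * K * δ := by field_simp
  -- If `Q n` is small, then either the driftless position is small or the accumulated drift is at
  -- least `r³`.
  have hsub : {ω | |Q n ω| < r ^ 3 * w} ⊆
      {ω | |driftless γ δ Q ξ n ω| ≤ 2 * r ^ 3} ∪ {ω | r ^ 3 ≤ |d ω|} := by
    intro ω hω
    simp only [Set.mem_ofPred_eq, Set.mem_union] at hω ⊢
    by_contra hcon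
    push Not at hcon
    have h1 : |w⁻¹ * Q n ω| < r ^ 3 := by
      rw [abs_mul, abs_of_pos (inv_pos.2 hw0), inv_mul_lt_iff₀ hw0, mul_comm]
      exact hω
    rw [hdecomp] at h1
    have h2 := abs_sub (driftless γ δ Q ξ n ω + d ω) (d ω)
    rw [add_sub_cancel_right] at h2
    linarith [hcon.1, hcon.2]
  have hmarkov : μ.real {ω | r ^ 3 ≤ |d ω|} ≤ τ / 2 := by
    have h1 := mul_meas_ge_le_integral_of_nonneg (ae_of_all _ fun ω => abs_nonneg (d ω)) hdi.abs
      (r ^ 3)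
    have h2 : r ^ 3 * μ.real {ω | r ^ 3 ≤ |d ω|} ≤ r ^ 3 * (4 * K * r) := by
      refine h1.trans (hdb.trans (le_of_eq ?_))
      rw [hδ]; ring
    exact (le_of_mul_le_mul_left h2 (by positivity)).trans hr2
  refine (measureReal_mono hsub).trans ((measureReal_union_le _ _).trans ?_)
  have e : ∀ z : ℝ, (z / (2 * r ^ 3)) ^ 2 * σ2 * δ / 4 = z ^ 2 * σ2 / 16 * (r ^ 2)⁻¹ := by
    intro z
    rw [hδ]
    field_simp
    ring
  simp_rw [e] at hsmall
  linarith

end IsAsymptoticNoise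

/-! ### Coupled vector recursions and their mean-square rates. -/

/-- The measurable factor is pulled out of the conditional expectation. A general bilinear map
serves both the inner product in the mean-square step and the product of `⟨u, N⟩` with a complex
test function. -/
lemma integral_bilin_eq_zero_of_condExp_eq_zero {Ω E F H : Type*} {m m0 : MeasurableSpace Ω}
    {μ : Measure Ω} [IsFiniteMeasure μ] [NormedAddCommGroup E] [NormedSpace ℝ E] [CompleteSpace E]
    [NormedAddCommGroup F] [NormedSpace ℝ F] [NormedAddCommGroup H] [NormedSpace ℝ H]
    [CompleteSpace H] (hm : m ≤ m0) (B : F →L[ℝ] E →L[ℝ] H) {g : Ω → F} {N : Ω → E}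
    (hg : StronglyMeasurable[m] g) (hN : Integrable N μ)
    (hgN : Integrable (fun ω => B (g ω) (N ω)) μ) (h0 : μ[N | m] =ᵐ[μ] 0) :
    ∫ ω, B (g ω) (N ω) ∂μ = 0 := by
  rw [← integral_condExp hm]
  have h := condExp_bilin_of_stronglyMeasurable_left B hg hgN hN
  rw [integral_congr_ae h]
  refine integral_eq_zero_of_ae ?_
  filter_upwards [h0] with ω hω
  rw [hω]
  simp

/-- Two recursions `p`, `z` on time scales `αₙ` and `βₙ` with drifts `-X p + e`, `-W z + f`,
whose coupling terms `e`, `f` carry a factor `αₙ / βₙ`, and with dominated martingale difference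
noise. -/
structure IsCoupledSystem {Ω E : Type*} {m0 : MeasurableSpace Ω} [NormedAddCommGroup E]
    [InnerProductSpace ℝ E] [CompleteSpace E] (μ : Measure Ω) (ℱ : ℕ → MeasurableSpace Ω)
    (α β C : ℝ) (X W : E →L[ℝ] E) (p z e f N N' : ℕ → Ω → E) : Prop where
  le : ∀ n, ℱ n ≤ m0
  mono : Monotone ℱ
  C_nonneg : 0 ≤ C
  memLp_p_zero : MemLp (p 0) 2 μ
  memLp_z_zero : MemLp (z 0) 2 μ
  p_meas : ∀ n, StronglyMeasurable[ℱ n] (p n)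
  z_meas : ∀ n, StronglyMeasurable[ℱ n] (z n)
  e_meas : ∀ n, StronglyMeasurable[ℱ n] (e n)
  f_meas : ∀ n, StronglyMeasurable[ℱ n] (f n)
  N_meas : ∀ n, StronglyMeasurable[ℱ (n + 1)] (N n)
  N'_meas : ∀ n, StronglyMeasurable[ℱ (n + 1)] (N' n)
  e_le : ∀ n ω, ‖e n ω‖ ≤ C * (pstep (α - β) n * (‖p n ω‖ + ‖z n ω‖))
  f_le : ∀ n ω, ‖f n ω‖ ≤ C * (pstep (α - β) n * (‖p n ω‖ + ‖z n ω‖))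
  N_le : ∀ n, ∀ᵐ ω ∂μ, ‖N n ω‖ ≤ C * (1 + ‖p n ω‖ + ‖z n ω‖)
  N'_le : ∀ n, ∀ᵐ ω ∂μ, ‖N' n ω‖ ≤ C * (1 + ‖p n ω‖ + ‖z n ω‖)
  condExp_N : ∀ n, μ[N n | ℱ n] =ᵐ[μ] 0
  condExp_N' : ∀ n, μ[N' n | ℱ n] =ᵐ[μ] 0
  p_succ : ∀ n ω, p (n + 1) ω = p n ω + pstep α n • (-X (p n ω) + e n ω + N n ω)
  z_succ : ∀ n ω, z (n + 1) ω = z n ω + pstep β n • (-W (z n ω) + f n ω + N' n ω)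

/-- One step of the mean-square recursion. -/
lemma integral_norm_sq_step_le {Ω E : Type*} {m m0 : MeasurableSpace Ω} [NormedAddCommGroup E]
    [InnerProductSpace ℝ E] [CompleteSpace E] {μ : Measure Ω} [IsFiniteMeasure μ] (hm : m ≤ m0)
    {X : E →L[ℝ] E} {κ γ : ℝ} (hκ : 0 < κ) (hγ : 0 < γ) (hX : ∀ x, κ * ‖x‖ ^ 2 ≤ inner ℝ x (X x))
    {q e N : Ω → E} (hq : MemLp q 2 μ) (he : MemLp e 2 μ) (hN : MemLp N 2 μ)
    (hqm : StronglyMeasurable[m] q) (hem : StronglyMeasurable[m] e) (hN0 : μ[N | m] =ᵐ[μ] 0) :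
    ∫ ω, ‖q ω + γ • (-X (q ω) + e ω + N ω)‖ ^ 2 ∂μ ≤
      (1 - κ * γ) * ∫ ω, ‖q ω‖ ^ 2 ∂μ + γ / κ * ∫ ω, ‖e ω‖ ^ 2 ∂μ +
      γ ^ 2 * (2 * ‖X‖ ^ 2 * ∫ ω, ‖q ω‖ ^ 2 ∂μ + 2 * ∫ ω, ‖e ω‖ ^ 2 ∂μ + ∫ ω, ‖N ω‖ ^ 2 ∂μ) := by
  have hXq : MemLp (fun ω => X (q ω)) 2 μ := X.comp_memLp' hq
  set g : Ω → E := fun ω => q ω + γ • (-X (q ω) + e ω) with hg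
  have hgL : MemLp g 2 μ := hq.add ((hXq.neg.add he).const_smul γ)
  have hgm : StronglyMeasurable[m] g :=
    hqm.add (((X.continuous.comp_stronglyMeasurable hqm).neg.add hem).const_smul γ)
  have hgN : Integrable (fun ω => inner ℝ (g ω) (N ω)) μ :=
    (hgL.norm.integrable_mul hN.norm).mono' (hgL.1.inner hN.1)
      (ae_of_all _ fun ω => norm_inner_le_norm (𝕜 := ℝ) _ _)
  -- `g` is the part of the next iterate known before the noise is revealed, hence orthogonal to the
  -- noise.
  have horth : ∫ ω, inner ℝ (g ω) (N ω) ∂μ = 0 :=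
    integral_bilin_eq_zero_of_condExp_eq_zero hm (innerSL ℝ) hgm (hN.integrable one_le_two) hgN hN0
  have iq := hq.integrable_norm_pow two_ne_zero
  have ie := he.integrable_norm_pow two_ne_zero
  have iN := hN.integrable_norm_pow two_ne_zero
  have hpt : ∀ ω, ‖q ω + γ • (-X (q ω) + e ω + N ω)‖ ^ 2 ≤
      (1 - κ * γ + γ ^ 2 * (2 * ‖X‖ ^ 2)) * ‖q ω‖ ^ 2 + (γ / κ + γ ^ 2 * 2) * ‖e ω‖ ^ 2 +
      γ ^ 2 * ‖N ω‖ ^ 2 + 2 * γ * inner ℝ (g ω) (N ω) := by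
    intro ω
    have e1 : q ω + γ • (-X (q ω) + e ω + N ω) = g ω + γ • N ω := by
      simp only [hg, smul_add]; abel
    rw [e1, norm_add_sq_real, norm_smul, inner_smul_right, Real.norm_eq_abs, abs_of_pos hγ]
    have e2 : ‖g ω‖ ^ 2 = ‖q ω‖ ^ 2 + 2 * γ * (-inner ℝ (q ω) (X (q ω)) + inner ℝ (q ω) (e ω)) +
        γ ^ 2 * ‖-X (q ω) + e ω‖ ^ 2 := by
      rw [hg]
      simp only
      rw [norm_add_sq_real, norm_smul, inner_smul_right, inner_add_right, inner_neg_right,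
        Real.norm_eq_abs, abs_of_pos hγ]
      ring
    have h1 := hX (q ω)
    -- Coercivity contracts by `2κγ`; Young's inequality with weight `κ` spends half of it on the
    -- coupling, leaving `1 - κγ`.
    have h2 : 2 * inner ℝ (q ω) (e ω) ≤ κ * ‖q ω‖ ^ 2 + ‖e ω‖ ^ 2 / κ := by
      have h3 := real_inner_le_norm (q ω) (e ω)
      have h4 : 0 ≤ (κ * ‖q ω‖ - ‖e ω‖) ^ 2 / κ := by positivity
      have h5 : (κ * ‖q ω‖ - ‖e ω‖) ^ 2 / κ =
        κ * ‖q ω‖ ^ 2 + ‖e ω‖ ^ 2 / κ - 2 * (‖q ω‖ * ‖e ω‖) := by field_simp; ring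
      linarith
    have h6 : ‖-X (q ω) + e ω‖ ^ 2 ≤ 2 * ‖X‖ ^ 2 * ‖q ω‖ ^ 2 + 2 * ‖e ω‖ ^ 2 := by
      have h7 : ‖-X (q ω) + e ω‖ ≤ ‖X‖ * ‖q ω‖ + ‖e ω‖ := by
        refine (norm_add_le _ _).trans ?_
        rw [norm_neg]
        gcongr
        exact X.le_opNorm _
      calc _ ≤ (‖X‖ * ‖q ω‖ + ‖e ω‖) ^ 2 := by gcongr
        _ ≤ _ := by nlinarith [sq_nonneg (‖X‖ * ‖q ω‖ - ‖e ω‖)]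
    have h8 := mul_le_mul_of_nonneg_left h1 (by positivity : 0 ≤ 2 * γ)
    have h9 := mul_le_mul_of_nonneg_left h2 hγ.le
    have h10 := mul_le_mul_of_nonneg_left h6 (sq_nonneg γ)
    have e3 : γ * (κ * ‖q ω‖ ^ 2 + ‖e ω‖ ^ 2 / κ) =
      γ * κ * ‖q ω‖ ^ 2 + γ / κ * ‖e ω‖ ^ 2 := by ring
    rw [e3] at h9
    rw [e2]
    linarith
  have i1 := iq.const_mul (1 - κ * γ + γ ^ 2 * (2 * ‖X‖ ^ 2))
  have i2 := ie.const_mul (γ / κ + γ ^ 2 * 2)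
  have i3 := iN.const_mul (γ ^ 2)
  have i4 := hgN.const_mul (2 * γ)
  have i12 := i1.fun_add i2
  have i123 := i12.fun_add i3
  have hleft : Integrable (fun ω => ‖q ω + γ • (-X (q ω) + e ω + N ω)‖ ^ 2) μ :=
    (hq.add (((hXq.neg.add he).add hN).const_smul γ)).integrable_norm_pow two_ne_zero
  refine (integral_mono hleft (i123.fun_add i4) hpt).trans (le_of_eq ?_)
  rw [integral_add i123 i4, integral_add i12 i3, integral_add i1 i2, integral_const_mul,
    integral_const_mul, integral_const_mul, integral_const_mul, horth]
  ring

namespace IsCoupledSystem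

variable {Ω E : Type*} {m0 : MeasurableSpace Ω} [NormedAddCommGroup E]
    [InnerProductSpace ℝ E] [CompleteSpace E] {μ : Measure Ω} {ℱ : ℕ → MeasurableSpace Ω}
    {α β C : ℝ} {X W : E →L[ℝ] E} {p z e f N N' : ℕ → Ω → E}

/-- Domination carries square integrability from the iterates to couplings and noise of the same
index, and the recursion carries it on to the next iterates. -/
lemma memLp [IsFiniteMeasure μ] (h : IsCoupledSystem μ ℱ α β C X W p z e f N N') (n : ℕ) :
    (MemLp (p n) 2 μ ∧ MemLp (z n) 2 μ) ∧ (MemLp (e n) 2 μ ∧ MemLp (f n) 2 μ) ∧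
      MemLp (N n) 2 μ ∧ MemLp (N' n) 2 μ := by
  have key : ∀ n, MemLp (p n) 2 μ ∧ MemLp (z n) 2 μ → (MemLp (e n) 2 μ ∧ MemLp (f n) 2 μ) ∧
      MemLp (N n) 2 μ ∧ MemLp (N' n) 2 μ := by
    rintro n ⟨hp, hz⟩
    have hpz : MemLp (fun ω => ‖p n ω‖ + ‖z n ω‖) 2 μ := hp.norm.add hz.norm
    have h1 : MemLp (fun ω => C * (pstep (α - β) n * (‖p n ω‖ + ‖z n ω‖))) 2 μ :=
      (hpz.const_mul _).const_mul _
    have h0 : MemLp (fun _ : Ω => (1 : ℝ)) 2 μ := memLp_const 1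
    have h1p : MemLp (fun ω => 1 + ‖p n ω‖) 2 μ := h0.add hp.norm
    have h1pz : MemLp (fun ω => 1 + ‖p n ω‖ + ‖z n ω‖) 2 μ := h1p.add hz.norm
    have h2 : MemLp (fun ω => C * (1 + ‖p n ω‖ + ‖z n ω‖)) 2 μ := h1pz.const_mul _
    refine ⟨⟨h1.mono' ((h.e_meas n).mono (h.le _)).aestronglyMeasurable (ae_of_all _ (h.e_le n)),
      h1.mono' ((h.f_meas n).mono (h.le _)).aestronglyMeasurable (ae_of_all _ (h.f_le n))⟩,
      h2.mono' ((h.N_meas n).mono (h.le _)).aestronglyMeasurable (h.N_le n),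
      h2.mono' ((h.N'_meas n).mono (h.le _)).aestronglyMeasurable (h.N'_le n)⟩
  have main : ∀ n, MemLp (p n) 2 μ ∧ MemLp (z n) 2 μ := by
    intro n
    induction n with
    | zero => exact ⟨h.memLp_p_zero, h.memLp_z_zero⟩
    | succ n ih =>
      obtain ⟨⟨he, hf⟩, hN, hN'⟩ := key n ih
      constructor
      · have e1 : p (n + 1) = fun ω => p n ω + pstep α n • (-X (p n ω) + e n ω + N n ω) :=
          funext (h.p_succ n)
        have hXp : MemLp (fun ω => X (p n ω)) 2 μ := X.comp_memLp' ih.1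
        rw [e1]
        exact ih.1.add (((hXp.neg.add he).add hN).const_smul _)
      · have e1 : z (n + 1) = fun ω => z n ω + pstep β n • (-W (z n ω) + f n ω + N' n ω) :=
          funext (h.z_succ n)
        have hWz : MemLp (fun ω => W (z n ω)) 2 μ := W.comp_memLp' ih.2
        rw [e1]
        exact ih.2.add (((hWz.neg.add hf).add hN').const_smul _)
  exact ⟨main n, key n (main n)⟩

lemma integral_norm_sq_le [IsFiniteMeasure μ] (h : IsCoupledSystem μ ℱ α β C X W p z e f N N')
    {n : ℕ} {c : ℝ} {g : Ω → E} (hg : ∀ ω, ‖g ω‖ ≤ c * (‖p n ω‖ + ‖z n ω‖)) :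
    ∫ ω, ‖g ω‖ ^ 2 ∂μ ≤ 2 * c ^ 2 * (∫ ω, ‖p n ω‖ ^ 2 ∂μ + ∫ ω, ‖z n ω‖ ^ 2 ∂μ) := by
  obtain ⟨⟨hp, hz⟩, -⟩ := h.memLp n
  have ip := hp.integrable_norm_pow two_ne_zero
  have iz := hz.integrable_norm_pow two_ne_zero
  rw [← integral_add ip iz, ← integral_const_mul]
  refine integral_mono_of_nonneg (ae_of_all _ fun ω => by positivity) ((ip.fun_add iz).const_mul _)
    (ae_of_all _ fun ω => ?_)
  calc ‖g ω‖ ^ 2 ≤ (c * (‖p n ω‖ + ‖z n ω‖)) ^ 2 := by gcongr; exact hg ω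
    _ = c ^ 2 * (‖p n ω‖ + ‖z n ω‖) ^ 2 := by ring
    _ ≤ c ^ 2 * (2 * (‖p n ω‖ ^ 2 + ‖z n ω‖ ^ 2)) := by
        gcongr; nlinarith [sq_nonneg (‖p n ω‖ - ‖z n ω‖)]
    _ = _ := by ring

lemma sq_le_of_le {C a b x : ℝ} (hx : 0 ≤ x) (h : x ≤ C * (1 + a + b)) :
    x ^ 2 ≤ 3 * C ^ 2 * (1 + (a ^ 2 + b ^ 2)) := by
  calc x ^ 2 ≤ (C * (1 + a + b)) ^ 2 := by gcongr
    _ = C ^ 2 * (1 + a + b) ^ 2 := by ring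
    _ ≤ C ^ 2 * (3 * (1 + (a ^ 2 + b ^ 2))) := by
        gcongr; nlinarith [sq_nonneg (a - b), sq_nonneg (a - 1), sq_nonneg (b - 1)]
    _ = _ := by ring

lemma integral_noise_sq_le [IsFiniteMeasure μ] (hμ : μ.real Set.univ ≤ 1)
    (h : IsCoupledSystem μ ℱ α β C X W p z e f N N') {n : ℕ} {g : Ω → E}
    (hg : ∀ᵐ ω ∂μ, ‖g ω‖ ≤ C * (1 + ‖p n ω‖ + ‖z n ω‖)) :
    ∫ ω, ‖g ω‖ ^ 2 ∂μ ≤ 3 * C ^ 2 * (1 + ∫ ω, ‖p n ω‖ ^ 2 ∂μ + ∫ ω, ‖z n ω‖ ^ 2 ∂μ) := by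
  obtain ⟨⟨hp, hz⟩, -⟩ := h.memLp n
  have ip := hp.integrable_norm_pow two_ne_zero
  have iz := hz.integrable_norm_pow two_ne_zero
  have i1 : Integrable (fun ω => 1 + (‖p n ω‖ ^ 2 + ‖z n ω‖ ^ 2)) μ :=
    (integrable_const 1).fun_add (ip.fun_add iz)
  refine (integral_mono_of_nonneg (g := fun ω => 3 * C ^ 2 * (1 + (‖p n ω‖ ^ 2 + ‖z n ω‖ ^ 2)))
    (ae_of_all _ fun ω => by positivity) (i1.const_mul _) ?_).trans ?_
  · filter_upwards [hg] with ω hω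
    exact sq_le_of_le (norm_nonneg _) hω
  · rw [integral_const_mul, integral_add (integrable_const 1) (ip.fun_add iz), integral_add ip iz,
      integral_const, smul_eq_mul, mul_one, add_assoc]
    gcongr

/-- Mean-square convergence rates: `E‖pₙ‖² = O(αₙ)` and `E‖zₙ‖² = O(βₙ)`. -/
theorem mean_square_rates [IsFiniteMeasure μ] (hμ : μ.real Set.univ ≤ 1)
    (h : IsCoupledSystem μ ℱ α β C X W p z e f N N') (hα : α < 1) (hαβ : β < α) (hβ : 0 < β)
    {κ : ℝ} (hκ : 0 < κ) (hX : ∀ x, κ * ‖x‖ ^ 2 ≤ inner ℝ x (X x))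
    (hW : ∀ x, κ * ‖x‖ ^ 2 ≤ inner ℝ x (W x)) :
    ∃ K, 0 < K ∧ ∀ n, ∫ ω, ‖p n ω‖ ^ 2 ∂μ ≤ K * pstep α n ∧ ∫ ω, ‖z n ω‖ ^ 2 ∂μ ≤ K * pstep β n := by
  have hr : 0 ≤ α - β := by linarith
  have hC := h.C_nonneg
  -- One estimate for both components: `q` stands for `p` with `T = X` or for `z` with `T = W`, and
  -- the output has the shape required by `two_timescale_rates`.
  have step : ∀ (T : E →L[ℝ] E), (∀ x, κ * ‖x‖ ^ 2 ≤ inner ℝ x (T x)) → ∀ (γ : ℝ) (n : ℕ)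
      (q g M : Ω → E), MemLp q 2 μ → MemLp g 2 μ → MemLp M 2 μ → StronglyMeasurable[ℱ n] q →
      StronglyMeasurable[ℱ n] g → μ[M | ℱ n] =ᵐ[μ] 0 →
      (∀ ω, ‖g ω‖ ≤ C * (pstep (α - β) n * (‖p n ω‖ + ‖z n ω‖))) →
      (∀ᵐ ω ∂μ, ‖M ω‖ ≤ C * (1 + ‖p n ω‖ + ‖z n ω‖)) →
      ∫ ω, ‖q ω‖ ^ 2 ∂μ ≤ ∫ ω, ‖p n ω‖ ^ 2 ∂μ + ∫ ω, ‖z n ω‖ ^ 2 ∂μ →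
      ∫ ω, ‖q ω + pstep γ n • (-T (q ω) + g ω + M ω)‖ ^ 2 ∂μ ≤
        (1 - κ * pstep γ n) * ∫ ω, ‖q ω‖ ^ 2 ∂μ +
        (2 * C ^ 2 / κ + 2 * (‖X‖ ^ 2 + ‖W‖ ^ 2 + ‖T‖ ^ 2) + 7 * C ^ 2) *
          (pstep γ n * pstep (α - β) n ^ 2 * (∫ ω, ‖p n ω‖ ^ 2 ∂μ + ∫ ω, ‖z n ω‖ ^ 2 ∂μ) +
          pstep γ n ^ 2 * (1 + ∫ ω, ‖p n ω‖ ^ 2 ∂μ + ∫ ω, ‖z n ω‖ ^ 2 ∂μ)) := by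
    intro T hT γ n q g M hq hg hM hqm hgm hM0 hgb hMb hqb
    have h1 := integral_norm_sq_step_le (h.le n) hκ (pstep_pos γ n) hT hq hg hM hqm hgm hM0
    have h2 := h.integral_norm_sq_le (n := n) (c := C * pstep (α - β) n) (g := g) (fun ω => (hgb ω).trans_eq (by ring))
    have h3 := h.integral_noise_sq_le hμ hMb
    have hr1 := pstep_le_one hr n
    have hr0 := pstep_pos (α - β) n
    have hg0 := pstep_pos γ n
    have hu0 : 0 ≤ ∫ ω, ‖p n ω‖ ^ 2 ∂μ := integral_nonneg fun ω => by positivity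
    have hv0 : 0 ≤ ∫ ω, ‖z n ω‖ ^ 2 ∂μ := integral_nonneg fun ω => by positivity
    set u := ∫ ω, ‖p n ω‖ ^ 2 ∂μ
    set v := ∫ ω, ‖z n ω‖ ^ 2 ∂μ
    set r := pstep (α - β) n
    set g' := pstep γ n
    have h4 : ∫ ω, ‖g ω‖ ^ 2 ∂μ ≤ 2 * C ^ 2 * (1 + u + v) := by
      refine h2.trans ?_
      have : (C * r) ^ 2 ≤ C ^ 2 := by
        rw [mul_pow]; exact mul_le_of_le_one_right (by positivity) (pow_le_one₀ hr0.le hr1)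
      gcongr
      linarith
    have t1 : g' / κ * ∫ ω, ‖g ω‖ ^ 2 ∂μ ≤ 2 * C ^ 2 / κ * (g' * r ^ 2 * (u + v)) := by
      calc _ ≤ g' / κ * (2 * (C * r) ^ 2 * (u + v)) := by gcongr
        _ = _ := by ring
    have t2 : 2 * ‖T‖ ^ 2 * ∫ ω, ‖q ω‖ ^ 2 ∂μ ≤
        2 * (‖X‖ ^ 2 + ‖W‖ ^ 2 + ‖T‖ ^ 2) * (1 + u + v) := by
      gcongr
      · nlinarith [sq_nonneg ‖X‖, sq_nonneg ‖W‖]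
      · linarith
    have t3 : g' ^ 2 * (2 * ‖T‖ ^ 2 * ∫ ω, ‖q ω‖ ^ 2 ∂μ + 2 * ∫ ω, ‖g ω‖ ^ 2 ∂μ + ∫ ω, ‖M ω‖ ^ 2 ∂μ) ≤
        g' ^ 2 * ((2 * (‖X‖ ^ 2 + ‖W‖ ^ 2 + ‖T‖ ^ 2) + 7 * C ^ 2) * (1 + u + v)) := by
      gcongr
      linarith
    have t4 : 0 ≤ (2 * (‖X‖ ^ 2 + ‖W‖ ^ 2 + ‖T‖ ^ 2) + 7 * C ^ 2) * (g' * r ^ 2 * (u + v)) := by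
      positivity
    have t5 : 0 ≤ 2 * C ^ 2 / κ * (g' ^ 2 * (1 + u + v)) := by positivity
    linarith
  set C' := 2 * C ^ 2 / κ + 2 * (‖X‖ ^ 2 + ‖W‖ ^ 2 + (‖X‖ ^ 2 + ‖W‖ ^ 2)) + 7 * C ^ 2 with hC'
  have hint0 : ∀ (q : Ω → E), 0 ≤ ∫ ω, ‖q ω‖ ^ 2 ∂μ := fun q => integral_nonneg fun ω => by positivity
  refine two_timescale_rates hα hαβ hβ hκ (C := C') (by positivity) (fun n => hint0 (p n))
    (fun n => hint0 (z n)) (fun n => ?_) (fun n => ?_)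
  · obtain ⟨⟨hp, hz⟩, ⟨he, hf⟩, hN, hN'⟩ := h.memLp n
    simp_rw [h.p_succ]
    refine (step X hX α n (p n) (e n) (N n) hp he hN (h.p_meas n) (h.e_meas n) (h.condExp_N n)
      (h.e_le n) (h.N_le n) (by linarith [hint0 (z n)])).trans ?_
    have := hint0 (p n)
    have := hint0 (z n)
    have := pstep_pos α n
    gcongr
    rw [hC']
    nlinarith [sq_nonneg ‖W‖]
  · obtain ⟨⟨hp, hz⟩, ⟨he, hf⟩, hN, hN'⟩ := h.memLp n
    simp_rw [h.z_succ]
    refine (step W hW β n (z n) (f n) (N' n) hz hf hN' (h.z_meas n) (h.f_meas n) (h.condExp_N' n)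
      (h.f_le n) (h.N'_le n) (by linarith [hint0 (p n)])).trans ?_
    have := hint0 (p n)
    have := hint0 (z n)
    have := pstep_pos β n
    gcongr
    rw [hC']
    nlinarith [sq_nonneg ‖X‖]

end IsCoupledSystem

lemma pstep_anti_exponent {a b : ℝ} (hab : a ≤ b) (n : ℕ) : pstep b n ≤ pstep a n :=
  Real.rpow_le_rpow_of_exponent_le (by linarith [(Nat.cast_nonneg n : (0 : ℝ) ≤ n)]) (by linarith)

lemma pstep_half_sq (γ : ℝ) (n : ℕ) : pstep (γ / 2) n ^ 2 = pstep γ n := by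
  rw [pow_two, ← pstep_add]; ring_nf

/-- Integrate `‖q‖ ≤ t + ‖q‖²/t`, which stands in for the Cauchy–Schwarz inequality and avoids
square roots of integrals. -/
lemma integral_norm_le_of_integral_sq_le {Ω E : Type*} {m0 : MeasurableSpace Ω}
    [NormedAddCommGroup E] {μ : Measure Ω} [IsFiniteMeasure μ] (hμ : μ.real Set.univ ≤ 1)
    {q : Ω → E} (hq : MemLp q 2 μ) {K t : ℝ} (ht : 0 < t) (h : ∫ ω, ‖q ω‖ ^ 2 ∂μ ≤ K * t ^ 2) :
    ∫ ω, ‖q ω‖ ∂μ ≤ (1 + K) * t := by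
  have iq := hq.integrable_norm_pow two_ne_zero
  have hpt : ∀ ω, ‖q ω‖ ≤ t + t⁻¹ * ‖q ω‖ ^ 2 := by
    intro ω
    have h1 : 0 ≤ t⁻¹ * (‖q ω‖ - t) ^ 2 := by positivity
    have h2 : t⁻¹ * (‖q ω‖ - t) ^ 2 = t⁻¹ * ‖q ω‖ ^ 2 - 2 * ‖q ω‖ + t := by field_simp; ring
    have := norm_nonneg (q ω)
    linarith
  have i1 : Integrable (fun ω => t + t⁻¹ * ‖q ω‖ ^ 2) μ :=
    (integrable_const t).fun_add (iq.const_mul _)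
  refine (integral_mono (hq.integrable one_le_two).norm i1 hpt).trans ?_
  rw [integral_add (integrable_const t) (iq.const_mul _), integral_const, integral_const_mul,
    smul_eq_mul]
  have h3 : t⁻¹ * ∫ ω, ‖q ω‖ ^ 2 ∂μ ≤ K * t := by
    calc _ ≤ t⁻¹ * (K * t ^ 2) := by gcongr
      _ = K * t := by field_simp
  have h4 := mul_le_mul_of_nonneg_right hμ ht.le
  linarith

/-! ### Anti-concentration of coupled systems. -/

/-- Anti-concentration is stable under perturbations of smaller order. -/
lemma anticoncentration_of_perturbation {Ω E : Type*} {m0 : MeasurableSpace Ω}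
    [NormedAddCommGroup E] [InnerProductSpace ℝ E] {μ : Measure Ω} [IsFiniteMeasure μ]
    {u : E} (hu : ‖u‖ = 1) {q x : ℕ → Ω → E} {γ g K : ℝ} (hγ : 0 ≤ γ) (hg : γ < g)
    (hi : ∀ n, Integrable (fun ω => x n ω - q n ω) μ)
    (hx : ∀ n, ∫ ω, ‖x n ω - q n ω‖ ∂μ ≤ K * pstep g n)
    (hq : ∀ τ : ℝ, 0 < τ → ∃ c, 0 < c ∧ ∀ᶠ n : ℕ in atTop,
      μ.real {ω | |inner ℝ u (q n ω)| < c * (n : ℝ) ^ (-γ)} ≤ τ) {τ : ℝ} (hτ : 0 < τ) :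
    ∃ c, 0 < c ∧ ∀ᶠ n : ℕ in atTop, μ.real {ω | ‖x n ω‖ < c * (n : ℝ) ^ (-γ)} ≤ τ := by
  obtain ⟨c, hc, hev⟩ := hq (τ / 2) (half_pos hτ)
  refine ⟨c / 2, half_pos hc, ?_⟩
  have hK : 0 ≤ K := nonneg_of_mul_nonneg_left
    ((integral_nonneg fun _ => norm_nonneg _).trans (hx 0)) (pstep_pos _ _)
  -- The constant is what Markov's inequality at level `c/2 · n^(-γ)` needs to give probability
  -- `τ/2`; `K + 1` guards against `K = 0`.
  filter_upwards [hev, eventually_gt_atTop 0,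
    eventually_pstep_le hg (c := c / 2 * (τ / 2) / (K + 1)) (by positivity)] with n h1 hn h2
  have hn0 : (0 : ℝ) < n := by exact_mod_cast hn
  set w := (n : ℝ) ^ (-γ)
  have hw0 : 0 < w := Real.rpow_pos_of_pos hn0 _
  have hw : pstep γ n ≤ w :=
    Real.rpow_le_rpow_of_nonpos hn0 (by linarith) (by linarith)
  have hsub : {ω | ‖x n ω‖ < c / 2 * w} ⊆
      {ω | |inner ℝ u (q n ω)| < c * w} ∪ {ω | c / 2 * w ≤ ‖x n ω - q n ω‖} := by
    intro ω hω
    simp only [Set.mem_ofPred_eq, Set.mem_union] at hω ⊢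
    by_contra hcon
    push Not at hcon
    have h3 := abs_real_inner_le_norm u (q n ω)
    rw [hu, one_mul] at h3
    have h4 : ‖q n ω‖ ≤ ‖x n ω‖ + ‖x n ω - q n ω‖ := by
      have := norm_sub_le (x n ω) (x n ω - q n ω)
      rwa [sub_sub_cancel] at this
    linarith [hcon.1, hcon.2]
  have hmarkov : μ.real {ω | c / 2 * w ≤ ‖x n ω - q n ω‖} ≤ τ / 2 := by
    have h3 := mul_meas_ge_le_integral_of_nonneg
      (ae_of_all _ fun ω => norm_nonneg (x n ω - q n ω)) (hi n).norm (c / 2 * w)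
    have h4 : c / 2 * w * μ.real {ω | c / 2 * w ≤ ‖x n ω - q n ω‖} ≤ c / 2 * w * (τ / 2) := by
      refine h3.trans ((hx n).trans ?_)
      have hpg := pstep_pos g n
      calc K * pstep g n ≤ (K + 1) * (c / 2 * (τ / 2) / (K + 1) * pstep γ n) := by
            gcongr; exact (lt_add_one K).le
        _ = c / 2 * (τ / 2) * pstep γ n := by field_simp
        _ ≤ c / 2 * (τ / 2) * w := by gcongr
        _ = _ := by ring
    exact le_of_mul_le_mul_left h4 (by positivity)
  refine (measureReal_mono hsub).trans ((measureReal_union_le _ _).trans ?_)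
  linarith

/-- The conditional second moment of `⟨u, Nₙ⟩` tends to `σ2` in `L¹`, in weak form. -/
def HasAsymptoticVariance {Ω E : Type*} {m0 : MeasurableSpace Ω} [NormedAddCommGroup E]
    [InnerProductSpace ℝ E] (μ : Measure Ω) (ℱ : ℕ → MeasurableSpace Ω) (u : E)
    (N : ℕ → Ω → E) (σ2 : ℝ) (ε : ℕ → ℝ) : Prop :=
  0 < σ2 ∧ Tendsto ε atTop (𝓝 0) ∧
    ∀ n, ∀ G : Ω → ℂ, StronglyMeasurable[ℱ n] G → (∀ ω, ‖G ω‖ ≤ 1) →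
      ‖∫ ω, ((inner ℝ u (N n ω) ^ 2 - σ2 : ℝ) : ℂ) * G ω ∂μ‖ ≤ ε n

namespace IsCoupledSystem

variable {Ω E : Type*} {m0 : MeasurableSpace Ω} [NormedAddCommGroup E]
    [InnerProductSpace ℝ E] [CompleteSpace E] {μ : Measure Ω} {ℱ : ℕ → MeasurableSpace Ω}
    {α β C : ℝ} {X W : E →L[ℝ] E} {p z e f N N' : ℕ → Ω → E}

/-- The role of `Y` is played by `‖p‖² + ‖z‖²`, which tends to `0` in `L¹` by the mean-square rates:
the dominated noise is asymptotically bounded. -/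
lemma isAsymptoticNoise [IsFiniteMeasure μ]
    (h : IsCoupledSystem μ ℱ α β C X W p z e f N N') (hα : 0 < α) (hβ : 0 < β) {K : ℝ}
    (hK : ∀ n, ∫ ω, ‖p n ω‖ ^ 2 ∂μ ≤ K * pstep α n ∧ ∫ ω, ‖z n ω‖ ^ 2 ∂μ ≤ K * pstep β n)
    {u : E} (hu : ‖u‖ = 1) {M : ℕ → Ω → E} (hM : ∀ n, StronglyMeasurable[ℱ (n + 1)] (M n))
    (hM2 : ∀ n, MemLp (M n) 2 μ) (hM0 : ∀ n, μ[M n | ℱ n] =ᵐ[μ] 0)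
    (hMb : ∀ n, ∀ᵐ ω ∂μ, ‖M n ω‖ ≤ C * (1 + ‖p n ω‖ + ‖z n ω‖)) {σ2 : ℝ} {ε : ℕ → ℝ}
    (hvar : HasAsymptoticVariance μ ℱ u M σ2 ε) :
    IsAsymptoticNoise μ ℱ (fun n ω => inner ℝ u (M n ω)) σ2 (3 * C ^ 2) ε
      (fun n ω => ‖p n ω‖ ^ 2 + ‖z n ω‖ ^ 2) where
  le := h.le
  mono := h.mono
  adapted n := (stronglyMeasurable_const.inner (hM n)).measurable
  memLp n := (hM2 n).const_inner u
  mean_zero n G hG hG1 := by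
    have hGm : AEStronglyMeasurable G μ := (hG.mono (h.le n)).aestronglyMeasurable
    have hi := (hM2 n).integrable one_le_two
    have hi2 : Integrable (fun ω => (inner ℝ u (M n ω) : ℂ) * G ω) μ :=
      ((((hM2 n).const_inner u).integrable one_le_two).ofReal).mul_bdd (c := 1) hGm
        (ae_of_all _ hG1)
    -- The bilinear map is `(g, v) ↦ ⟨u, v⟩ g` from `ℂ × E` to `ℂ`.
    have e1 : ∀ ω, (((ContinuousLinearMap.lsmul ℝ ℝ).flip.bilinearComp
        (ContinuousLinearMap.id ℝ ℂ) (innerSL ℝ u)) (G ω) (M n ω) : ℂ) =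
        (inner ℝ u (M n ω) : ℂ) * G ω := by
      intro ω
      simp
    have := integral_bilin_eq_zero_of_condExp_eq_zero (h.le n)
      ((ContinuousLinearMap.lsmul ℝ ℝ).flip.bilinearComp
        (ContinuousLinearMap.id ℝ ℂ) (innerSL ℝ u)) hG hi (by simpa only [e1] using hi2) (hM0 n)
    simpa only [e1] using this
  var_close := hvar.2.2
  var_pos := hvar.1
  tendsto_ε := hvar.2.1
  C_nonneg := by positivity
  Y_nonneg n ω := by positivity
  Y_integrable n := by
    obtain ⟨⟨hp, hz⟩, -⟩ := h.memLp n
    exact (hp.integrable_norm_pow two_ne_zero).fun_add (hz.integrable_norm_pow two_ne_zero)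
  sq_le n := by
    filter_upwards [hMb n] with ω hω
    have h1 := abs_real_inner_le_norm u (M n ω)
    rw [hu, one_mul] at h1
    rw [← sq_abs]
    exact sq_le_of_le (abs_nonneg _) (h1.trans hω)
  tendsto_Y := by
    have hlim : Tendsto (fun n => K * pstep α n + K * pstep β n) atTop (𝓝 0) := by
      simpa using ((tendsto_pstep hα).const_mul K).add ((tendsto_pstep hβ).const_mul K)
    refine squeeze_zero (fun n => integral_nonneg fun ω => by positivity) (fun n => ?_) hlim
    obtain ⟨⟨hp, hz⟩, -⟩ := h.memLp n
    rw [integral_add (hp.integrable_norm_pow two_ne_zero) (hz.integrable_norm_pow two_ne_zero)]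
    exact add_le_add (hK n).1 (hK n).2

lemma first_moments [IsFiniteMeasure μ] (hμ : μ.real Set.univ ≤ 1)
    (h : IsCoupledSystem μ ℱ α β C X W p z e f N N') {K : ℝ}
    (hK : ∀ n, ∫ ω, ‖p n ω‖ ^ 2 ∂μ ≤ K * pstep α n ∧ ∫ ω, ‖z n ω‖ ^ 2 ∂μ ≤ K * pstep β n) (n : ℕ) :
    ∫ ω, ‖p n ω‖ ∂μ ≤ (1 + K) * pstep (α / 2) n ∧ ∫ ω, ‖z n ω‖ ∂μ ≤ (1 + K) * pstep (β / 2) n := by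
  obtain ⟨⟨hp, hz⟩, -⟩ := h.memLp n
  refine ⟨integral_norm_le_of_integral_sq_le hμ hp (pstep_pos _ _) ?_,
    integral_norm_le_of_integral_sq_le hμ hz (pstep_pos _ _) ?_⟩
  · rw [pstep_half_sq]; exact (hK n).1
  · rw [pstep_half_sq]; exact (hK n).2

/-- First moment of a quantity dominated by `(αₙ/βₙ) (‖pₙ‖ + ‖zₙ‖)`. -/
lemma integral_norm_coupling_le [IsFiniteMeasure μ] (hμ : μ.real Set.univ ≤ 1)
    (h : IsCoupledSystem μ ℱ α β C X W p z e f N N') (hαβ : β < α) {K : ℝ} (hK0 : 0 < K)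
    (hK : ∀ n, ∫ ω, ‖p n ω‖ ^ 2 ∂μ ≤ K * pstep α n ∧ ∫ ω, ‖z n ω‖ ^ 2 ∂μ ≤ K * pstep β n) {n : ℕ}
    {c : ℝ} (hc : 0 ≤ c) {g : Ω → E}
    (hg : ∀ ω, ‖g ω‖ ≤ c * (pstep (α - β) n * (‖p n ω‖ + ‖z n ω‖))) :
    ∫ ω, ‖g ω‖ ∂μ ≤ 2 * c * (1 + K) * pstep (α - β / 2) n := by
  obtain ⟨⟨hp, hz⟩, -⟩ := h.memLp n
  have ip := (hp.integrable one_le_two).norm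
  have iz := (hz.integrable one_le_two).norm
  obtain ⟨h1, h2⟩ := h.first_moments hμ hK n
  refine (integral_mono_of_nonneg (ae_of_all _ fun ω => norm_nonneg _)
    (((ip.fun_add iz).const_mul _).const_mul _) (ae_of_all _ hg)).trans ?_
  rw [integral_const_mul, integral_const_mul, integral_add ip iz]
  have h3 : pstep (α / 2) n ≤ pstep (β / 2) n := pstep_anti_exponent (by linarith) n
  have hr := pstep_pos (α - β) n
  calc _ ≤ c * (pstep (α - β) n * ((1 + K) * pstep (β / 2) n + (1 + K) * pstep (β / 2) n)) := by
        gcongr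
        exact h1.trans (by gcongr)
    _ = 2 * c * (1 + K) * (pstep (α - β) n * pstep (β / 2) n) := by ring
    _ = _ := by rw [← pstep_add]; ring_nf

/-- Anti-concentration of both components of a coupled system along the direction `u`. -/
theorem anticoncentration [IsFiniteMeasure μ] (hμ : μ.real Set.univ ≤ 1)
    (h : IsCoupledSystem μ ℱ α β C X W p z e f N N') (hα : α < 1) (hαβ : β < α) (hβ : 0 < β)
    {K : ℝ} (hK0 : 0 < K)
    (hK : ∀ n, ∫ ω, ‖p n ω‖ ^ 2 ∂μ ≤ K * pstep α n ∧ ∫ ω, ‖z n ω‖ ^ 2 ∂μ ≤ K * pstep β n)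
    {u : E} (hu : ‖u‖ = 1) {σ2 σ2' : ℝ} {ε ε' : ℕ → ℝ}
    (hvar : HasAsymptoticVariance μ ℱ u N σ2 ε) (hvar' : HasAsymptoticVariance μ ℱ u N' σ2' ε') :
    (∀ τ : ℝ, 0 < τ → ∃ c, 0 < c ∧ ∀ᶠ n : ℕ in atTop,
      μ.real {ω | |inner ℝ u (p n ω)| < c * (n : ℝ) ^ (-(α / 2))} ≤ τ) ∧
    (∀ τ : ℝ, 0 < τ → ∃ c, 0 < c ∧ ∀ᶠ n : ℕ in atTop,
      μ.real {ω | |inner ℝ u (z n ω)| < c * (n : ℝ) ^ (-(β / 2))} ≤ τ) := by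
  have hC := h.C_nonneg
  -- The coupling has first moment of order `(αₙ/βₙ) βₙ^(1/2)`, exponent `α - β/2`. For `γ = α` and
  -- `γ = β` alike this is at least `γ/2`, because `β < α`; the drift thus has the size that the
  -- scalar theorem allows.
  have drift : ∀ (γ : ℝ) (_ : γ / 2 ≤ α - β / 2) (T : E →L[ℝ] E) (n : ℕ) (q g : Ω → E),
      MemLp q 2 μ → MemLp g 2 μ → ∫ ω, ‖q ω‖ ∂μ ≤ (1 + K) * pstep (γ / 2) n →
      (∀ ω, ‖g ω‖ ≤ C * (pstep (α - β) n * (‖p n ω‖ + ‖z n ω‖))) →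
      Integrable (fun ω => inner ℝ u (-T (q ω) + g ω)) μ ∧
      ∫ ω, |inner ℝ u (-T (q ω) + g ω)| ∂μ ≤
        (‖T‖ * (1 + K) + 2 * C * (1 + K)) * pstep (γ / 2) n := by
    intro γ hγ T n q g hq hg hqK hgb
    have hTq : MemLp (fun ω => T (q ω)) 2 μ := T.comp_memLp' hq
    have hL : MemLp (fun ω => -T (q ω) + g ω) 2 μ := hTq.neg.add hg
    have hi : Integrable (fun ω => inner ℝ u (-T (q ω) + g ω)) μ :=
      (hL.const_inner u).integrable one_le_two
    refine ⟨hi, ?_⟩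
    have iq := (hq.integrable one_le_two).norm
    have ig := (hg.integrable one_le_two).norm
    have hpt : ∀ ω, |inner ℝ u (-T (q ω) + g ω)| ≤ ‖T‖ * ‖q ω‖ + ‖g ω‖ := by
      intro ω
      have h1 := abs_real_inner_le_norm u (-T (q ω) + g ω)
      rw [hu, one_mul] at h1
      refine h1.trans ((norm_add_le _ _).trans ?_)
      rw [norm_neg]
      gcongr
      exact T.le_opNorm _
    refine (integral_mono hi.abs ((iq.const_mul _).fun_add ig) hpt).trans ?_
    rw [integral_add (iq.const_mul _) ig, integral_const_mul]
    have h1 := h.integral_norm_coupling_le hμ hαβ hK0 hK hC hgb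
    have h2 : pstep (α - β / 2) n ≤ pstep (γ / 2) n := pstep_anti_exponent hγ n
    calc _ ≤ ‖T‖ * ((1 + K) * pstep (γ / 2) n) + 2 * C * (1 + K) * pstep (γ / 2) n := by
          gcongr
          exact h1.trans (by gcongr)
      _ = _ := by ring
  constructor
  · intro τ hτ
    have hn := h.isAsymptoticNoise (hβ.trans hαβ) hβ hK hu h.N_meas (fun n => (h.memLp n).2.2.1)
      h.condExp_N h.N_le hvar
    have hd := fun n => drift α (by linarith) X n (p n) (e n) (h.memLp n).1.1 (h.memLp n).2.1.1
      (h.first_moments hμ hK n).1 (h.e_le n)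
    refine hn.anticoncentration hμ (hβ.trans hαβ) hα
      (Q := fun n ω => inner ℝ u (p n ω)) (D := fun n ω => inner ℝ u (-X (p n ω) + e n ω))
      (fun n => (stronglyMeasurable_const.inner (h.p_meas n)).measurable) (fun n => (hd n).1)
      (fun n => (hd n).2) (fun n ω => ?_) hτ
    rw [h.p_succ, inner_add_right, inner_smul_right, inner_add_right]
  · intro τ hτ
    have hn := h.isAsymptoticNoise (hβ.trans hαβ) hβ hK hu h.N'_meas (fun n => (h.memLp n).2.2.2)
      h.condExp_N' h.N'_le hvar'
    have hd := fun n => drift β (by linarith) W n (z n) (f n) (h.memLp n).1.2 (h.memLp n).2.1.2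
      (h.first_moments hμ hK n).2 (h.f_le n)
    refine hn.anticoncentration hμ hβ (hαβ.trans hα)
      (Q := fun n ω => inner ℝ u (z n ω)) (D := fun n ω => inner ℝ u (-W (z n ω) + f n ω))
      (fun n => (stronglyMeasurable_const.inner (h.z_meas n)).measurable) (fun n => (hd n).1)
      (fun n => (hd n).2) (fun n ω => ?_) hτ
    rw [h.z_succ, inner_add_right, inner_smul_right, inner_add_right]

end IsCoupledSystem

/-! ### Limiting variances from the limiting conditional covariance. -/

/-- A generalized Vitali/Scheffé lemma for conditional expectations: almost sure convergence plus
domination by `C (1 + Yₙ)`, `Yₙ → 0` in `L¹`, gives convergence in `L¹`. -/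
lemma tendsto_integral_abs_condExp_sub {Ω : Type*} {m0 : MeasurableSpace Ω} {μ : Measure Ω}
    [IsFiniteMeasure μ] {ℱ : ℕ → MeasurableSpace Ω} (hle : ∀ n, ℱ n ≤ m0) {H Y : ℕ → Ω → ℝ}
    {C g : ℝ} (hC : 0 ≤ C) (hHi : ∀ n, Integrable (H n) μ)
    (hH : ∀ n, ∀ᵐ ω ∂μ, |H n ω| ≤ C * (1 + Y n ω)) (hYm : ∀ n, StronglyMeasurable[ℱ n] (Y n))
    (hYi : ∀ n, Integrable (Y n) μ) (hY0 : ∀ n ω, 0 ≤ Y n ω)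
    (hY : Tendsto (fun n => ∫ ω, Y n ω ∂μ) atTop (𝓝 0))
    (hlim : ∀ᵐ ω ∂μ, Tendsto (fun n => (μ[H n | ℱ n]) ω) atTop (𝓝 g)) :
    Tendsto (fun n => ∫ ω, |(μ[H n | ℱ n]) ω - g| ∂μ) atTop (𝓝 0) := by
  have hB : ∀ n, Integrable (fun ω => C * (1 + Y n ω)) μ := fun n =>
    ((integrable_const 1).fun_add (hYi n)).const_mul C
  have hBm : ∀ n, StronglyMeasurable[ℱ n] (fun ω => C * (1 + Y n ω)) := fun n =>
    (stronglyMeasurable_const.add (hYm n)).const_mul C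
  -- The dominating function is `ℱ n`-measurable, so it survives conditioning unchanged.
  have hV : ∀ n, ∀ᵐ ω ∂μ, |(μ[H n | ℱ n]) ω| ≤ C * (1 + Y n ω) := by
    intro n
    have h1 := condExp_mono (m := ℱ n) (hHi n) (hB n)
      ((hH n).mono fun ω hω => (le_abs_self _).trans hω)
    have h2 := condExp_mono (m := ℱ n) (hB n).neg (hHi n)
      ((hH n).mono fun ω hω => (abs_le.1 hω).1)
    rw [condExp_of_stronglyMeasurable (hle n) (hBm n) (hB n)] at h1
    rw [condExp_of_stronglyMeasurable (hle n) (hBm n).neg (hB n).neg] at h2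
    filter_upwards [h1, h2] with ω a b
    exact abs_le.2 ⟨b, a⟩
  -- Truncating at `C + |g|` makes dominated convergence applicable, and the part cut off is at most
  -- `C Y`, which vanishes in `L¹`.
  set D : ℕ → Ω → ℝ := fun n ω => min |(μ[H n | ℱ n]) ω - g| (C + |g|) with hD
  have hVm : ∀ n, AEStronglyMeasurable (μ[H n | ℱ n]) μ := fun n =>
    integrable_condExp.aestronglyMeasurable
  have hDm : ∀ n, AEStronglyMeasurable (D n) μ := fun n => by
    have h1 : AEMeasurable (fun ω => |(μ[H n | ℱ n]) ω - g|) μ :=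
      ((hVm n).aemeasurable.sub_const g).abs
    exact (h1.min aemeasurable_const).aestronglyMeasurable
  have hDb : ∀ n ω, ‖D n ω‖ ≤ C + |g| := by
    intro n ω
    have : 0 ≤ C + |g| := by positivity
    rw [Real.norm_eq_abs, abs_of_nonneg (le_min (abs_nonneg _) this)]
    exact min_le_right _ _
  have hDlim : Tendsto (fun n => ∫ ω, D n ω ∂μ) atTop (𝓝 0) := by
    rw [← integral_zero Ω ℝ (μ := μ)]
    refine tendsto_integral_of_dominated_convergence (fun _ => C + |g|) hDm (integrable_const _)
      (fun n => ae_of_all _ (hDb n)) ?_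
    filter_upwards [hlim] with ω hω
    have h1 : Tendsto (fun n => |(μ[H n | ℱ n]) ω - g|) atTop (𝓝 0) := by
      simpa using (hω.sub_const g).abs
    refine squeeze_zero (fun n => le_min (abs_nonneg _) (by positivity)) (fun n => min_le_left _ _)
      h1
  have hsum : Tendsto (fun n => (∫ ω, D n ω ∂μ) + C * ∫ ω, Y n ω ∂μ) atTop (𝓝 0) := by
    simpa using hDlim.add (hY.const_mul C)
  refine squeeze_zero (fun n => integral_nonneg fun ω => abs_nonneg _) (fun n => ?_) hsum
  have iD : Integrable (D n) μ := Integrable.of_bound (hDm n) (C + |g|) (ae_of_all _ (hDb n))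
  rw [← integral_const_mul, ← integral_add iD ((hYi n).const_mul C)]
  refine integral_mono_ae ((integrable_condExp.sub (integrable_const g)).abs)
    (iD.fun_add ((hYi n).const_mul C)) ?_
  filter_upwards [hV n] with ω hω
  have h0 := mul_nonneg hC (hY0 n ω)
  simp only [hD]
  rcases le_total |(μ[H n | ℱ n]) ω - g| (C + |g|) with h | h
  · rw [min_eq_left h]; linarith
  · rw [min_eq_right h]
    have := abs_sub ((μ[H n | ℱ n]) ω) g
    linarith

/-- Linear combinations, with converging coefficients, of a noise vector whose conditional second
moments converge in `L¹` have an asymptotic conditional variance. -/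
lemma hasAsymptoticVariance_of_cov {Ω E ι : Type*} [Fintype ι] [DecidableEq ι]
    {m0 : MeasurableSpace Ω} [NormedAddCommGroup E] [InnerProductSpace ℝ E] {μ : Measure Ω}
    [IsFiniteMeasure μ] (hμ : μ.real Set.univ ≤ 1) {ℱ : ℕ → MeasurableSpace Ω}
    (hle : ∀ n, ℱ n ≤ m0) {η : ℕ → Ω → ι → ℝ} {Γ : Matrix ι ι ℝ} (hΓ : Γ.PosDef)
    (hηi : ∀ n i j, Integrable (fun ω => η n ω i * η n ω j) μ)
    (hcov : ∀ i j, Tendsto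
      (fun n => ∫ ω, |(μ[fun ω' => η n ω' i * η n ω' j | ℱ n]) ω - Γ i j| ∂μ) atTop (𝓝 0))
    {u : E} {N : ℕ → Ω → E} {a : ℕ → ι → ℝ} {a' : ι → ℝ} (ha' : a' ≠ 0)
    (ha : ∀ i, Tendsto (fun n => a n i) atTop (𝓝 (a' i)))
    (hN : ∀ n ω, inner ℝ u (N n ω) = ∑ i, a n i * η n ω i) :
    ∃ σ2 ε, HasAsymptoticVariance μ ℱ u N σ2 ε := by
  set δ : ℕ → ι → ι → ℝ := fun n i j =>
    ∫ ω, |(μ[fun ω' => η n ω' i * η n ω' j | ℱ n]) ω - Γ i j| ∂μ with hδ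
  set σ2 : ℝ := ∑ i, ∑ j, a' i * a' j * Γ i j with hσ
  -- The first part comes from the convergence of the conditional covariance, the second from that
  -- of the coefficients.
  set ε : ℕ → ℝ := fun n => (∑ i, ∑ j, |a n i * a n j| * δ n i j) +
    |(∑ i, ∑ j, a n i * a n j * Γ i j) - σ2| with hε
  refine ⟨σ2, ε, ?_, ?_, fun n G hG hG1 => ?_⟩
  · have h1 := hΓ.dotProduct_mulVec_pos ha'
    have e : σ2 = dotProduct (star a') (Γ.mulVec a') := by
      simp only [hσ, dotProduct, Matrix.mulVec, Finset.mul_sum, star_trivial]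
      refine Finset.sum_congr rfl fun i _ => Finset.sum_congr rfl fun j _ => ?_
      ring
    rw [e]
    exact h1
  · have h1 : Tendsto (fun n => ∑ i, ∑ j, |a n i * a n j| * δ n i j) atTop
        (𝓝 (∑ i, ∑ j, |a' i * a' j| * 0)) :=
      tendsto_finsetSum _ fun i _ => tendsto_finsetSum _ fun j _ =>
        (((ha i).mul (ha j)).abs).mul (hcov i j)
    have h2 : Tendsto (fun n => ∑ i, ∑ j, a n i * a n j * Γ i j) atTop (𝓝 σ2) :=
      tendsto_finsetSum _ fun i _ => tendsto_finsetSum _ fun j _ =>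
        ((ha i).mul (ha j)).mul_const _
    have h3 := h1.add ((h2.sub_const σ2).abs)
    simp only [mul_zero, Finset.sum_const_zero, sub_self, abs_zero, add_zero] at h3
    exact h3
  · have hGm : AEStronglyMeasurable G μ := (hG.mono (hle n)).aestronglyMeasurable
    have hGi : Integrable G μ := Integrable.of_bound hGm 1 (ae_of_all _ hG1)
    have key : ∀ i j, Integrable (fun ω => ((η n ω i * η n ω j - Γ i j : ℝ) : ℂ) * G ω) μ ∧
        ‖∫ ω, ((η n ω i * η n ω j - Γ i j : ℝ) : ℂ) * G ω ∂μ‖ ≤ δ n i j := by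
      intro i j
      have i0 : Integrable (fun ω => η n ω i * η n ω j - Γ i j) μ :=
        (hηi n i j).sub (integrable_const _)
      have i1 : Integrable (fun ω => ((η n ω i * η n ω j - Γ i j : ℝ) : ℂ) * G ω) μ :=
        i0.ofReal.mul_bdd (c := 1) hGm (ae_of_all _ hG1)
      refine ⟨i1, ?_⟩
      have hpull := condExp_bilin_of_stronglyMeasurable_left (m := ℱ n) (μ := μ)
        (ContinuousLinearMap.lsmul ℝ ℝ (E := ℂ)).flip hG (g := fun ω => η n ω i * η n ω j - Γ i j)
        (by simpa using i1) i0
      have hsub : μ[fun ω => η n ω i * η n ω j - Γ i j | ℱ n] =ᵐ[μ]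
          fun ω => (μ[fun ω' => η n ω' i * η n ω' j | ℱ n]) ω - Γ i j := by
        have h1 := condExp_sub (hηi n i j) (integrable_const (Γ i j)) (ℱ n)
        rw [condExp_const (hle n)] at h1
        exact h1
      have e1 : ∫ ω, ((η n ω i * η n ω j - Γ i j : ℝ) : ℂ) * G ω ∂μ =
          ∫ ω, (((μ[fun ω' => η n ω' i * η n ω' j | ℱ n]) ω - Γ i j : ℝ) : ℂ) * G ω ∂μ := by
        calc _ = ∫ ω, ((ContinuousLinearMap.lsmul ℝ ℝ (E := ℂ)).flip (G ω))
                (η n ω i * η n ω j - Γ i j) ∂μ := by simp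
          _ = _ := by
            rw [← integral_condExp (hle n)]
            refine integral_congr_ae ?_
            filter_upwards [hpull, hsub] with ω h1 h2
            rw [h1, h2]
            simp
      rw [e1]
      refine norm_integral_le_of_norm_le
        ((integrable_condExp.sub (integrable_const (Γ i j))).abs) (ae_of_all _ fun ω => ?_)
      rw [norm_mul, Complex.norm_real]
      exact mul_le_of_le_one_right (norm_nonneg _) (hG1 ω)
    have hdec : ∀ ω, ((inner ℝ u (N n ω) ^ 2 - σ2 : ℝ) : ℂ) * G ω =
        (∑ i, ∑ j, ((a n i * a n j : ℝ) : ℂ) * (((η n ω i * η n ω j - Γ i j : ℝ) : ℂ) * G ω)) +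
        (((∑ i, ∑ j, a n i * a n j * Γ i j) - σ2 : ℝ) : ℂ) * G ω := by
      intro ω
      have h1 : inner ℝ u (N n ω) ^ 2 =
          (∑ i, ∑ j, a n i * a n j * (η n ω i * η n ω j - Γ i j)) +
          ∑ i, ∑ j, a n i * a n j * Γ i j := by
        rw [hN, pow_two, Finset.sum_mul_sum, ← Finset.sum_add_distrib]
        refine Finset.sum_congr rfl fun i _ => ?_
        rw [← Finset.sum_add_distrib]
        refine Finset.sum_congr rfl fun j _ => ?_
        ring
      rw [h1, add_sub_assoc]
      push_cast
      rw [add_mul, Finset.sum_mul]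
      congr 1
      refine Finset.sum_congr rfl fun i _ => ?_
      rw [Finset.sum_mul]
      refine Finset.sum_congr rfl fun j _ => ?_
      ring
    have is : Integrable (fun ω => ∑ i, ∑ j, ((a n i * a n j : ℝ) : ℂ) *
        (((η n ω i * η n ω j - Γ i j : ℝ) : ℂ) * G ω)) μ :=
      integrable_finsetSum _ fun i _ => integrable_finsetSum _ fun j _ => (key i j).1.const_mul _
    simp_rw [hdec]
    rw [integral_add is (hGi.const_mul _), integral_const_mul,
      integral_finsetSum _ fun i _ => integrable_finsetSum _ fun j _ => (key i j).1.const_mul _]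
    refine (norm_add_le _ _).trans (add_le_add ?_ ?_)
    · refine (norm_sum_le _ _).trans (Finset.sum_le_sum fun i _ => ?_)
      rw [integral_finsetSum _ fun j _ => (key i j).1.const_mul _]
      refine (norm_sum_le _ _).trans (Finset.sum_le_sum fun j _ => ?_)
      rw [integral_const_mul, norm_mul, Complex.norm_real, Real.norm_eq_abs]
      exact mul_le_mul_of_nonneg_left (key i j).2 (abs_nonneg _)
    · rw [norm_mul, Complex.norm_real, Real.norm_eq_abs]
      refine mul_le_of_le_one_right (abs_nonneg _) ?_
      refine (norm_integral_le_of_norm_le_const (C := 1) (ae_of_all _ hG1)).trans ?_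
      linarith

/-! ### Decoupling the linear recursion. -/

/-- The operators of a linear two-timescale problem together with the inverse `V` of `W₂`. -/
structure TwoTimescaleOps (E : Type*) [NormedAddCommGroup E] [InnerProductSpace ℝ E] where
  Γ₁ : E →L[ℝ] E
  Γ₂ : E →L[ℝ] E
  W₁ : E →L[ℝ] E
  W₂ : E →L[ℝ] E
  V : E →L[ℝ] E
  W₂_V : ∀ x, W₂ (V x) = x
  V_W₂ : ∀ x, V (W₂ x) = x

namespace TwoTimescaleOps

variable {E : Type*} [NormedAddCommGroup E] [InnerProductSpace ℝ E]

/-- `G = W₂⁻¹ Γ₂`. -/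
def G (S : TwoTimescaleOps E) : E →L[ℝ] E := S.V ∘L S.Γ₂

/-- `B = W₁ W₂⁻¹`. -/
def B (S : TwoTimescaleOps E) : E →L[ℝ] E := S.W₁ ∘L S.V

/-- `X = Γ₁ - W₁ W₂⁻¹ Γ₂`. -/
def X (S : TwoTimescaleOps E) : E →L[ℝ] E := S.Γ₁ - S.B ∘L S.Γ₂

variable (S : TwoTimescaleOps E) (α β : ℝ) {Ω : Type*} (x y M M' : ℕ → Ω → E)

/-- The fast error. -/
def fast (n : ℕ) (ω : Ω) : E := y n ω + S.G (x n ω)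

/-- The slow error, corrected by the fast one. -/
def slow (n : ℕ) (ω : Ω) : E := x n ω - pstep (α - β) n • S.B (S.fast x y n ω)

/-- The drift of the slow iterate. -/
def slowDrift (n : ℕ) (ω : Ω) : E := S.X (x n ω) + S.W₁ (S.fast x y n ω)

/-- `rₙ₊₁ / rₙ` for `rₙ = αₙ / βₙ`. -/
def ratio (α β : ℝ) (n : ℕ) : ℝ := pstep (α - β) (n + 1) / pstep (α - β) n

/-- Coupling term in the recursion of the slow error. -/
def slowCoupling (n : ℕ) (ω : Ω) : E :=
  -(pstep (α - β) n • S.X (S.B (S.fast x y n ω))) +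
    (pstep (α - β) n * (1 - ratio α β n) / pstep α n) • S.B (S.fast x y n ω) -
    (1 - ratio α β n) • S.W₁ (S.fast x y n ω) +
    (ratio α β n * pstep (α - β) n) • S.B (S.G (S.slowDrift x y n ω))

/-- Coupling term in the recursion of the fast error. -/
def fastCoupling (n : ℕ) (ω : Ω) : E := -(pstep (α - β) n • S.G (S.slowDrift x y n ω))

/-- Noise in the recursion of the slow error. -/
def slowNoise (n : ℕ) (ω : Ω) : E :=
  (ContinuousLinearMap.id ℝ E - (ratio α β n * pstep (α - β) n) • (S.B ∘L S.G)) (M n ω) +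
    (-(ratio α β n • S.B)) (M' n ω)

/-- Noise in the recursion of the fast error. -/
def fastNoise (n : ℕ) (ω : Ω) : E :=
  (pstep (α - β) n • S.G) (M n ω) + (ContinuousLinearMap.id ℝ E) (M' n ω)

variable {α β x y M M'}

lemma pstep_mul_pstep_sub (α β : ℝ) (n : ℕ) : pstep (α - β) n * pstep β n = pstep α n := by
  rw [← pstep_add]; ring_nf

lemma ratio_mul (α β : ℝ) (n : ℕ) : ratio α β n * pstep (α - β) n = pstep (α - β) (n + 1) :=
  div_mul_cancel₀ _ (pstep_pos _ _).ne'

lemma ratio_pos (α β : ℝ) (n : ℕ) : 0 < ratio α β n := div_pos (pstep_pos _ _) (pstep_pos _ _)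

lemma ratio_le_one (hαβ : β < α) (n : ℕ) : ratio α β n ≤ 1 :=
  (div_le_one (pstep_pos _ _)).2 (pstep_anti (by linarith) (Nat.le_succ n))

/-- The time dependence of `αₙ/βₙ` costs only `1/(n+1)`, which is below both `αₙ` and `αₙ/βₙ`. -/
lemma one_sub_ratio_le (hα : α < 1) (hβ : 0 < β) (hαβ : β < α) (n : ℕ) :
    1 - ratio α β n ≤ pstep 1 n := by
  have h1 : 1 - (α - β) * pstep 1 n ≤ ratio α β n := by
    rw [ratio, le_div_iff₀ (pstep_pos _ _), mul_comm]
    exact pstep_succ_ge (by linarith) n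
  have := pstep_pos 1 n
  nlinarith

lemma tendsto_ratio (hα : α < 1) (hβ : 0 < β) (hαβ : β < α) : Tendsto (ratio α β) atTop (𝓝 1) := by
  have h1 : Tendsto (fun n => 1 - pstep 1 n) atTop (𝓝 1) := by
    simpa using (tendsto_pstep one_pos).const_sub 1
  exact tendsto_of_tendsto_of_tendsto_of_le_of_le h1 tendsto_const_nhds
    (fun n => by linarith [one_sub_ratio_le hα hβ hαβ n]) (fun n => ratio_le_one hαβ n)

lemma drift_slow (n : ℕ) (ω : Ω) :
    -S.Γ₁ (x n ω) - S.W₁ (y n ω) = -S.slowDrift x y n ω := by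
  simp only [slowDrift, X, fast, G, B, sub_apply,
    ContinuousLinearMap.comp_apply, map_add]
  abel

/-- For frozen `x` the fast equation has equilibrium `-W₂⁻¹ Γ₂ x`; `fast` is the distance to it, and
the fast drift sees nothing else. -/
lemma drift_fast (n : ℕ) (ω : Ω) :
    -S.Γ₂ (x n ω) - S.W₂ (y n ω) = -S.W₂ (S.fast x y n ω) := by
  simp only [fast, G, ContinuousLinearMap.comp_apply, map_add, S.W₂_V]
  abel

/-- The equilibrium moves with `x` at speed `αₙ = (αₙ/βₙ) βₙ`; seen on the scale `βₙ`, this gives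
the factor `αₙ/βₙ` in the coupling. -/
lemma fast_succ
    (hx : ∀ n ω, x (n + 1) ω = x n ω + pstep α n • (-S.Γ₁ (x n ω) - S.W₁ (y n ω) + M n ω))
    (hy : ∀ n ω, y (n + 1) ω = y n ω + pstep β n • (-S.Γ₂ (x n ω) - S.W₂ (y n ω) + M' n ω))
    (n : ℕ) (ω : Ω) : S.fast x y (n + 1) ω = S.fast x y n ω +
    pstep β n • (-S.W₂ (S.fast x y n ω) + S.fastCoupling α β x y n ω +
      S.fastNoise α β M M' n ω) := by
  rw [fast, hx, hy, drift_slow, drift_fast, ← pstep_mul_pstep_sub α β]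
  simp only [fastCoupling, fastNoise, map_add, map_smul, map_neg, smul_apply,
    ContinuousLinearMap.id_apply]
  have : S.fast x y n ω = y n ω + S.G (x n ω) := rfl
  generalize S.W₂ (S.fast x y n ω) = a
  rw [this]
  module

/-- Because `B W₂ = W₁` and `(αₙ/βₙ) βₙ = αₙ`, the increment of `(αₙ/βₙ) B z` contains `-αₙ W₁ z` up
to the factor `ratio`, which cancels the fast error in the drift of `x`. What is left over is
collected in `slowCoupling`. -/
lemma slow_succ
    (hx : ∀ n ω, x (n + 1) ω = x n ω + pstep α n • (-S.Γ₁ (x n ω) - S.W₁ (y n ω) + M n ω))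
    (hy : ∀ n ω, y (n + 1) ω = y n ω + pstep β n • (-S.Γ₂ (x n ω) - S.W₂ (y n ω) + M' n ω))
    (n : ℕ) (ω : Ω) : S.slow α β x y (n + 1) ω = S.slow α β x y n ω +
    pstep α n • (-S.X (S.slow α β x y n ω) + S.slowCoupling α β x y n ω +
      S.slowNoise α β M M' n ω) := by
  have hBW : ∀ v, S.B (S.W₂ v) = S.W₁ v := fun v => by simp [B, S.V_W₂]
  have hk : pstep α n * (pstep (α - β) n * (1 - ratio α β n) / pstep α n) =
    pstep (α - β) n * (1 - ratio α β n) := mul_div_cancel₀ _ (pstep_pos _ _).ne'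
  rw [slow, S.fast_succ hx hy, hx, drift_slow, ← ratio_mul]
  have hz : S.slow α β x y n ω = x n ω - pstep (α - β) n • S.B (S.fast x y n ω) := rfl
  simp only [hz, slowCoupling, slowNoise, fastCoupling, fastNoise, map_add, map_sub, map_smul, map_neg,
    smul_apply, ContinuousLinearMap.id_apply, sub_apply,
    neg_apply, ContinuousLinearMap.comp_apply, hBW]
  have hd : S.slowDrift x y n ω = S.X (x n ω) + S.W₁ (S.fast x y n ω) := rfl
  generalize S.B (S.G (S.slowDrift x y n ω)) = b
  rw [hd]
  generalize pstep (α - β) n * (1 - ratio α β n) / pstep α n = k at *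
  rw [← pstep_mul_pstep_sub α β] at hk ⊢
  linear_combination (norm := module) -(hk • S.B (S.fast x y n ω))

end TwoTimescaleOps

namespace TwoTimescaleOps

section General

variable {E : Type*} [NormedAddCommGroup E] [InnerProductSpace ℝ E] (S : TwoTimescaleOps E)
  {α β : ℝ} {Ω : Type*} {x y M M' : ℕ → Ω → E}

lemma norm_x_le (n : ℕ) (ω : Ω) :
    ‖x n ω‖ ≤ ‖S.slow α β x y n ω‖ + pstep (α - β) n * (‖S.B‖ * ‖S.fast x y n ω‖) := by
  have h1 : x n ω = S.slow α β x y n ω + pstep (α - β) n • S.B (S.fast x y n ω) := by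
    rw [slow]; abel
  have hr := pstep_pos (α - β) n
  calc ‖x n ω‖ = ‖S.slow α β x y n ω + pstep (α - β) n • S.B (S.fast x y n ω)‖ := by rw [← h1]
    _ ≤ _ := norm_add_le _ _
    _ ≤ _ := by
      rw [norm_smul, Real.norm_eq_abs, abs_of_pos hr]
      gcongr
      exact S.B.le_opNorm _

lemma norm_x_le' (hαβ : β < α) (n : ℕ) (ω : Ω) :
    ‖x n ω‖ ≤ (1 + ‖S.B‖) * (‖S.slow α β x y n ω‖ + ‖S.fast x y n ω‖) := by
  have h1 := S.norm_x_le (α := α) (β := β) (x := x) (y := y) n ω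
  have h2 := mul_le_of_le_one_left (mul_nonneg (norm_nonneg S.B) (norm_nonneg (S.fast x y n ω)))
    (pstep_le_one (by linarith : 0 ≤ α - β) n)
  have h3 := mul_nonneg (norm_nonneg S.B) (norm_nonneg (S.slow α β x y n ω))
  have h4 := norm_nonneg (S.fast x y n ω)
  linarith

lemma one_add_norm_le (hαβ : β < α) (n : ℕ) (ω : Ω) :
    1 + ‖x n ω‖ + ‖y n ω‖ ≤ (2 + (1 + ‖S.G‖) * (1 + ‖S.B‖)) *
      (1 + ‖S.slow α β x y n ω‖ + ‖S.fast x y n ω‖) := by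
  have h1 := S.norm_x_le' (x := x) (y := y) hαβ n ω
  have h2 : ‖y n ω‖ ≤ ‖S.fast x y n ω‖ + ‖S.G‖ * ‖x n ω‖ := by
    have e : y n ω = S.fast x y n ω - S.G (x n ω) := by rw [fast]; abel
    calc ‖y n ω‖ = ‖S.fast x y n ω - S.G (x n ω)‖ := by rw [← e]
      _ ≤ _ := norm_sub_le _ _
      _ ≤ _ := by gcongr; exact S.G.le_opNorm _
  have h3 := mul_le_mul_of_nonneg_left h1 (by positivity : 0 ≤ 1 + ‖S.G‖)
  have h4 : 0 ≤ (1 + ‖S.G‖) * (1 + ‖S.B‖) := by positivity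
  have h5 := norm_nonneg (S.slow α β x y n ω)
  have h6 := norm_nonneg (S.fast x y n ω)
  linarith

lemma norm_slowDrift_le (hαβ : β < α) (n : ℕ) (ω : Ω) :
    ‖S.slowDrift x y n ω‖ ≤ (‖S.X‖ * (1 + ‖S.B‖) + ‖S.W₁‖) *
      (‖S.slow α β x y n ω‖ + ‖S.fast x y n ω‖) := by
  have h1 := S.norm_x_le' (x := x) (y := y) hαβ n ω
  have h5 := norm_nonneg (S.slow α β x y n ω)
  calc ‖S.slowDrift x y n ω‖ ≤ ‖S.X (x n ω)‖ + ‖S.W₁ (S.fast x y n ω)‖ := norm_add_le _ _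
    _ ≤ ‖S.X‖ * ‖x n ω‖ + ‖S.W₁‖ * ‖S.fast x y n ω‖ := by
      gcongr <;> exact ContinuousLinearMap.le_opNorm _ _
    _ ≤ ‖S.X‖ * ((1 + ‖S.B‖) * (‖S.slow α β x y n ω‖ + ‖S.fast x y n ω‖)) +
        ‖S.W₁‖ * (‖S.slow α β x y n ω‖ + ‖S.fast x y n ω‖) := by
      gcongr; linarith
    _ = _ := by ring

/-- Most terms show the factor `αₙ/βₙ`. For the two created by the variation of the ratio, `1 -
ratio ≤ 1/(n+1)` is compared with `αₙ`, undoing the division, and with `αₙ/βₙ`. -/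
lemma norm_coupling_le (hα : α < 1) (hαβ : β < α) (hβ : 0 < β) (n : ℕ) (ω : Ω) :
    ‖S.fastCoupling α β x y n ω‖ ≤ ‖S.G‖ * (‖S.X‖ * (1 + ‖S.B‖) + ‖S.W₁‖) *
      (pstep (α - β) n * (‖S.slow α β x y n ω‖ + ‖S.fast x y n ω‖)) ∧
    ‖S.slowCoupling α β x y n ω‖ ≤
      (‖S.X‖ * ‖S.B‖ + ‖S.B‖ + ‖S.W₁‖ + ‖S.B‖ * (‖S.G‖ * (‖S.X‖ * (1 + ‖S.B‖) + ‖S.W₁‖))) *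
      (pstep (α - β) n * (‖S.slow α β x y n ω‖ + ‖S.fast x y n ω‖)) := by
  have hd := S.norm_slowDrift_le (x := x) (y := y) hαβ n ω
  have hr := pstep_pos (α - β) n
  have ha := pstep_pos α n
  have hρ := ratio_pos α β n
  have hρ1 := ratio_le_one hαβ n
  have hρ2 := one_sub_ratio_le hα hβ hαβ n
  have hGd := (S.G.le_opNorm (S.slowDrift x y n ω)).trans
    (mul_le_mul_of_nonneg_left hd (norm_nonneg S.G))
  have hP : ‖S.fast x y n ω‖ ≤ ‖S.slow α β x y n ω‖ + ‖S.fast x y n ω‖ :=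
    le_add_of_nonneg_left (norm_nonneg _)
  set P := ‖S.slow α β x y n ω‖ + ‖S.fast x y n ω‖
  have hP0 : 0 ≤ P := (norm_nonneg _).trans hP
  set cd := ‖S.X‖ * (1 + ‖S.B‖) + ‖S.W₁‖
  set r := pstep (α - β) n
  constructor
  · rw [fastCoupling, norm_neg, norm_smul, Real.norm_eq_abs, abs_of_pos hr]
    calc _ ≤ r * (‖S.G‖ * (cd * P)) := by gcongr
      _ = _ := by ring
  · have hB : ‖S.B (S.fast x y n ω)‖ ≤ ‖S.B‖ * P :=
      (S.B.le_opNorm _).trans (mul_le_mul_of_nonneg_left hP (norm_nonneg _))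
    have t1 : ‖-(r • S.X (S.B (S.fast x y n ω)))‖ ≤ r * (‖S.X‖ * (‖S.B‖ * P)) := by
      rw [norm_neg, norm_smul, Real.norm_eq_abs, abs_of_pos hr]
      gcongr
      exact (S.X.le_opNorm _).trans (mul_le_mul_of_nonneg_left hB (norm_nonneg _))
    have hk : 0 ≤ r * (1 - ratio α β n) / pstep α n :=
      div_nonneg (mul_nonneg hr.le (by linarith)) ha.le
    have hk1 : r * (1 - ratio α β n) / pstep α n ≤ r := by
      rw [div_le_iff₀ ha]
      exact mul_le_mul_of_nonneg_left (hρ2.trans (pstep_anti_exponent hα.le n)) hr.le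
    have t2 : ‖(r * (1 - ratio α β n) / pstep α n) • S.B (S.fast x y n ω)‖ ≤ r * (‖S.B‖ * P) := by
      rw [norm_smul, Real.norm_eq_abs, abs_of_nonneg hk]
      gcongr
    have t3 : ‖(1 - ratio α β n) • S.W₁ (S.fast x y n ω)‖ ≤ r * (‖S.W₁‖ * P) := by
      rw [norm_smul, Real.norm_eq_abs, abs_of_nonneg (by linarith)]
      have hw := (S.W₁.le_opNorm (S.fast x y n ω)).trans
        (mul_le_mul_of_nonneg_left hP (norm_nonneg _))
      have h1 : 1 - ratio α β n ≤ r := hρ2.trans (pstep_anti_exponent (by linarith) n)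
      gcongr
    have t4 : ‖(ratio α β n * r) • S.B (S.G (S.slowDrift x y n ω))‖ ≤
        r * (‖S.B‖ * (‖S.G‖ * (cd * P))) := by
      rw [norm_smul, Real.norm_eq_abs, abs_of_pos (mul_pos hρ hr)]
      have h1 : ratio α β n * r ≤ r := mul_le_of_le_one_left hr.le hρ1
      have h2 := (S.B.le_opNorm (S.G (S.slowDrift x y n ω))).trans
        (mul_le_mul_of_nonneg_left hGd (norm_nonneg _))
      gcongr
    rw [slowCoupling]
    refine (norm_add_le _ _).trans ((add_le_add ((norm_sub_le _ _).trans (add_le_add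
      ((norm_add_le _ _).trans (add_le_add t1 t2)) t3)) t4).trans (le_of_eq ?_))
    ring

lemma norm_noise_le (hαβ : β < α) {m : ℝ} {n : ℕ} {ω : Ω}
    (h : ‖M n ω‖ ≤ m * (1 + ‖x n ω‖ + ‖y n ω‖)) (h' : ‖M' n ω‖ ≤ m * (1 + ‖x n ω‖ + ‖y n ω‖))
    (hm : 0 ≤ m) :
    ‖S.slowNoise α β M M' n ω‖ ≤
      (1 + ‖S.B‖ * ‖S.G‖ + ‖S.B‖) * (m * (2 + (1 + ‖S.G‖) * (1 + ‖S.B‖))) *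
        (1 + ‖S.slow α β x y n ω‖ + ‖S.fast x y n ω‖) ∧
    ‖S.fastNoise α β M M' n ω‖ ≤
      (‖S.G‖ + 1) * (m * (2 + (1 + ‖S.G‖) * (1 + ‖S.B‖))) *
        (1 + ‖S.slow α β x y n ω‖ + ‖S.fast x y n ω‖) := by
  have hL := mul_le_mul_of_nonneg_left (S.one_add_norm_le (x := x) (y := y) hαβ n ω) hm
  have h := h.trans hL
  have h' := h'.trans hL
  rw [← mul_assoc] at h h'
  have hr := pstep_pos (α - β) n
  have hr1 := pstep_le_one (by linarith : 0 ≤ α - β) n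
  have hρ := ratio_pos α β n
  have hρ1 := ratio_le_one hαβ n
  set Z := m * (2 + (1 + ‖S.G‖) * (1 + ‖S.B‖)) * (1 + ‖S.slow α β x y n ω‖ + ‖S.fast x y n ω‖)
  have hZ : 0 ≤ Z := (norm_nonneg _).trans h
  constructor
  · have t1 : ‖(ContinuousLinearMap.id ℝ E - (ratio α β n * pstep (α - β) n) • (S.B ∘L S.G))
        (M n ω)‖ ≤ Z + ‖S.B‖ * (‖S.G‖ * Z) := by
      rw [sub_apply, ContinuousLinearMap.id_apply, smul_apply, ContinuousLinearMap.comp_apply]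
      refine (norm_sub_le _ _).trans (add_le_add h ?_)
      rw [norm_smul, Real.norm_eq_abs, abs_of_pos (mul_pos hρ hr)]
      have h1 : ratio α β n * pstep (α - β) n ≤ 1 := mul_le_one₀ hρ1 hr.le hr1
      have h2 : ‖S.B (S.G (M n ω))‖ ≤ ‖S.B‖ * (‖S.G‖ * Z) := (S.B.le_opNorm _).trans
        (mul_le_mul_of_nonneg_left ((S.G.le_opNorm _).trans
          (mul_le_mul_of_nonneg_left h (norm_nonneg _))) (norm_nonneg _))
      exact (mul_le_of_le_one_left (norm_nonneg _) h1).trans h2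
    have t2 : ‖(-(ratio α β n • S.B)) (M' n ω)‖ ≤ ‖S.B‖ * Z := by
      rw [neg_apply, norm_neg, smul_apply, norm_smul, Real.norm_eq_abs, abs_of_pos hρ]
      refine (mul_le_of_le_one_left (norm_nonneg _) hρ1).trans ((S.B.le_opNorm _).trans ?_)
      gcongr
    refine (norm_add_le _ _).trans ((add_le_add t1 t2).trans (le_of_eq ?_))
    ring
  · have t1 : ‖(pstep (α - β) n • S.G) (M n ω)‖ ≤ ‖S.G‖ * Z := by
      rw [smul_apply, norm_smul, Real.norm_eq_abs, abs_of_pos hr]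
      refine (mul_le_of_le_one_left (norm_nonneg _) hr1).trans ((S.G.le_opNorm _).trans ?_)
      gcongr
    refine (norm_add_le _ _).trans ((add_le_add t1 h').trans (le_of_eq ?_))
    ring

lemma condExp_linear_noise_eq_zero [CompleteSpace E] {m m0 : MeasurableSpace Ω} {μ : Measure Ω}
    {g g' : Ω → E} (hg : Integrable g μ) (hg' : Integrable g' μ) (h : μ[g | m] =ᵐ[μ] 0)
    (h' : μ[g' | m] =ᵐ[μ] 0) (A A' : E →L[ℝ] E) :
    μ[fun ω => A (g ω) + A' (g' ω) | m] =ᵐ[μ] 0 := by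
  have h1 := A.comp_condExp_comm (m := m) hg
  have h2 := A'.comp_condExp_comm (m := m) hg'
  have h3 := condExp_add (A.integrable_comp hg) (A'.integrable_comp hg') m
  filter_upwards [h, h', h1, h2, h3] with ω a a' b b' c
  have c' : (μ[fun ω => A (g ω) + A' (g' ω) | m]) ω =
    (μ[A ∘ g | m]) ω + (μ[A' ∘ g' | m]) ω := c
  rw [c', ← b, ← b']
  simp [a, a']

/-- A linear two-timescale recursion, in the decoupling coordinates. -/
theorem isCoupledSystem [CompleteSpace E] {m0 : MeasurableSpace Ω} {μ : Measure Ω}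
    [IsFiniteMeasure μ] {ℱ : ℕ → MeasurableSpace Ω} (hle : ∀ n, ℱ n ≤ m0) (hmono : Monotone ℱ)
    (hα : α < 1) (hαβ : β < α) (hβ : 0 < β)
    (hxm : ∀ n, StronglyMeasurable[ℱ n] (x n)) (hym : ∀ n, StronglyMeasurable[ℱ n] (y n))
    (hMm : ∀ n, StronglyMeasurable[ℱ (n + 1)] (M n))
    (hMm' : ∀ n, StronglyMeasurable[ℱ (n + 1)] (M' n))
    (hx0 : MemLp (x 0) 2 μ) (hy0 : MemLp (y 0) 2 μ)
    (hMi : ∀ n, Integrable (M n) μ) (hMi' : ∀ n, Integrable (M' n) μ)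
    (hM0 : ∀ n, μ[M n | ℱ n] =ᵐ[μ] 0) (hM0' : ∀ n, μ[M' n | ℱ n] =ᵐ[μ] 0) {m : ℝ} (hm : 0 ≤ m)
    (hb : ∀ n, ∀ᵐ ω ∂μ, ‖M n ω‖ ≤ m * (1 + ‖x n ω‖ + ‖y n ω‖))
    (hb' : ∀ n, ∀ᵐ ω ∂μ, ‖M' n ω‖ ≤ m * (1 + ‖x n ω‖ + ‖y n ω‖))
    (hx : ∀ n ω, x (n + 1) ω = x n ω + pstep α n • (-S.Γ₁ (x n ω) - S.W₁ (y n ω) + M n ω))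
    (hy : ∀ n ω, y (n + 1) ω = y n ω + pstep β n • (-S.Γ₂ (x n ω) - S.W₂ (y n ω) + M' n ω)) :
    ∃ C, IsCoupledSystem μ ℱ α β C S.X S.W₂ (S.slow α β x y) (S.fast x y)
      (S.slowCoupling α β x y) (S.fastCoupling α β x y) (S.slowNoise α β M M')
      (S.fastNoise α β M M') := by
  set cd := ‖S.G‖ * (‖S.X‖ * (1 + ‖S.B‖) + ‖S.W₁‖) with hcd
  set ce := ‖S.X‖ * ‖S.B‖ + ‖S.B‖ + ‖S.W₁‖ + ‖S.B‖ * cd with hce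
  set L := m * (2 + (1 + ‖S.G‖) * (1 + ‖S.B‖)) with hL
  have hL0 : 0 ≤ L := by positivity
  have hcd0 : 0 ≤ cd := by positivity
  have hce0 : 0 ≤ ce := by positivity
  set cs := (1 + ‖S.B‖ * ‖S.G‖ + ‖S.B‖) * L with hcs
  set cf := (‖S.G‖ + 1) * L with hcf
  have hcs0 : 0 ≤ cs := by positivity
  have hcf0 : 0 ≤ cf := by positivity
  have hfm : ∀ n, StronglyMeasurable[ℱ n] (S.fast x y n) := fun n =>
    (hym n).add (S.G.continuous.comp_stronglyMeasurable (hxm n))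
  have hBm : ∀ n, StronglyMeasurable[ℱ n] (fun ω => S.B (S.fast x y n ω)) := fun n =>
    S.B.continuous.comp_stronglyMeasurable (hfm n)
  have hdm : ∀ n, StronglyMeasurable[ℱ n] (S.slowDrift x y n) := fun n =>
    (S.X.continuous.comp_stronglyMeasurable (hxm n)).add
      (S.W₁.continuous.comp_stronglyMeasurable (hfm n))
  have hGm : ∀ n, StronglyMeasurable[ℱ n] (fun ω => S.G (S.slowDrift x y n ω)) := fun n =>
    S.G.continuous.comp_stronglyMeasurable (hdm n)
  have hGx0 : MemLp (fun ω => S.G (x 0 ω)) 2 μ := S.G.comp_memLp' hx0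
  have hf0 : MemLp (S.fast x y 0) 2 μ := hy0.add hGx0
  have hBf0 : MemLp (fun ω => S.B (S.fast x y 0 ω)) 2 μ := S.B.comp_memLp' hf0
  refine ⟨cd + ce + cs + cf,
    { le := hle
      mono := hmono
      C_nonneg := by positivity
      memLp_p_zero := hx0.sub (hBf0.const_smul (pstep (α - β) 0))
      memLp_z_zero := hf0
      p_meas := fun n => (hxm n).sub ((hBm n).const_smul (pstep (α - β) n))
      z_meas := hfm
      e_meas := fun n => ?_
      f_meas := fun n => ((hGm n).const_smul (pstep (α - β) n)).neg
      N_meas := fun n => (ContinuousLinearMap.continuous _ |>.comp_stronglyMeasurable (hMm n)).add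
        (ContinuousLinearMap.continuous _ |>.comp_stronglyMeasurable (hMm' n))
      N'_meas := fun n => (ContinuousLinearMap.continuous _ |>.comp_stronglyMeasurable (hMm n)).add
        (ContinuousLinearMap.continuous _ |>.comp_stronglyMeasurable (hMm' n))
      e_le := fun n ω => ?_
      f_le := fun n ω => ?_
      N_le := fun n => ?_
      N'_le := fun n => ?_
      condExp_N := fun n => condExp_linear_noise_eq_zero (hMi n) (hMi' n) (hM0 n) (hM0' n) _ _
      condExp_N' := fun n => condExp_linear_noise_eq_zero (hMi n) (hMi' n) (hM0 n) (hM0' n) _ _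
      p_succ := S.slow_succ hx hy
      z_succ := S.fast_succ hx hy }⟩
  · exact (((((S.X.continuous.comp_stronglyMeasurable (hBm n)).const_smul _).neg.add
      ((hBm n).const_smul _)).sub
      ((S.W₁.continuous.comp_stronglyMeasurable (hfm n)).const_smul _))).add
      ((S.B.continuous.comp_stronglyMeasurable (hGm n)).const_smul _)
  · have hr := pstep_pos (α - β) n
    have h1 : ce ≤ cd + ce + cs + cf := by linarith
    exact (S.norm_coupling_le hα hαβ hβ n ω).2.trans
      (mul_le_mul_of_nonneg_right h1 (by positivity))
  · have hr := pstep_pos (α - β) n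
    have h1 : cd ≤ cd + ce + cs + cf := by linarith
    exact (S.norm_coupling_le hα hαβ hβ n ω).1.trans
      (mul_le_mul_of_nonneg_right h1 (by positivity))
  · filter_upwards [hb n, hb' n] with ω h1 h2
    have h3 : cs ≤ cd + ce + cs + cf := by linarith
    exact (S.norm_noise_le hαβ h1 h2 hm).1.trans (mul_le_mul_of_nonneg_right h3 (by positivity))
  · filter_upwards [hb n, hb' n] with ω h1 h2
    have h3 : cf ≤ cd + ce + cs + cf := by linarith
    exact (S.norm_noise_le hαβ h1 h2 hm).2.trans (mul_le_mul_of_nonneg_right h3 (by positivity))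

end General

end TwoTimescaleOps

/-! ### Coordinates of the noise and anti-concentration of the linear recursion. -/

lemma inner_clm_eq_sum {d : ℕ} (u : Vec d) (A : Vec d →L[ℝ] Vec d) (v : Vec d) :
    inner ℝ u (A v) = ∑ i, inner ℝ u (A (EuclideanSpace.single i 1)) * v.ofLp i := by
  have hv : v = ∑ i, v.ofLp i • EuclideanSpace.single i (1 : ℝ) := by
    have := (EuclideanSpace.basisFun (Fin d) ℝ).sum_repr v
    simpa using this.symm
  conv_lhs => rw [hv]
  rw [map_sum, inner_sum]
  refine Finset.sum_congr rfl fun i _ => ?_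
  rw [map_smul, inner_smul_right, mul_comm]

/-- Coefficients of `⟨u, A M₁ + A' M₂⟩` in the stacked noise. -/
def noiseCoeff {d : ℕ} (u : Vec d) (A A' : Vec d →L[ℝ] Vec d) : Fin d ⊕ Fin d → ℝ :=
  Sum.elim (fun i => inner ℝ u (A (EuclideanSpace.single i 1)))
    (fun i => inner ℝ u (A' (EuclideanSpace.single i 1)))

lemma inner_linear_noise {Ω : Type*} {d : ℕ} (u : Vec d) (A A' : Vec d →L[ℝ] Vec d)
    (M₁ M₂ : ℕ → Ω → Vec d) (n : ℕ) (ω : Ω) :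
    inner ℝ u (A (M₁ n ω) + A' (M₂ n ω)) =
      ∑ i, noiseCoeff u A A' i * stackedNoise M₁ M₂ n ω i := by
  rw [inner_add_right, inner_clm_eq_sum u A, inner_clm_eq_sum u A', Fintype.sum_sum_type]
  rfl

lemma tendsto_noiseCoeff {d : ℕ} (u : Vec d) {A A' : ℕ → Vec d →L[ℝ] Vec d}
    {T T' : Vec d →L[ℝ] Vec d} (hA : ∀ v, Tendsto (fun n => A n v) atTop (𝓝 (T v)))
    (hA' : ∀ v, Tendsto (fun n => A' n v) atTop (𝓝 (T' v))) (i : Fin d ⊕ Fin d) :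
    Tendsto (fun n => noiseCoeff u (A n) (A' n) i) atTop (𝓝 (noiseCoeff u T T' i)) := by
  rcases i with i | i
  · exact tendsto_const_nhds.inner (hA _)
  · exact tendsto_const_nhds.inner (hA' _)

lemma abs_stackedNoise_le {Ω : Type*} {d : ℕ} (M₁ M₂ : ℕ → Ω → Vec d) (n : ℕ) (ω : Ω)
    (i : Fin d ⊕ Fin d) : |stackedNoise M₁ M₂ n ω i| ≤ ‖M₁ n ω‖ + ‖M₂ n ω‖ := by
  rcases i with i | i
  · have := PiLp.norm_apply_le (M₁ n ω) i
    exact this.trans (le_add_of_nonneg_right (norm_nonneg _))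
  · have := PiLp.norm_apply_le (M₂ n ω) i
    exact this.trans (le_add_of_nonneg_left (norm_nonneg _))

lemma memLp_stackedNoise {Ω : Type*} {m0 : MeasurableSpace Ω} {μ : Measure Ω} {d : ℕ}
    {M₁ M₂ : ℕ → Ω → Vec d} {n : ℕ} (h₁ : MemLp (M₁ n) 2 μ) (h₂ : MemLp (M₂ n) 2 μ)
    (i : Fin d ⊕ Fin d) : MemLp (fun ω => stackedNoise M₁ M₂ n ω i) 2 μ := by
  rcases i with i | i
  · exact (EuclideanSpace.proj (𝕜 := ℝ) i).comp_memLp' h₁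
  · exact (EuclideanSpace.proj (𝕜 := ℝ) i).comp_memLp' h₂

namespace TwoTimescaleOps

/-- Anti-concentration of the errors of a linear two-timescale recursion with square integrable
initial values. -/
theorem anticoncentration {d : ℕ} (hd : 0 < d) (S : TwoTimescaleOps (Vec d)) {α β : ℝ} {Ω : Type*}
    {x y M₁ M₂ : ℕ → Ω → Vec d} {m0 : MeasurableSpace Ω} {μ : Measure Ω}
    [IsFiniteMeasure μ] (hμ : μ.real Set.univ ≤ 1) {ℱ : ℕ → MeasurableSpace Ω}
    (hle : ∀ n, ℱ n ≤ m0) (hmono : Monotone ℱ)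
    (hα : α < 1) (hαβ : β < α) (hβ : 0 < β)
    {κ : ℝ} (hκ : 0 < κ) (hX : ∀ v, κ * ‖v‖ ^ 2 ≤ inner ℝ v (S.X v))
    (hW : ∀ v, κ * ‖v‖ ^ 2 ≤ inner ℝ v (S.W₂ v))
    (hxm : ∀ n, StronglyMeasurable[ℱ n] (x n)) (hym : ∀ n, StronglyMeasurable[ℱ n] (y n))
    (hMm : ∀ n, StronglyMeasurable[ℱ (n + 1)] (M₁ (n + 1)))
    (hMm' : ∀ n, StronglyMeasurable[ℱ (n + 1)] (M₂ (n + 1)))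
    (hx0 : MemLp (x 0) 2 μ) (hy0 : MemLp (y 0) 2 μ)
    (hMi : ∀ n, MemLp (M₁ (n + 1)) 2 μ) (hMi' : ∀ n, MemLp (M₂ (n + 1)) 2 μ)
    (hM0 : ∀ n, μ[M₁ (n + 1) | ℱ n] =ᵐ[μ] 0) (hM0' : ∀ n, μ[M₂ (n + 1) | ℱ n] =ᵐ[μ] 0)
    {m : ℝ} (hm : 0 ≤ m)
    (hb : ∀ n, ∀ᵐ ω ∂μ, ‖M₁ (n + 1) ω‖ ≤ m * (1 + ‖x n ω‖ + ‖y n ω‖))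
    (hb' : ∀ n, ∀ᵐ ω ∂μ, ‖M₂ (n + 1) ω‖ ≤ m * (1 + ‖x n ω‖ + ‖y n ω‖))
    (hx : ∀ n ω, x (n + 1) ω = x n ω +
      pstep α n • (-S.Γ₁ (x n ω) - S.W₁ (y n ω) + M₁ (n + 1) ω))
    (hy : ∀ n ω, y (n + 1) ω = y n ω +
      pstep β n • (-S.Γ₂ (x n ω) - S.W₂ (y n ω) + M₂ (n + 1) ω))
    {Γ : Matrix (Fin d ⊕ Fin d) (Fin d ⊕ Fin d) ℝ} (hΓ : Γ.PosDef)
    (hcov : ∀ i j, ∀ᵐ ω ∂μ, Tendsto (fun n : ℕ =>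
      (μ[fun ω' => stackedNoise M₁ M₂ (n + 1) ω' i * stackedNoise M₁ M₂ (n + 1) ω' j | ℱ n]) ω)
      atTop (𝓝 (Γ i j))) {τ : ℝ} (hτ : 0 < τ) :
    (∃ c, 0 < c ∧ ∀ᶠ n : ℕ in atTop, μ.real {ω | ‖x n ω‖ < c * (n : ℝ) ^ (-(α / 2))} ≤ τ) ∧
    (∃ c, 0 < c ∧ ∀ᶠ n : ℕ in atTop, μ.real {ω | ‖y n ω‖ < c * (n : ℝ) ^ (-(β / 2))} ≤ τ) := by
  have hα0 : 0 < α := hβ.trans hαβ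
  obtain ⟨C, h⟩ := S.isCoupledSystem (M := fun n => M₁ (n + 1)) (M' := fun n => M₂ (n + 1))
    hle hmono hα hαβ hβ hxm hym hMm hMm' hx0 hy0
    (fun n => (hMi n).integrable one_le_two) (fun n => (hMi' n).integrable one_le_two) hM0 hM0' hm
    hb hb' hx hy
  set p := S.slow α β x y with hp
  set z := S.fast x y with hz
  obtain ⟨K, hK0, hK⟩ := h.mean_square_rates hμ hα hαβ hβ hκ hX hW
  have hY : Tendsto (fun n => ∫ ω, (‖p n ω‖ ^ 2 + ‖z n ω‖ ^ 2) ∂μ) atTop (𝓝 0) := by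
    have hlim : Tendsto (fun n => K * pstep α n + K * pstep β n) atTop (𝓝 0) := by
      simpa using ((tendsto_pstep hα0).const_mul K).add ((tendsto_pstep hβ).const_mul K)
    refine squeeze_zero (fun n => integral_nonneg fun ω => by positivity) (fun n => ?_) hlim
    obtain ⟨⟨hp2, hz2⟩, -⟩ := h.memLp n
    rw [integral_add (hp2.integrable_norm_pow two_ne_zero) (hz2.integrable_norm_pow two_ne_zero)]
    exact add_le_add (hK n).1 (hK n).2
  have hηi : ∀ n i j, Integrable
      (fun ω => stackedNoise M₁ M₂ (n + 1) ω i * stackedNoise M₁ M₂ (n + 1) ω j) μ := fun n i j =>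
    (memLp_stackedNoise (hMi n) (hMi' n) i).integrable_mul (memLp_stackedNoise (hMi n) (hMi' n) j)
  set L := 2 * (m * (2 + (1 + ‖S.G‖) * (1 + ‖S.B‖))) with hL
  have hηb : ∀ n i j, ∀ᵐ ω ∂μ,
      |stackedNoise M₁ M₂ (n + 1) ω i * stackedNoise M₁ M₂ (n + 1) ω j| ≤
        3 * L ^ 2 * (1 + (‖p n ω‖ ^ 2 + ‖z n ω‖ ^ 2)) := by
    intro n i j
    filter_upwards [hb n, hb' n] with ω h1 h2
    have h3 := mul_le_mul_of_nonneg_left (S.one_add_norm_le (x := x) (y := y) hαβ n ω) hm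
    have h4 : ‖M₁ (n + 1) ω‖ + ‖M₂ (n + 1) ω‖ ≤ L * (1 + ‖p n ω‖ + ‖z n ω‖) := by
      rw [← mul_assoc] at h3
      rw [hL]
      linarith
    refine le_trans ?_ (IsCoupledSystem.sq_le_of_le (by positivity) h4)
    rw [abs_mul, pow_two]
    exact mul_le_mul (abs_stackedNoise_le _ _ _ _ i) (abs_stackedNoise_le _ _ _ _ j)
      (abs_nonneg _) (by positivity)
  have hcov1 : ∀ i j, Tendsto (fun n => ∫ ω, |(μ[fun ω' => stackedNoise M₁ M₂ (n + 1) ω' i *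
      stackedNoise M₁ M₂ (n + 1) ω' j | ℱ n]) ω - Γ i j| ∂μ) atTop (𝓝 0) := fun i j =>
    tendsto_integral_abs_condExp_sub hle (by positivity) (fun n => hηi n i j)
      (fun n => hηb n i j)
      (fun n => ((h.p_meas n).norm.pow 2).add ((h.z_meas n).norm.pow 2))
      (fun n => ((h.memLp n).1.1.integrable_norm_pow two_ne_zero).fun_add
        ((h.memLp n).1.2.integrable_norm_pow two_ne_zero))
      (fun n ω => by positivity) hY (hcov i j)
  set i0 : Fin d := ⟨0, hd⟩
  set u : Vec d := EuclideanSpace.single i0 1 with hu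
  have hu1 : ‖u‖ = 1 := by simp [hu]
  have huu : inner ℝ u (ContinuousLinearMap.id ℝ (Vec d) (EuclideanSpace.single i0 1)) = (1 : ℝ) := by
    rw [ContinuousLinearMap.id_apply, ← hu, real_inner_self_eq_norm_sq, hu1, one_pow]
  have hr : Tendsto (pstep (α - β)) atTop (𝓝 0) := tendsto_pstep (by linarith)
  have hρ := tendsto_ratio hα hβ hαβ
  obtain ⟨σ, ε, hvar⟩ : ∃ σ ε, HasAsymptoticVariance μ ℱ u
      (S.slowNoise α β (fun n => M₁ (n + 1)) (fun n => M₂ (n + 1))) σ ε := by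
    refine hasAsymptoticVariance_of_cov hμ hle hΓ hηi hcov1
      -- In the limit the slow noise is `M₁ - B M₂` and, below, the fast noise is `M₂`. The identity
      -- block keeps the coefficients nonzero whatever `B` is.
      (a' := noiseCoeff u (ContinuousLinearMap.id ℝ _) (-S.B)) ?_ ?_
      (fun n ω => inner_linear_noise u _ _ M₁ M₂ (n + 1) ω)
    · intro h0
      have := congrFun h0 (Sum.inl i0)
      simp only [noiseCoeff, Sum.elim_inl, huu, Pi.zero_apply] at this
      exact one_ne_zero this
    · refine tendsto_noiseCoeff u (fun v => ?_) (fun v => ?_)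
      · have h1 := (hρ.mul hr).smul_const ((S.B ∘L S.G) v)
        rw [mul_zero, zero_smul] at h1
        simpa using h1.const_sub v
      · have h1 := (hρ.smul_const (S.B v)).neg
        simpa using h1
  obtain ⟨σ', ε', hvar'⟩ : ∃ σ ε, HasAsymptoticVariance μ ℱ u
      (S.fastNoise α β (fun n => M₁ (n + 1)) (fun n => M₂ (n + 1))) σ ε := by
    refine hasAsymptoticVariance_of_cov hμ hle hΓ hηi hcov1
      (a' := noiseCoeff u 0 (ContinuousLinearMap.id ℝ _)) ?_ ?_
      (fun n ω => inner_linear_noise u _ _ M₁ M₂ (n + 1) ω)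
    · intro h0
      have := congrFun h0 (Sum.inr i0)
      simp only [noiseCoeff, Sum.elim_inr, huu, Pi.zero_apply] at this
      exact one_ne_zero this
    · refine tendsto_noiseCoeff u (fun v => ?_) (fun v => tendsto_const_nhds)
      have h1 := hr.smul_const (S.G v)
      rw [zero_smul] at h1
      simpa using h1
  obtain ⟨hp1, hz1⟩ := h.anticoncentration hμ hα hαβ hβ hK0 hK hu1 hvar hvar'
  have hxp : ∀ n ω, ‖x n ω - p n ω‖ ≤
      ‖S.B‖ * (pstep (α - β) n * (‖p n ω‖ + ‖z n ω‖)) := by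
    intro n ω
    have e : x n ω - p n ω = pstep (α - β) n • S.B (z n ω) := by rw [hp, slow]; abel
    have h0 := pstep_pos (α - β) n
    rw [e, norm_smul, Real.norm_eq_abs, abs_of_pos h0]
    calc _ ≤ pstep (α - β) n * (‖S.B‖ * ‖z n ω‖) := by gcongr; exact S.B.le_opNorm _
      _ ≤ pstep (α - β) n * (‖S.B‖ * (‖p n ω‖ + ‖z n ω‖)) := by
        gcongr; exact le_add_of_nonneg_left (norm_nonneg _)
      _ = _ := by ring
  -- The exponent `α - β/2` exceeds `α/2`, so the correction is negligible at the scale of `x`.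
  have hxpI : ∀ n, ∫ ω, ‖x n ω - p n ω‖ ∂μ ≤ 2 * ‖S.B‖ * (1 + K) * pstep (α - β / 2) n := fun n =>
    h.integral_norm_coupling_le hμ hαβ hK0 hK (norm_nonneg _) (hxp n)
  have hpi : ∀ n, Integrable (p n) μ := fun n => (h.memLp n).1.1.integrable one_le_two
  have hzi : ∀ n, Integrable (z n) μ := fun n => (h.memLp n).1.2.integrable one_le_two
  have hxpi : ∀ n, Integrable (fun ω => x n ω - p n ω) μ := fun n => by
    refine (((hpi n).norm.fun_add (hzi n).norm).const_mul (pstep (α - β) n) |>.const_mul ‖S.B‖).mono'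
      ?_ (ae_of_all _ (hxp n))
    exact (((hxm n).sub (h.p_meas n)).mono (hle n)).aestronglyMeasurable
  constructor
  · exact anticoncentration_of_perturbation hu1 (by linarith) (by linarith) hxpi hxpI hp1 hτ
  · have hyz : ∀ n ω, y n ω - z n ω = -S.G (x n ω) := by
      intro n ω
      rw [hz, fast]; abel
    have hxi : ∀ n, Integrable (x n) μ := fun n => by
      have := (hxpi n).fun_add (hpi n)
      simpa using this
    -- Here `y - z = -G x` has the slow order `αₙ^(1/2)`, negligible against `βₙ^(1/2)`.
    refine anticoncentration_of_perturbation (g := α / 2)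
      (K := ‖S.G‖ * (2 * ‖S.B‖ * (1 + K) + (1 + K))) hu1 (by linarith) (by linarith)
      (fun n => ?_) (fun n => ?_) hz1 hτ
    · simp_rw [hyz]
      exact (S.G.integrable_comp (hxi n)).neg
    · have h1 : ∀ ω, ‖y n ω - z n ω‖ ≤ ‖S.G‖ * (‖x n ω - p n ω‖ + ‖p n ω‖) := by
        intro ω
        rw [hyz, norm_neg]
        refine (S.G.le_opNorm _).trans ?_
        gcongr
        have := norm_add_le (x n ω - p n ω) (p n ω)
        rwa [sub_add_cancel] at this
      have i1 := (hxpi n).norm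
      have i2 := (hpi n).norm
      refine (integral_mono_of_nonneg (ae_of_all _ fun ω => norm_nonneg _)
        ((i1.fun_add i2).const_mul _) (ae_of_all _ h1)).trans ?_
      rw [integral_const_mul, integral_add i1 i2]
      have h2 := (h.first_moments hμ hK n).1
      have h3 : pstep (α - β / 2) n ≤ pstep (α / 2) n := pstep_anti_exponent (by linarith) n
      calc _ ≤ ‖S.G‖ * (2 * ‖S.B‖ * (1 + K) * pstep (α / 2) n + (1 + K) * pstep (α / 2) n) := by
            gcongr
            exact (hxpI n).trans (by gcongr)
        _ = _ := by ring

end TwoTimescaleOps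

/-! ### From matrices to operators -/

/-- The continuous linear map of a matrix. -/
def matCLM {d : ℕ} (A : Matrix (Fin d) (Fin d) ℝ) : Vec d →L[ℝ] Vec d :=
  Matrix.toEuclideanCLM (n := Fin d) (𝕜 := ℝ) A

lemma mulV_eq {d : ℕ} (A : Matrix (Fin d) (Fin d) ℝ) (x : Vec d) : mulV A x = matCLM A x := rfl

lemma matCLM_mul {d : ℕ} (A A' : Matrix (Fin d) (Fin d) ℝ) (x : Vec d) :
    matCLM (A * A') x = matCLM A (matCLM A' x) := by
  unfold matCLM
  rw [map_mul]
  rfl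

lemma matCLM_sub {d : ℕ} (A A' : Matrix (Fin d) (Fin d) ℝ) (x : Vec d) :
    matCLM (A - A') x = matCLM A x - matCLM A' x := by
  unfold matCLM
  rw [map_sub]
  rfl

lemma matCLM_one {d : ℕ} (x : Vec d) : matCLM (1 : Matrix (Fin d) (Fin d) ℝ) x = x := by
  unfold matCLM
  rw [map_one]
  rfl

lemma inner_matCLM {d : ℕ} (A : Matrix (Fin d) (Fin d) ℝ) (x : Vec d) :
    inner ℝ x (matCLM A x) = dotProduct x.ofLp (A.mulVec x.ofLp) :=
  Matrix.inner_toEuclideanCLM A x x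

namespace IsPosDefNonsymm

variable {d : ℕ} {A : Matrix (Fin d) (Fin d) ℝ}

lemma isUnit_det (h : IsPosDefNonsymm A) : IsUnit A.det := by
  rw [← Matrix.isUnit_iff_isUnit_det, ← Matrix.mulVec_injective_iff_isUnit]
  intro x y hxy
  by_contra hne
  have h1 := h (x - y) (sub_ne_zero.2 hne)
  have h2 : A.mulVec (x - y) = 0 := by
    rw [Matrix.mulVec_sub]
    exact sub_eq_zero.2 hxy
  rw [h2, dotProduct_zero] at h1
  exact lt_irrefl _ h1

lemma matCLM_inv_right (h : IsPosDefNonsymm A) (x : Vec d) : matCLM A (matCLM A⁻¹ x) = x := by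
  rw [← matCLM_mul, Matrix.mul_nonsing_inv _ h.isUnit_det, matCLM_one]

lemma matCLM_inv_left (h : IsPosDefNonsymm A) (x : Vec d) : matCLM A⁻¹ (matCLM A x) = x := by
  rw [← matCLM_mul, Matrix.nonsing_inv_mul _ h.isUnit_det, matCLM_one]

/-- The quadratic form attains a positive minimum on the compact unit sphere, and homogeneity does
the rest. -/
lemma coercive (h : IsPosDefNonsymm A) (hd : 0 < d) :
    ∃ κ, 0 < κ ∧ ∀ x : Vec d, κ * ‖x‖ ^ 2 ≤ inner ℝ x (matCLM A x) := by
  have hne : (Metric.sphere (0 : Vec d) 1).Nonempty :=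
    ⟨EuclideanSpace.single ⟨0, hd⟩ 1, by simp⟩
  have hcont : Continuous fun x : Vec d => inner ℝ x (matCLM A x) :=
    continuous_id.inner (matCLM A).continuous
  obtain ⟨x₀, hx₀, hmin⟩ := (isCompact_sphere (0 : Vec d) 1).exists_isMinOn hne hcont.continuousOn
  have hpos : ∀ x : Vec d, x ≠ 0 → 0 < inner ℝ x (matCLM A x) := by
    intro x hx
    rw [inner_matCLM]
    refine h _ fun h0 => hx ?_
    ext i
    exact congrFun h0 i
  refine ⟨_, hpos x₀ (ne_zero_of_mem_unit_sphere ⟨x₀, hx₀⟩), fun x => ?_⟩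
  by_cases hx : x = 0
  · simp [hx]
  have hn : 0 < ‖x‖ := norm_pos_iff.2 hx
  have h1 := isMinOn_iff.1 hmin (‖x‖⁻¹ • x) (by simp [norm_smul, hn.ne'])
  rw [map_smul, inner_smul_left, inner_smul_right] at h1
  have h2 := mul_le_mul_of_nonneg_right h1 (sq_nonneg ‖x‖)
  refine h2.trans (le_of_eq ?_)
  simp only [conj_trivial]
  field_simp

end IsPosDefNonsymm

namespace LinearProblem

variable {d : ℕ} {S : LinearProblem d}

/-- The operators of a linear problem. -/
def ops (S : LinearProblem d) (hS : S.MatrixAssumption) : TwoTimescaleOps (Vec d) where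
  Γ₁ := matCLM S.Γ₁
  Γ₂ := matCLM S.Γ₂
  W₁ := matCLM S.W₁
  W₂ := matCLM S.W₂
  V := matCLM S.W₂⁻¹
  W₂_V := hS.1.matCLM_inv_right
  V_W₂ := hS.1.matCLM_inv_left

lemma ops_X_apply (hS : S.MatrixAssumption) (v : Vec d) : (S.ops hS).X v = matCLM S.X₁ v := by
  simp only [X₁, matCLM_sub, matCLM_mul]
  rfl

lemma h₁_star (hS : S.MatrixAssumption) : S.h₁ S.θstar S.wstar = 0 := by
  have h1 : matCLM S.X₁ S.θstar = S.b₁ := hS.2.matCLM_inv_right S.b₁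
  have h2 : S.h₁ S.θstar S.wstar = S.b₁ - matCLM S.X₁ S.θstar := by
    simp only [h₁, wstar, b₁, X₁, mulV_eq, matCLM_sub, matCLM_mul, map_sub]
    abel
  rw [h2, h1, sub_self]

lemma h₂_star (hS : S.MatrixAssumption) : S.h₂ S.θstar S.wstar = 0 := by
  simp only [h₂, wstar, mulV_eq, hS.1.matCLM_inv_right]
  abel

lemma h₁_eq (hS : S.MatrixAssumption) (θ w : Vec d) :
    S.h₁ θ w = -(S.ops hS).Γ₁ (θ - S.θstar) - (S.ops hS).W₁ (w - S.wstar) := by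
  have h := h₁_star hS
  rw [← sub_zero (S.h₁ θ w), ← h]
  simp only [h₁, ops, mulV_eq, map_sub]
  abel

lemma h₂_eq (hS : S.MatrixAssumption) (θ w : Vec d) :
    S.h₂ θ w = -(S.ops hS).Γ₂ (θ - S.θstar) - (S.ops hS).W₂ (w - S.wstar) := by
  have h := h₂_star hS
  rw [← sub_zero (S.h₂ θ w), ← h]
  simp only [h₂, ops, mulV_eq, map_sub]
  abel

end LinearProblem

/-! ### Measurability of the iterates -/

section Measurability

variable {Ω : Type*} {d : ℕ} {θ₀ w₀ : Ω → Vec d} {M₁ M₂ : ℕ → Ω → Vec d}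

lemma noiseSigma_mono : Monotone (noiseSigma θ₀ w₀ M₁ M₂) := by
  intro m n hmn
  refine sup_le_sup le_rfl (biSup_mono fun k hk => ?_)
  rw [Finset.mem_Icc] at hk ⊢
  omega

lemma noiseSigma_le [m0 : MeasurableSpace Ω] (hθ : Measurable θ₀) (hw : Measurable w₀)
    (h₁ : ∀ n, Measurable (M₁ (n + 1))) (h₂ : ∀ n, Measurable (M₂ (n + 1))) (n : ℕ) :
    noiseSigma θ₀ w₀ M₁ M₂ n ≤ m0 := by
  refine sup_le (sup_le hθ.comap_le hw.comap_le) (iSup₂_le fun k hk => ?_)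
  obtain ⟨j, rfl⟩ : ∃ j, k = j + 1 := ⟨k - 1, by have := (Finset.mem_Icc.1 hk).1; omega⟩
  exact sup_le (h₁ j).comap_le (h₂ j).comap_le

lemma measurable_noiseSigma_init (n : ℕ) :
    Measurable[noiseSigma θ₀ w₀ M₁ M₂ n] θ₀ ∧ Measurable[noiseSigma θ₀ w₀ M₁ M₂ n] w₀ :=
  ⟨(comap_measurable θ₀).mono (le_sup_of_le_left le_sup_left) le_rfl,
    (comap_measurable w₀).mono (le_sup_of_le_left le_sup_right) le_rfl⟩

lemma measurable_noiseSigma_noise (n : ℕ) :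
    Measurable[noiseSigma θ₀ w₀ M₁ M₂ (n + 1)] (M₁ (n + 1)) ∧
      Measurable[noiseSigma θ₀ w₀ M₁ M₂ (n + 1)] (M₂ (n + 1)) := by
  have h : MeasurableSpace.comap (M₁ (n + 1)) inferInstance ⊔
      MeasurableSpace.comap (M₂ (n + 1)) inferInstance ≤ noiseSigma θ₀ w₀ M₁ M₂ (n + 1) :=
    le_sup_of_le_right (le_iSup₂_of_le (n + 1) (Finset.mem_Icc.2 ⟨by omega, le_rfl⟩) le_rfl)
  exact ⟨(comap_measurable _).mono (le_sup_left.trans h) le_rfl,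
    (comap_measurable _).mono (le_sup_right.trans h) le_rfl⟩

lemma LinearProblem.IsIterates.measurable {S : LinearProblem d} {α β : ℝ} {θ w : ℕ → Ω → Vec d}
    (h : S.IsIterates α β θ w M₁ M₂) (n : ℕ) :
    Measurable[noiseSigma (θ 0) (w 0) M₁ M₂ n] (θ n) ∧
      Measurable[noiseSigma (θ 0) (w 0) M₁ M₂ n] (w n) := by
  induction n with
  | zero => exact measurable_noiseSigma_init 0
  | succ n ih =>
    have hm : noiseSigma (θ 0) (w 0) M₁ M₂ n ≤ noiseSigma (θ 0) (w 0) M₁ M₂ (n + 1) :=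
      noiseSigma_mono (Nat.le_succ n)
    have hθ := ih.1.mono hm le_rfl
    have hw := ih.2.mono hm le_rfl
    obtain ⟨hM₁, hM₂⟩ := measurable_noiseSigma_noise (θ₀ := θ 0) (w₀ := w 0) (M₁ := M₁) (M₂ := M₂) n
    have e1 : θ (n + 1) = fun ω => θ n ω + ((n : ℝ) + 1) ^ (-α) •
      (S.h₁ (θ n ω) (w n ω) + M₁ (n + 1) ω) := funext fun ω => (h n ω).1
    have e2 : w (n + 1) = fun ω => w n ω + ((n : ℝ) + 1) ^ (-β) •
      (S.h₂ (θ n ω) (w n ω) + M₂ (n + 1) ω) := funext fun ω => (h n ω).2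
    simp only [LinearProblem.h₁, LinearProblem.h₂, mulV_eq] at e1 e2
    rw [e1, e2]
    have hlin : ∀ (v : Vec d) (A A' : Vec d →L[ℝ] Vec d) (M : Ω → Vec d),
        Measurable[noiseSigma (θ 0) (w 0) M₁ M₂ (n + 1)] M →
        Measurable[noiseSigma (θ 0) (w 0) M₁ M₂ (n + 1)]
          fun ω => v - A (θ n ω) - A' (w n ω) + M ω := fun v A A' M hM =>
      ((measurable_const.sub (A.continuous.measurable.comp hθ)).sub
        (A'.continuous.measurable.comp hw)).add hM
    exact ⟨hθ.add ((hlin _ _ _ _ hM₁).const_smul (((n : ℝ) + 1) ^ (-α))),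
      hw.add ((hlin _ _ _ _ hM₂).const_smul (((n : ℝ) + 1) ^ (-β)))⟩

end Measurability

/-! ### The lower bounds -/

/-- Tightness of one real random variable; it allows truncating initial values that have no moments.
-/
lemma exists_measureReal_lt_le {Ω : Type*} [MeasurableSpace Ω] (P : Measure Ω)
    [IsFiniteMeasure P] {f : Ω → ℝ} (hf : Measurable f) {ε : ℝ} (hε : 0 < ε) :
    ∃ R : ℝ, P.real {ω | R < f ω} ≤ ε := by
  have h1 : Tendsto (fun k : ℕ => P {ω | (k : ℝ) < f ω}) atTop
      (𝓝 (P (⋂ k : ℕ, {ω | (k : ℝ) < f ω}))) := by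
    refine tendsto_measure_iInter_atTop
      (fun k => (measurableSet_lt measurable_const hf).nullMeasurableSet) ?_
      ⟨0, measure_ne_top _ _⟩
    intro a b hab ω hω
    have : (a : ℝ) ≤ b := by exact_mod_cast hab
    exact lt_of_le_of_lt this hω
  have h2 : (⋂ k : ℕ, {ω | (k : ℝ) < f ω}) = ∅ := by
    ext ω
    simp only [Set.mem_iInter, Set.mem_ofPred_eq, Set.mem_empty_iff_false, iff_false, not_forall,
      not_lt]
    exact exists_nat_ge (f ω)
  rw [h2, measure_empty] at h1
  have h3 := (ENNReal.tendsto_toReal ENNReal.zero_ne_top).comp h1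
  rw [ENNReal.toReal_zero] at h3
  obtain ⟨k, hk⟩ := (h3.eventually_le_const hε).exists
  exact ⟨k, hk⟩

/-- As soon as `C g n < c`, the event in question lies inside the one controlled by `Ω_p`. The index
`0` is left out because `0` to a nonzero power is `0`, so the rate vanishes there. -/
lemma IsOmegaP.noFasterRate {Ω : Type*} [MeasurableSpace Ω] {P : Measure Ω} [IsFiniteMeasure P]
    {X : ℕ → Ω → ℝ} {γ : ℕ → ℝ} (h : IsOmegaP P X γ) (hX : ∀ n ω, 0 ≤ X n ω)
    (hγ : ∀ n, 0 < n → 0 < γ n) : NoFasterRate P X γ := by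
  intro C hC g hg hg0
  rw [Metric.tendsto_atTop]
  intro ε hε
  obtain ⟨c, hc, K, hK⟩ := h (ε / 2) (half_pos hε)
  have h1 : Tendsto (fun n => C * g n) atTop (𝓝 0) := by simpa using hg0.const_mul C
  obtain ⟨K', hK'⟩ := eventually_atTop.1 (h1.eventually_lt_const hc)
  refine ⟨max (max K K') 1, fun n hn => ?_⟩
  have hn1 : K ≤ n := (le_max_left _ _).trans ((le_max_left _ _).trans hn)
  have hn2 : K' ≤ n := (le_max_right _ _).trans ((le_max_left _ _).trans hn)
  have hn3 : 0 < n := (le_max_right _ _).trans hn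
  rw [Real.dist_eq, sub_zero, abs_of_nonneg measureReal_nonneg]
  refine lt_of_le_of_lt ((measureReal_mono ?_).trans (hK n hn1)) (by linarith)
  intro ω hω
  simp only [Set.mem_ofPred_eq] at hω ⊢
  rw [abs_of_nonneg (hX n ω), div_lt_iff₀ (hγ n hn3)]
  have := mul_lt_mul_of_pos_right (hK' n hn2) (hγ n hn3)
  linarith

/-- The lower bounds hold for every linear two-timescale algorithm whose noise consists of
dominated martingale differences with convergent conditional covariance. -/
theorem lowerBounds_of_hasLimitCondCov {d : ℕ} (hd : 0 < d) {S : LinearProblem d}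
    (hS : S.MatrixAssumption) {α β : ℝ} (hα : α < 1) (hαβ : β < α) (hβ : 0 < β) {Ω : Type*}
    [m0 : MeasurableSpace Ω] {P : Measure Ω} [IsProbabilityMeasure P] {θ w M₁ M₂ : ℕ → Ω → Vec d}
    {m₁ m₂ : ℝ} (hit : S.IsIterates α β θ w M₁ M₂)
    (hdom : IsDominatedMartingaleDiff P θ w M₁ M₂ m₁ m₂) (hcov : HasLimitCondCov P θ w M₁ M₂) :
    LowerBounds P S α β θ w := by
  set ℱ := noiseSigma (θ 0) (w 0) M₁ M₂ with hℱ
  have hle : ∀ n, ℱ n ≤ m0 :=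
    noiseSigma_le hdom.measurable_θ₀ hdom.measurable_w₀ hdom.measurable₁ hdom.measurable₂
  obtain ⟨hL2, Γ, hΓ, hlim⟩ := hcov
  obtain ⟨κ₁, hκ₁, hc₁⟩ := hS.1.coercive hd
  obtain ⟨κ₂, hκ₂, hc₂⟩ := hS.2.coercive hd
  set κ := min κ₁ κ₂ with hκ
  have hκ0 : 0 < κ := lt_min hκ₁ hκ₂
  have hf : Measurable[ℱ 0] fun ω => ‖θ 0 ω‖ + ‖w 0 ω‖ :=
    (measurable_norm.comp (hit.measurable 0).1).add (measurable_norm.comp (hit.measurable 0).2)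
  set T := 1 + ‖S.θstar‖ + ‖S.wstar‖ with hT
  -- Domination in terms of `θ`, `w` becomes domination in terms of the errors. Absolute values are
  -- needed as `m₁`, `m₂` carry no sign assumption.
  set m := (|m₁| + |m₂|) * T with hm
  have hbound : ∀ (c : ℝ) (v a b : Vec d), |c| ≤ |m₁| + |m₂| → ‖v‖ ≤ c * (1 + ‖a‖ + ‖b‖) →
      ‖v‖ ≤ m * (1 + ‖a - S.θstar‖ + ‖b - S.wstar‖) := by
    intro c v a b hc hv
    have h1 : ‖a‖ ≤ ‖a - S.θstar‖ + ‖S.θstar‖ := by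
      have := norm_add_le (a - S.θstar) S.θstar
      rwa [sub_add_cancel] at this
    have h2 : ‖b‖ ≤ ‖b - S.wstar‖ + ‖S.wstar‖ := by
      have := norm_add_le (b - S.wstar) S.wstar
      rwa [sub_add_cancel] at this
    have h3 : 1 + ‖a‖ + ‖b‖ ≤ T * (1 + ‖a - S.θstar‖ + ‖b - S.wstar‖) := by
      have := mul_nonneg (add_nonneg (norm_nonneg S.θstar) (norm_nonneg S.wstar))
        (add_nonneg (norm_nonneg (a - S.θstar)) (norm_nonneg (b - S.wstar)))
      rw [hT]
      linarith
    calc ‖v‖ ≤ c * (1 + ‖a‖ + ‖b‖) := hv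
      _ ≤ (|m₁| + |m₂|) * (1 + ‖a‖ + ‖b‖) := by
        gcongr
        exact (le_abs_self c).trans hc
      _ ≤ (|m₁| + |m₂|) * (T * (1 + ‖a - S.θstar‖ + ‖b - S.wstar‖)) := by gcongr
      _ = _ := by rw [hm]; ring
  have main : ∀ τ : ℝ, 0 < τ →
      (∃ c, 0 < c ∧ ∀ᶠ n : ℕ in atTop,
        P.real {ω | ‖θ n ω - S.θstar‖ < c * (n : ℝ) ^ (-(α / 2))} ≤ τ) ∧
      (∃ c, 0 < c ∧ ∀ᶠ n : ℕ in atTop,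
        P.real {ω | ‖w n ω - S.wstar‖ < c * (n : ℝ) ^ (-(β / 2))} ≤ τ) := by
    intro τ hτ
    obtain ⟨R, hR⟩ := exists_measureReal_lt_le P (hf.mono (hle 0) le_rfl) (half_pos hτ)
    set D : Set Ω := {ω | ‖θ 0 ω‖ + ‖w 0 ω‖ ≤ R} with hD
    have hD0 : MeasurableSet[ℱ 0] D := hf measurableSet_Iic
    have hDn : ∀ n, MeasurableSet[ℱ n] D := fun n => noiseSigma_mono (Nat.zero_le n) _ hD0
    have hDm : MeasurableSet D := hle 0 _ hD0
    -- `D` belongs to `ℱ 0`, so restricting to it changes none of the conditional expectations on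
    -- `D`, while the initial values become bounded. The complement costs `τ/2`.
    set μ := P.restrict D with hμ
    have hmass : μ.real Set.univ ≤ 1 := by
      rw [hμ, measureReal_restrict_apply_univ]
      exact measureReal_le_one
    have hDc : P.real Dᶜ ≤ τ / 2 := by
      have e : Dᶜ = {ω | R < ‖θ 0 ω‖ + ‖w 0 ω‖} := by
        ext ω; simp [hD]
      rw [e]; exact hR
    have split : ∀ A : Set Ω, P.real A ≤ μ.real A + τ / 2 := by
      intro A
      have h1 : A ⊆ (A ∩ D) ∪ Dᶜ := by
        intro ω hω
        by_cases h : ω ∈ D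
        · exact Or.inl ⟨hω, h⟩
        · exact Or.inr h
      have h2 : μ.real A = P.real (A ∩ D) := by
        rw [hμ, measureReal_restrict_apply' hDm]
      rw [h2]
      exact (measureReal_mono h1).trans ((measureReal_union_le _ _).trans (by linarith))
    have hac : ∀ {Q : Ω → Prop}, (∀ᵐ ω ∂P, Q ω) → ∀ᵐ ω ∂μ, Q ω := fun h => ae_restrict_of_ae h
    have hinit : ∀ (q : Ω → Vec d) (v : Vec d), Measurable[ℱ 0] q →
        (∀ ω ∈ D, ‖q ω‖ ≤ R) → MemLp (fun ω => q ω - v) 2 μ := by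
      intro q v hq hqR
      refine MemLp.of_bound ((hq.mono (hle 0) le_rfl).sub_const v).aestronglyMeasurable (R + ‖v‖) ?_
      rw [hμ, ae_restrict_iff' hDm]
      exact ae_of_all _ fun ω hω => (norm_sub_le _ _).trans (by gcongr; exact hqR ω hω)
    have hcondM : ∀ (M : Ω → Vec d) n, Integrable M P → P[M | ℱ n] =ᵐ[P] 0 → μ[M | ℱ n] =ᵐ[μ] 0 := by
      intro M n hM h0
      exact (condExp_restrict_ae_eq_restrict (hle n) (hDn n) hM).trans (hac h0)
    have hcovμ : ∀ i j, ∀ᵐ ω ∂μ, Tendsto (fun n : ℕ =>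
        (μ[fun ω' => stackedNoise M₁ M₂ (n + 1) ω' i * stackedNoise M₁ M₂ (n + 1) ω' j | ℱ n]) ω)
        atTop (𝓝 (Γ i j)) := by
      intro i j
      have h1 : ∀ n, μ[fun ω' => stackedNoise M₁ M₂ (n + 1) ω' i * stackedNoise M₁ M₂ (n + 1) ω' j
          | ℱ n] =ᵐ[μ] P[fun ω' => stackedNoise M₁ M₂ (n + 1) ω' i *
            stackedNoise M₁ M₂ (n + 1) ω' j | ℱ n] := fun n =>
        condExp_restrict_ae_eq_restrict (hle n) (hDn n)
          ((memLp_stackedNoise (hL2 n).1 (hL2 n).2 i).integrable_mul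
            (memLp_stackedNoise (hL2 n).1 (hL2 n).2 j))
      filter_upwards [ae_all_iff.2 h1, hac (hlim i j)] with ω h2 h3
      refine h3.congr fun n => (h2 n).symm
    have hres := (S.ops hS).anticoncentration hd (x := fun n ω => θ n ω - S.θstar)
      (y := fun n ω => w n ω - S.wstar) (M₁ := M₁) (M₂ := M₂) hmass hle noiseSigma_mono hα hαβ hβ hκ0
      (fun v => by
        rw [LinearProblem.ops_X_apply]
        exact (mul_le_mul_of_nonneg_right (min_le_right _ _) (sq_nonneg _)).trans (hc₂ v))
      (fun v => (mul_le_mul_of_nonneg_right (min_le_left _ _) (sq_nonneg _)).trans (hc₁ v))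
      (fun n => ((hit.measurable n).1.sub_const _).stronglyMeasurable)
      (fun n => ((hit.measurable n).2.sub_const _).stronglyMeasurable)
      (fun n => (measurable_noiseSigma_noise n).1.stronglyMeasurable)
      (fun n => (measurable_noiseSigma_noise n).2.stronglyMeasurable)
      (hinit _ _ (hit.measurable 0).1 fun ω hω =>
        (le_add_of_nonneg_right (norm_nonneg _)).trans hω)
      (hinit _ _ (hit.measurable 0).2 fun ω hω =>
        (le_add_of_nonneg_left (norm_nonneg _)).trans hω)
      (fun n => (hL2 n).1.mono_measure Measure.restrict_le_self)
      (fun n => (hL2 n).2.mono_measure Measure.restrict_le_self)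
      (fun n => hcondM _ n (hdom.integrable₁ n) (hdom.condExp₁ n))
      (fun n => hcondM _ n (hdom.integrable₂ n) (hdom.condExp₂ n))
      (m := m) (by positivity)
      (fun n => hac ((hdom.bound₁ n).mono fun ω h =>
        hbound m₁ _ _ _ (le_add_of_nonneg_right (abs_nonneg _)) h))
      (fun n => hac ((hdom.bound₂ n).mono fun ω h =>
        hbound m₂ _ _ _ (le_add_of_nonneg_left (abs_nonneg _)) h))
      (fun n ω => by
        rw [(hit n ω).1, LinearProblem.h₁_eq hS, add_sub_right_comm]; rfl)
      (fun n ω => by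
        rw [(hit n ω).2, LinearProblem.h₂_eq hS, add_sub_right_comm]; rfl)
      hΓ hcovμ (half_pos hτ)
    obtain ⟨⟨c, hc, h1⟩, ⟨c', hc', h2⟩⟩ := hres
    refine ⟨⟨c, hc, h1.mono fun n hn => ?_⟩, ⟨c', hc', h2.mono fun n hn => ?_⟩⟩
    · exact (split _).trans (by linarith)
    · exact (split _).trans (by linarith)
  have omega : ∀ (X : ℕ → Ω → ℝ) (g : ℝ), (∀ n ω, 0 ≤ X n ω) →
      (∀ τ : ℝ, 0 < τ → ∃ c, 0 < c ∧ ∀ᶠ n : ℕ in atTop,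
        P.real {ω | X n ω < c * (n : ℝ) ^ (-g)} ≤ τ) →
      IsOmegaP P X (fun n => (n : ℝ) ^ (-g)) := by
    intro X g hX h ε hε
    obtain ⟨c, hc, hev⟩ := h ε hε
    obtain ⟨K, hK⟩ := eventually_atTop.1 (hev.and (eventually_gt_atTop 0))
    refine ⟨c, hc, K, fun n hn => ?_⟩
    obtain ⟨h1, h2⟩ := hK n hn
    refine (measureReal_mono fun ω hω => ?_).trans h1
    have h3 : (0 : ℝ) < (n : ℝ) ^ (-g) := Real.rpow_pos_of_pos (by exact_mod_cast h2) _
    simp only [Set.mem_ofPred_eq] at hω ⊢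
    rwa [abs_of_nonneg (hX n ω), div_lt_iff₀ h3] at hω
  have hθ := omega (fun n ω => ‖θ n ω - S.θstar‖) (α / 2) (fun _ _ => norm_nonneg _)
    fun τ hτ => (main τ hτ).1
  have hw := omega (fun n ω => ‖w n ω - S.wstar‖) (β / 2) (fun _ _ => norm_nonneg _)
    fun τ hτ => (main τ hτ).2
  have hpos : ∀ (g : ℝ) (n : ℕ), 0 < n → (0 : ℝ) < (n : ℝ) ^ (-g) := fun g n hn =>
    Real.rpow_pos_of_pos (by exact_mod_cast hn) _
  exact ⟨hθ, hw, hθ.noFasterRate (fun _ _ => norm_nonneg _) (hpos _),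
    hw.noFasterRate (fun _ _ => norm_nonneg _) (hpos _)⟩

/-! ### Rademacher noise -/

/-- The sign `±1` encoded by a Boolean. -/
def boolSign (b : Bool) : ℝ := if b then 1 else -1

lemma boolSign_not (b : Bool) : boolSign (!b) = -boolSign b := by cases b <;> simp [boolSign]

lemma boolSign_mul_self (b : Bool) : boolSign b * boolSign b = 1 := by cases b <;> simp [boolSign]

lemma abs_boolSign (b : Bool) : |boolSign b| = 1 := by cases b <;> simp [boolSign]

/-- The uniform measure on the sign vectors. -/
def signMeasure (ι : Type) [Fintype ι] [DecidableEq ι] : Measure (ι → Bool) :=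
  (PMF.uniformOfFintype (ι → Bool)).toMeasure

instance (ι : Type) [Fintype ι] [DecidableEq ι] : IsProbabilityMeasure (signMeasure ι) :=
  inferInstanceAs (IsProbabilityMeasure (PMF.uniformOfFintype (ι → Bool)).toMeasure)

section

variable {ι : Type} [Fintype ι] [DecidableEq ι]

/-- Flip the sign number `i`. -/
def flipAt (i : ι) : Equiv.Perm (ι → Bool) :=
  Function.Involutive.toPerm (fun s => Function.update s i (!(s i))) fun s => by
    ext j
    by_cases h : j = i
    · subst h; simp
    · simp [h]

/-- Flipping one sign permutes the sign vectors, so the sum of `f` equals its own negative. -/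
lemma integral_signMeasure_eq_zero {f : (ι → Bool) → ℝ} (i : ι)
    (hf : ∀ s, f (flipAt i s) = -f s) : ∫ s, f s ∂signMeasure ι = 0 := by
  have h1 : ∑ s, f s = 0 := by
    have h2 := Equiv.sum_comp (flipAt i) f
    simp_rw [hf, Finset.sum_neg_distrib] at h2
    linarith
  rw [signMeasure, PMF.integral_eq_sum]
  simp only [PMF.uniformOfFintype_apply, smul_eq_mul]
  rw [← Finset.mul_sum, h1, mul_zero]

lemma integral_boolSign (i : ι) : ∫ s, boolSign (s i) ∂signMeasure ι = 0 :=
  integral_signMeasure_eq_zero i fun s => by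
    simp [flipAt, Function.Involutive.toPerm, boolSign_not]

lemma integral_boolSign_mul (i j : ι) :
    ∫ s, boolSign (s i) * boolSign (s j) ∂signMeasure ι = if i = j then 1 else 0 := by
  split_ifs with h
  · subst h
    simp [boolSign_mul_self]
  · refine integral_signMeasure_eq_zero i fun s => ?_
    simp [flipAt, Function.Involutive.toPerm, boolSign_not, Ne.symm h]

end

/-- The canonical space of independent sign vectors. -/
abbrev SignSpace (d : ℕ) : Type := ℕ → (Fin d ⊕ Fin d → Bool)

/-- The law of an i.i.d. sequence of uniform sign vectors. -/
def signLaw (d : ℕ) : Measure (SignSpace d) :=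
  Measure.infinitePi fun _ : ℕ => signMeasure (Fin d ⊕ Fin d)

instance (d : ℕ) : IsProbabilityMeasure (signLaw d) :=
  inferInstanceAs (IsProbabilityMeasure (Measure.infinitePi fun _ : ℕ =>
    signMeasure (Fin d ⊕ Fin d)))

/-- The vector with coordinates `c` times the signs selected by `e`. -/
def signVec {d : ℕ} (c : ℝ) (e : Fin d → Fin d ⊕ Fin d) (s : Fin d ⊕ Fin d → Bool) : Vec d :=
  WithLp.toLp 2 fun i => c * boolSign (s (e i))

/-- First component of the sign noise. -/
def signNoise₁ {d : ℕ} (c : ℝ) (n : ℕ) (ω : SignSpace d) : Vec d := signVec c Sum.inl (ω n)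

/-- Second component of the sign noise. -/
def signNoise₂ {d : ℕ} (c : ℝ) (n : ℕ) (ω : SignSpace d) : Vec d := signVec c Sum.inr (ω n)

section

variable {d : ℕ}

/-- The norm is exactly `m/√d`; scaling by `m/d` rather than `m/√d` avoids a root. -/
lemma norm_signVec_le (hd : 0 < d) {m : ℝ} (hm : 0 ≤ m) (e : Fin d → Fin d ⊕ Fin d)
    (s : Fin d ⊕ Fin d → Bool) : ‖signVec (m / d) e s‖ ≤ m := by
  have hd1 : (1 : ℝ) ≤ d := by exact_mod_cast hd
  refine abs_le_of_sq_le_sq' ?_ hm |>.2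
  rw [EuclideanSpace.norm_sq_eq]
  have h1 : ∀ i, ‖(signVec (m / d) e s).ofLp i‖ ^ 2 = (m / d) ^ 2 := by
    intro i
    simp only [signVec, Real.norm_eq_abs, abs_mul, abs_boolSign, mul_one, sq_abs]
  rw [Finset.sum_congr rfl fun i _ => h1 i, Finset.sum_const, Finset.card_univ, Fintype.card_fin,
    nsmul_eq_mul, div_pow]
  have h2 : (d : ℝ) * (m ^ 2 / d ^ 2) = m ^ 2 / d := by field_simp
  rw [h2]
  exact div_le_self (sq_nonneg m) hd1

lemma measurable_eval_comp {F : Type*} [MeasurableSpace F] (f : (Fin d ⊕ Fin d → Bool) → F)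
    (n : ℕ) : Measurable fun ω : SignSpace d => f (ω n) :=
  (Measurable.of_discrete (f := f)).comp (measurable_pi_apply n)

lemma integral_eval_comp {F : Type*} [NormedAddCommGroup F] [NormedSpace ℝ F] [MeasurableSpace F]
    [BorelSpace F] [SecondCountableTopology F]
    (f : (Fin d ⊕ Fin d → Bool) → F) (n : ℕ) :
    ∫ ω, f (ω n) ∂signLaw d = ∫ s, f s ∂signMeasure (Fin d ⊕ Fin d) := by
  have h := measurePreserving_eval_infinitePi (fun _ : ℕ => signMeasure (Fin d ⊕ Fin d)) n
  rw [← h.map_eq, integral_map h.measurable.aemeasurable]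
  · rfl
  · exact (Measurable.of_discrete (f := f)).aestronglyMeasurable

/-- Functions of the next sign vector are independent of the past. -/
lemma condExp_signLaw {F : Type*} [NormedAddCommGroup F] [NormedSpace ℝ F] [CompleteSpace F]
    [MeasurableSpace F] [BorelSpace F] [SecondCountableTopology F] (c₁ c₂ : ℝ) (θ₀ w₀ : Vec d)
    (f : (Fin d ⊕ Fin d → Bool) → F) (n : ℕ) :
    (signLaw d)[fun ω => f (ω (n + 1)) | noiseSigma (fun _ => θ₀) (fun _ => w₀)
      (signNoise₁ c₁) (signNoise₂ c₂) n] =ᵐ[signLaw d]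
      fun _ => ∫ s, f s ∂signMeasure (Fin d ⊕ Fin d) := by
  set m : ℕ → MeasurableSpace (SignSpace d) := fun k =>
    MeasurableSpace.comap (fun ω : SignSpace d => ω k) inferInstance with hm
  have hmle : ∀ k, m k ≤ MeasurableSpace.pi := fun k => (measurable_pi_apply k).comap_le
  have hind : ProbabilityTheory.iIndep m (signLaw d) := by
    have h1 := ProbabilityTheory.iIndepFun_infinitePi
      (P := fun _ : ℕ => signMeasure (Fin d ⊕ Fin d))
      (X := fun _ s => s) (fun _ => measurable_id)
    exact h1
  have hdisj : Disjoint ({n + 1} : Set ℕ) (Set.Icc 1 n) := by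
    rw [Set.disjoint_singleton_left, Set.mem_Icc]
    omega
  have hI := ProbabilityTheory.indep_iSup_of_disjoint hmle hind hdisj
  have hcomp : ∀ (k : ℕ) (g : (Fin d ⊕ Fin d → Bool) → Vec d),
      MeasurableSpace.comap (fun ω : SignSpace d => g (ω k)) inferInstance ≤ m k := by
    intro k g
    have : Measurable[m k] fun ω : SignSpace d => g (ω k) :=
      (Measurable.of_discrete (f := g)).comp (comap_measurable _)
    exact this.comap_le
  -- Constant initial values generate nothing, so the past involves only the sign vectors `1, …, n`.
  have hle : noiseSigma (fun _ : SignSpace d => θ₀) (fun _ => w₀) (signNoise₁ c₁) (signNoise₂ c₂) n ≤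
      ⨆ k ∈ Set.Icc 1 n, m k := by
    refine sup_le (sup_le ?_ ?_) (iSup₂_le fun k hk => ?_)
    · rw [MeasurableSpace.comap_const]; exact bot_le
    · rw [MeasurableSpace.comap_const]; exact bot_le
    · have hk' : k ∈ Set.Icc 1 n := by simpa using hk
      exact (sup_le (hcomp k _) (hcomp k _)).trans (le_iSup₂_of_le k hk' le_rfl)
  have hle' : ⨆ k ∈ Set.Icc 1 n, m k ≤ MeasurableSpace.pi := iSup₂_le fun k _ => hmle k
  have hind2 : ProbabilityTheory.Indep (m (n + 1)) (noiseSigma (fun _ : SignSpace d => θ₀)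
      (fun _ => w₀) (signNoise₁ c₁) (signNoise₂ c₂) n) (signLaw d) := by
    refine ProbabilityTheory.indep_of_indep_of_le_left
      (ProbabilityTheory.indep_of_indep_of_le_right hI hle) ?_
    exact le_iSup₂_of_le (n + 1) (Set.mem_singleton _) le_rfl
  have hfm : StronglyMeasurable[m (n + 1)] fun ω : SignSpace d => f (ω (n + 1)) := by
    have : Measurable[m (n + 1)] fun ω : SignSpace d => f (ω (n + 1)) :=
      (Measurable.of_discrete (f := f)).comp (comap_measurable _)
    exact this.stronglyMeasurable
  have h := condExp_indep_eq (hmle (n + 1)) (hle.trans hle') hfm hind2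
  rw [integral_eval_comp f (n + 1)] at h
  exact h

lemma integral_signVec_eq_zero (c : ℝ) (e : Fin d → Fin d ⊕ Fin d) :
    ∫ s, signVec c e s ∂signMeasure (Fin d ⊕ Fin d) = 0 := by
  have hi : Integrable (signVec c e) (signMeasure (Fin d ⊕ Fin d)) := .of_finite
  ext i
  have h1 := (EuclideanSpace.proj (𝕜 := ℝ) i : Vec d →L[ℝ] ℝ).integral_comp_comm hi
  have h2 : ∀ s, (EuclideanSpace.proj (𝕜 := ℝ) i : Vec d →L[ℝ] ℝ) (signVec c e s) =
    c * boolSign (s (e i)) := fun s => rfl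
  simp_rw [h2] at h1
  rw [integral_const_mul, integral_boolSign, mul_zero] at h1
  exact h1.symm

end

/-- The iterates of a two-timescale recursion driven by given noise. -/
def iterates {Ω : Type*} {d : ℕ} (S : LinearProblem d) (α β : ℝ) (θ₀ w₀ : Vec d)
    (M₁ M₂ : ℕ → Ω → Vec d) : ℕ → Ω → Vec d × Vec d
  | 0, _ => (θ₀, w₀)
  | n + 1, ω =>
    let v := iterates S α β θ₀ w₀ M₁ M₂ n ω
    (v.1 + ((n : ℝ) + 1) ^ (-α) • (S.h₁ v.1 v.2 + M₁ (n + 1) ω),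
      v.2 + ((n : ℝ) + 1) ^ (-β) • (S.h₂ v.1 v.2 + M₂ (n + 1) ω))

/-- Every linear problem can be run with sign noise, for which all assumptions hold. -/
theorem exists_algorithm {d : ℕ} (hd : 0 < d) (S : LinearProblem d) (α β : ℝ) {m₁ m₂ : ℝ}
    (hm₁ : 0 < m₁) (hm₂ : 0 < m₂) (θ₀ w₀ : Vec d) :
    ∃ (θ w M₁ M₂ : ℕ → SignSpace d → Vec d),
      (∀ ω, θ 0 ω = θ₀ ∧ w 0 ω = w₀) ∧ S.IsIterates α β θ w M₁ M₂ ∧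
      IsDominatedMartingaleDiff (signLaw d) θ w M₁ M₂ m₁ m₂ ∧
      HasLimitCondCov (signLaw d) θ w M₁ M₂ := by
  have hd0 : (0 : ℝ) < d := by exact_mod_cast hd
  set c₁ := m₁ / d with hc₁
  set c₂ := m₂ / d with hc₂
  set it := iterates S α β θ₀ w₀ (signNoise₁ c₁) (signNoise₂ c₂) with hit
  have hmeas₁ : ∀ n, Measurable (signNoise₁ (d := d) c₁ n) := fun n => measurable_eval_comp _ n
  have hmeas₂ : ∀ n, Measurable (signNoise₂ (d := d) c₂ n) := fun n => measurable_eval_comp _ n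
  have hb₁ : ∀ n ω, ‖signNoise₁ (d := d) c₁ n ω‖ ≤ m₁ := fun n ω => norm_signVec_le hd hm₁.le _ _
  have hb₂ : ∀ n ω, ‖signNoise₂ (d := d) c₂ n ω‖ ≤ m₂ := fun n ω => norm_signVec_le hd hm₂.le _ _
  have hL₁ : ∀ n, MemLp (signNoise₁ (d := d) c₁ n) 2 (signLaw d) := fun n =>
    MemLp.of_bound (hmeas₁ n).aestronglyMeasurable m₁ (ae_of_all _ (hb₁ n))
  have hL₂ : ∀ n, MemLp (signNoise₂ (d := d) c₂ n) 2 (signLaw d) := fun n =>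
    MemLp.of_bound (hmeas₂ n).aestronglyMeasurable m₂ (ae_of_all _ (hb₂ n))
  refine ⟨fun n ω => (it n ω).1, fun n ω => (it n ω).2, signNoise₁ c₁, signNoise₂ c₂,
    fun ω => ⟨rfl, rfl⟩, fun n ω => ⟨rfl, rfl⟩, ?_, ?_⟩
  · exact
      { measurable_θ₀ := measurable_const
        measurable_w₀ := measurable_const
        measurable₁ := fun n => hmeas₁ _
        measurable₂ := fun n => hmeas₂ _
        integrable₁ := fun n => (hL₁ _).integrable one_le_two
        integrable₂ := fun n => (hL₂ _).integrable one_le_two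
        condExp₁ := fun n => by
          refine (condExp_signLaw c₁ c₂ θ₀ w₀ (signVec c₁ Sum.inl) n).trans ?_
          rw [integral_signVec_eq_zero]
          rfl
        condExp₂ := fun n => by
          refine (condExp_signLaw c₁ c₂ θ₀ w₀ (signVec c₂ Sum.inr) n).trans ?_
          rw [integral_signVec_eq_zero]
          rfl
        bound₁ := fun n => ae_of_all _ fun ω => (hb₁ _ ω).trans
          (le_mul_of_one_le_right hm₁.le (by
            linarith [norm_nonneg (it n ω).1, norm_nonneg (it n ω).2]))
        bound₂ := fun n => ae_of_all _ fun ω => (hb₂ _ ω).trans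
          (le_mul_of_one_le_right hm₂.le (by
            linarith [norm_nonneg (it n ω).1, norm_nonneg (it n ω).2])) }
  · set c : Fin d ⊕ Fin d → ℝ := Sum.elim (fun _ => c₁) (fun _ => c₂) with hc
    have hcpos : ∀ i, 0 < c i := by
      rintro (i | i)
      · exact div_pos hm₁ hd0
      · exact div_pos hm₂ hd0
    -- Distinct signs are uncorrelated and independent of the past, so the conditional covariance is
    -- this constant diagonal matrix for every `n`.
    refine ⟨fun n => ⟨hL₁ _, hL₂ _⟩, Matrix.diagonal fun i => c i ^ 2, ?_, fun i j => ?_⟩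
    · exact Matrix.PosDef.diagonal fun i => pow_pos (hcpos i) 2
    · have hstack : ∀ (n : ℕ) (ω : SignSpace d) (k : Fin d ⊕ Fin d),
          stackedNoise (signNoise₁ c₁) (signNoise₂ c₂) n ω k = c k * boolSign (ω n k) := by
        rintro n ω (k | k) <;> rfl
      have hval : ∀ n : ℕ, (signLaw d)[fun ω' =>
          stackedNoise (signNoise₁ c₁) (signNoise₂ c₂) (n + 1) ω' i *
          stackedNoise (signNoise₁ c₁) (signNoise₂ c₂) (n + 1) ω' j |
          noiseSigma (fun _ => θ₀) (fun _ => w₀) (signNoise₁ c₁) (signNoise₂ c₂) n]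
          =ᵐ[signLaw d] fun _ => Matrix.diagonal (fun i => c i ^ 2) i j := by
        intro n
        have h1 := condExp_signLaw c₁ c₂ θ₀ w₀
          (fun s => (c i * boolSign (s i)) * (c j * boolSign (s j))) n
        simp only [hstack]
        refine h1.trans (Eventually.of_forall fun ω => ?_)
        have h2 : ∀ s : Fin d ⊕ Fin d → Bool, (c i * boolSign (s i)) * (c j * boolSign (s j)) =
          c i * c j * (boolSign (s i) * boolSign (s j)) := fun s => by ring
        simp_rw [h2]
        rw [integral_const_mul, integral_boolSign_mul, Matrix.diagonal_apply]
        split_ifs with h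
        · subst h; ring
        · ring
      filter_upwards [ae_all_iff.2 hval] with ω hω
      exact tendsto_const_nhds.congr fun n => (hω n).symm

end

/-! ### The theorem: the sign-noise example is an instance of the general lower bound. -/

theorem proposition1 (d : ℕ) (hd : 0 < d) (S : LinearProblem d) (hS : S.MatrixAssumption)
    (α β : ℝ) (hα : α < 1) (hαβ : β < α) (hβ : 0 < β) :
    (∀ (m₁ m₂ : ℝ), 0 < m₁ → 0 < m₂ → ∀ (θ₀ w₀ : Vec d),
      ∃ (Ω : Type) (_ : MeasurableSpace Ω) (P : Measure Ω) (_ : IsProbabilityMeasure P)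
        (θ w M₁ M₂ : ℕ → Ω → Vec d),
        (∀ ω, θ 0 ω = θ₀ ∧ w 0 ω = w₀) ∧
        S.IsIterates α β θ w M₁ M₂ ∧
        IsDominatedMartingaleDiff P θ w M₁ M₂ m₁ m₂ ∧
        HasLimitCondCov P θ w M₁ M₂ ∧
        LowerBounds P S α β θ w) ∧
    (∀ (Ω : Type u) [MeasurableSpace Ω] (P : Measure Ω) [IsProbabilityMeasure P]
      (θ w M₁ M₂ : ℕ → Ω → Vec d) (m₁ m₂ : ℝ),
        S.IsIterates α β θ w M₁ M₂ →
        IsDominatedMartingaleDiff P θ w M₁ M₂ m₁ m₂ →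
        HasLimitCondCov P θ w M₁ M₂ →
        LowerBounds P S α β θ w) := by
  refine ⟨fun m₁ m₂ hm₁ hm₂ θ₀ w₀ => ?_, fun Ω _ P _ θ w M₁ M₂ m₁ m₂ hit hdom hcov =>
    lowerBounds_of_hasLimitCondCov hd hS hα hαβ hβ hit hdom hcov⟩
  obtain ⟨θ, w, M₁, M₂, h0, hit, hdom, hcov⟩ := exists_algorithm hd S α β hm₁ hm₂ θ₀ w₀
  exact ⟨SignSpace d, inferInstance, signLaw d, inferInstance, θ, w, M₁, M₂, h0, hit, hdom, hcov,
    lowerBounds_of_hasLimitCondCov hd hS hα hαβ hβ hit hdom hcov⟩
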